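/- Let $S$ be a set of prime numbers and let $\bar S$ be the set of primes not in $S$. For a set $T$ of primes let $P(T)$ be the set of positive integers all of whose prime factors lie in $T$; thus $P(\bar S)$ is the set of positive integers divisible by no prime in $S$. For a set $T$ of primes and $n\ge 1$, let $Q_n$ be the largest divisor of $n$ all of whose prime factors lie in $T$, let $C_n\le S_n$ be the cyclic group generated by an $n$-cycle, and let $L_n^T$ be the Frobenius characteristic of the $S_n$-module $\exp\left(\frac{2\pi i}{n}Q_n\right)\big\uparrow_{C_n}^{S_n}$ induced from the one-dimensional representation of $C_n$ in which the generator acts as the scalar $\exp\left(\frac{2\pi i}{n}Q_n\right)$. Put $L^T=\sum_{n\ge1}L^T_n$. For a partition $\lambda$ with $m_i$ parts equal to $i$, write $H_\lambda[L^T]=\prod_{i:\,m_i\ge1}h_{m_i}[L_i^T]$ (plethysm), with $H_\emptyset[L^T]=1$, so that $\sum_{\lambda\vdash n}H_\lambda[L^T]$ is the degree $n$ component of the symmetric power $H[L^T]=\sum_{r\ge0}h_r[L^T]$. Then for every $n\ge0$ the following sums of power sum symmetric functions are Schur-positive, i.e. are linear combinations of Schur functions with nonnegative integer coefficients: $$(1)\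 \sum_{\lambda\vdash n:\ \lambda_i\in P(S)}p_\lambda,\qquad\qquad (2)\ \sum_{\lambda\vdash n:\ \lambda_i\in P(\bar S)}p_\lambda .$$ Moreover these sums are the degree $n$ components of the symmetric powers of $L^S$ and of $L^{\bar S}$ respectively: $$\sum_{\lambda\vdash n:\ \lambda_i\in P(S)}p_\lambda=\sum_{\lambda\vdash n}H_\lambda[L^S],\qquad \sum_{\lambda\vdash n:\ \lambda_i\in P(\bar S)}p_\lambda=\sum_{\lambda\vdash n}H_\lambda[L^{\bar S}].$$ -/

import Mathlib

noncomputable section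

/-- Complex formal power series in the countably many variables `x_0, x_1, x_2, …`.
Symmetric functions (with complex coefficients) are regarded as elements of this ring. -/
abbrev SymPS : Type := MvPowerSeries ℕ ℂ

open Classical in
/-- The power sum `p_k = ∑_i x_i ^ k` (for `k ≥ 1`). -/
def powerSum (k : ℕ) : SymPS := fun α => if ∃ i, α = Finsupp.single i k then 1 else 0

/-- `p_lam = ∏_i p_{lam_i}` for a partition `lam`. -/
def powerSumPart {n : ℕ} (lam : n.Partition) : SymPS := (lam.parts.map powerSum).prod

/-- The content of a semistandard tableau `T`, as an exponent vector: `k` has as exponent the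
number of cells of `T` with entry `k`. -/
def tableauContent {mu : YoungDiagram} (T : SemistandardYoungTableau mu) : ℕ →₀ ℕ :=
  ∑ c ∈ mu.cells, Finsupp.single (T c.1 c.2) 1

/-- The Schur function `s_mu = ∑_T x^T`, the sum over all semistandard tableaux of shape `mu`. -/
def schur (mu : YoungDiagram) : SymPS :=
  fun α => (Nat.card {T : SemistandardYoungTableau mu // tableauContent T = α} : ℂ)

/-- `f` is Schur-positive: a (finite) combination of Schur functions with nonnegative integer
coefficients. -/
def SchurPositive (f : SymPS) : Prop :=
  ∃ c : YoungDiagram →₀ ℕ, f = ∑ mu ∈ c.support, (c mu : ℂ) • schur mu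

/-- The plethysm `p_k[f]`, i.e. `f(x_0^k, x_1^k, …)`, for `k ≥ 1` (and `0` for `k = 0`). -/
def powerPlethysm (k : ℕ) (f : SymPS) : SymPS :=
  if hk : k ≠ 0 then MvPowerSeries.expand k hk f else 0

/-- `z_lam = ∏_i i^{m_i} m_i!`, where `m_i` is the number of parts of `lam` equal to `i`. -/
def zPart {n : ℕ} (lam : n.Partition) : ℕ :=
  ∏ i ∈ lam.parts.toFinset, i ^ lam.parts.count i * (lam.parts.count i).factorial

/-- The plethysm `h_m[f]` of the complete homogeneous symmetric function
`h_m = ∑_{lam ⊢ m} z_lam⁻¹ p_lam` with `f`; recall that `g ↦ g[f]` is the algebra homomorphism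
that sends `p_k` to `p_k[f]`. -/
def hPlethysm (m : ℕ) (f : SymPS) : SymPS :=
  ∑ lam : m.Partition, (zPart lam : ℂ)⁻¹ • (lam.parts.map fun k => powerPlethysm k f).prod

/-- `H_lam[Q] = ∏_i h_{m_i}[q_i]`, where `m_i` is the number of parts of `lam` equal to `i`. -/
def higherH (Q : ℕ → SymPS) {n : ℕ} (lam : n.Partition) : SymPS :=
  ∏ i ∈ lam.parts.toFinset, hPlethysm (lam.parts.count i) (Q i)

/-- The component of degree `n` of the symmetric power `H[Q] = ∑_r h_r[Q]` of
`Q = q_1 + q_2 + ⋯` (`q_i` homogeneous of degree `i`), namely `∑_{lam ⊢ n} H_lam[Q]`. -/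
def symmetricPower (Q : ℕ → SymPS) (n : ℕ) : SymPS := ∑ lam : n.Partition, higherH Q lam

/-- The Frobenius characteristic `ch V = (1 / n!) ∑_σ χ_V(σ) p_{cycle type of σ}` of a
representation of the symmetric group on a set `X` with `n` elements. -/
def frobeniusChar {X : Type} [Fintype X] [DecidableEq X] {V : Type} [AddCommGroup V] [Module ℂ V]
    (ρ : Representation ℂ (Equiv.Perm X) V) : SymPS :=
  ((Fintype.card X).factorial : ℂ)⁻¹ •
    ∑ σ : Equiv.Perm X, ρ.character σ • powerSumPart σ.partition

/-- The inclusion of the cyclic group `C_n` into the symmetric group `S_n` of permutations of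
`ZMod n`: the generator is sent to the `n`-cycle `x ↦ 1 + x`. -/
def cyclicInclusion (n : ℕ) : Multiplicative (ZMod n) →* Equiv.Perm (ZMod n) :=
  MulAction.toPermHom (Multiplicative (ZMod n)) (ZMod n)

/-- The one-dimensional representation of `C_n` in which the generator acts as the scalar
`exp ((2 π i / n) * r)`. -/
def cyclicRep (n : ℕ) [NeZero n] (r : ℕ) : Representation ℂ (Multiplicative (ZMod n)) ℂ :=
  ((algebraMap ℂ (Module.End ℂ ℂ)).toMonoidHom).comp
    ((ZMod.stdAddChar (N := n)).mulShift (r : ZMod n)).toMonoidHom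

/-- The `S_n`-module `exp ((2 π i / n) * r) ↑_{C_n}^{S_n}` induced from `C_n`. -/
def foulkesRep (n : ℕ) [NeZero n] (r : ℕ) :
    Representation ℂ (Equiv.Perm (ZMod n))
      (Representation.IndV (cyclicInclusion n) (cyclicRep n r)) :=
  Representation.ind (cyclicInclusion n) (cyclicRep n r)

open Classical in
/-- The factor `Q_n = ∏_{q ∈ S} q ^ {a_q(n)}` of `n = ∏_q q ^ {a_q(n)}`. -/
def primesPart (S : Set ℕ) (n : ℕ) : ℕ :=
  n.factorization.prod fun q a => if q ∈ S then q ^ a else 1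

/-- The sequence `L^S_n = ch (exp ((2 π i / n) * Q_n) ↑_{C_n}^{S_n})`, `n ≥ 1`
(there is no term of degree `0`). -/
def modL (S : Set ℕ) (n : ℕ) : SymPS :=
  if hn : n = 0 then 0 else
    haveI : NeZero n := ⟨hn⟩
    frobeniusChar (foulkesRep n (primesPart S n))

/-- The set of all primes that are not in `S`. -/
def primesCompl (S : Set ℕ) : Set ℕ := {q | q.Prime ∧ q ∉ S}

/-- `P(S)`: the positive integers all of whose prime factors lie in `S`. -/
def primeMonoid (S : Set ℕ) : Set ℕ := {n | 1 ≤ n ∧ ∀ q : ℕ, q.Prime → q ∣ n → q ∈ S}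

open Classical in
/-- `∑ p_lam` over all partitions `lam` of `n` with all parts in `T`. -/
def powerSumSum (T : Set ℕ) (n : ℕ) : SymPS :=
  ∑ lam : n.Partition with ∀ k ∈ lam.parts, k ∈ T, powerSumPart lam

end

/-!
The coefficients of a power sum product in the monomials count the colorings fixed by a permutation,
so the expansion of power sums into Schur functions goes through Pieri's rule, proved by the local
rule of the Robinson-Schensted-Knuth correspondence. Inverting the Kostka matrix gives a class
function for each Young diagram; these are orthonormal integer combinations of permutation
characters, so an irreducible character equals one of them up to sign, and its pairing with
permutation characters fixes the sign. Hence Frobenius characteristics are Schur-positive.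

By Frobenius reciprocity `L_n^T` is the cycle index of `C_n` weighted by a linear character. Such
weighted cycle indices are closed under products and, through wreath products, under `h_m[·]`, so
every `H_λ[L^T]` is again the Frobenius characteristic of an induced representation.

Both sides of the identity satisfy a Newton recursion `n a_n = ∑_j b_j a_{n - j}`. The coefficients
agree because, for every `m`, the sum of `ζ ^ Q_{m * ord ζ}` over the `l`-th roots of unity `ζ` is
`l` if all prime factors of `l` lie in `T`, and `0` otherwise: for a prime factor `q` of `l` outside
`T`, the exponent is prime to `q` and does not change when `ζ` is multiplied by a `q`-th root of
unity, so the sum over each orbit of the group of `q`-th roots of unity vanishes.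
-/

open Equiv MvPowerSeries

section GeneratingSeries

variable {σ R Y Z : Type*}

/-- The generating series `∑_y x ^ w y` of a type `Y` whose elements carry a weight `w y`, counted
by `Nat.card`; it is meaningful when there are finitely many elements of each weight. -/
noncomputable def genSeries [Semiring R] (w : Y → σ →₀ ℕ) : MvPowerSeries σ R :=
  fun α => (Nat.card {y // w y = α} : R)

theorem coeff_genSeries [Semiring R] (w : Y → σ →₀ ℕ) (α : σ →₀ ℕ) :
    coeff α (genSeries w : MvPowerSeries σ R) = (Nat.card {y // w y = α} : R) := rfl

theorem genSeries_congr [Semiring R] (e : Y ≃ Z) {w : Y → σ →₀ ℕ} {v : Z → σ →₀ ℕ}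
    (h : ∀ y, v (e y) = w y) : (genSeries w : MvPowerSeries σ R) = genSeries v := by
  ext α
  simp only [coeff_genSeries]
  exact congrArg _ (Nat.card_congr (e.subtypeEquiv fun y => by rw [h]))

theorem genSeries_of_unique [Semiring R] [Unique Y] (w : Y → σ →₀ ℕ) :
    (genSeries w : MvPowerSeries σ R) = monomial (w default) 1 := by
  classical
  ext α
  rw [coeff_genSeries, coeff_monomial]
  split_ifs with h
  · have : Unique {y // w y = α} := ⟨⟨⟨default, h.symm⟩⟩, fun y => Subsingleton.elim _ _⟩
    simp
  · have : IsEmpty {y // w y = α} := ⟨fun y => h (by rw [← y.2, Unique.eq_default y.1])⟩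
    simp

theorem genSeries_prod [Semiring R] {w : Y → σ →₀ ℕ} {v : Z → σ →₀ ℕ}
    (hw : ∀ α, Finite {y // w y = α}) (hv : ∀ α, Finite {z // v z = α}) :
    (genSeries (fun p : Y × Z => w p.1 + v p.2) : MvPowerSeries σ R) =
      genSeries w * genSeries v := by
  classical
  ext α
  let e : {p : Y × Z // w p.1 + v p.2 = α} ≃
      Σ q : Finset.HasAntidiagonal.antidiagonal α, {y // w y = q.1.1} × {z // v z = q.1.2} :=
    { toFun p := ⟨⟨(w p.1.1, v p.1.2), Finset.HasAntidiagonal.mem_antidiagonal.2 p.2⟩,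
        ⟨p.1.1, rfl⟩, ⟨p.1.2, rfl⟩⟩
      invFun q := ⟨(q.2.1.1, q.2.2.1), by
        rw [q.2.1.2, q.2.2.2]
        exact Finset.HasAntidiagonal.mem_antidiagonal.1 q.1.2⟩
      left_inv _ := rfl
      right_inv := by
        rintro ⟨⟨⟨a, b⟩, _⟩, ⟨y, hy : w y = a⟩, ⟨z, hz : v z = b⟩⟩
        subst hy hz
        rfl }
  simp only [coeff_mul, coeff_genSeries]
  rw [Nat.card_congr e, Nat.card_sigma, Nat.cast_sum,
    ← Finset.sum_coe_sort (Finset.HasAntidiagonal.antidiagonal α)]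
  exact Finset.sum_congr rfl fun q _ => by rw [Nat.card_prod, Nat.cast_mul]

theorem genSeries_sigma [Semiring R] {ι : Type*} [Fintype ι] {Y : ι → Type*}
    {w : ∀ i, Y i → σ →₀ ℕ} (hw : ∀ i α, Finite {y // w i y = α}) :
    (genSeries (fun p : Σ i, Y i => w p.1 p.2) : MvPowerSeries σ R) = ∑ i, genSeries (w i) := by
  ext α
  let e : {p : Σ i, Y i // w p.1 p.2 = α} ≃ Σ i, {y // w i y = α} :=
    { toFun p := ⟨p.1.1, p.1.2, p.2⟩
      invFun p := ⟨⟨p.1, p.2.1⟩, p.2.2⟩ }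
  rw [map_sum]
  simp only [coeff_genSeries]
  rw [Nat.card_congr e, Nat.card_sigma, Nat.cast_sum]

theorem genSeries_const_add [Semiring R] (β : σ →₀ ℕ) (w : Y → σ →₀ ℕ) :
    (genSeries (fun y => β + w y) : MvPowerSeries σ R) = monomial β 1 * genSeries w := by
  classical
  ext α
  rw [coeff_monomial_mul, coeff_genSeries, one_mul]
  split_ifs with h
  · rw [coeff_genSeries]
    refine congrArg _ (Nat.card_congr (Equiv.subtypeEquivRight fun y => ?_))
    rw [eq_tsub_iff_add_eq_of_le h, add_comm]
  · have : IsEmpty {y // β + w y = α} := ⟨fun y => h (y.2 ▸ le_self_add)⟩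
    simp

theorem exists_eq_nsmul_of_forall_dvd {k : ℕ} {α : σ →₀ ℕ} (h : ∀ i, k ∣ α i) :
    ∃ β : σ →₀ ℕ, α = k • β := by
  refine ⟨α.mapRange (· / k) (Nat.zero_div k), Finsupp.ext fun i => ?_⟩
  rw [Finsupp.smul_apply, Finsupp.mapRange_apply, smul_eq_mul, Nat.mul_div_cancel' (h i)]

theorem expand_genSeries [CommRing R] (w : Y → σ →₀ ℕ) {k : ℕ} (hk : k ≠ 0) :
    expand k hk (genSeries w : MvPowerSeries σ R) = genSeries fun y => k • w y := by
  ext α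
  by_cases h : ∀ i, k ∣ α i
  · obtain ⟨β, rfl⟩ := exists_eq_nsmul_of_forall_dvd h
    rw [coeff_expand_smul, coeff_genSeries, coeff_genSeries]
    refine congrArg _ (Nat.card_congr (Equiv.subtypeEquivRight fun y => ?_))
    exact (nsmul_right_injective hk).eq_iff.symm
  · obtain ⟨i, hi⟩ := not_forall.1 h
    have : IsEmpty {y // k • w y = α} :=
      ⟨fun y => hi (by rw [← y.2]; exact Dvd.intro _ rfl)⟩
    rw [coeff_expand_of_not_dvd _ _ _ hi, coeff_genSeries]
    simp

end GeneratingSeries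

section PowerSum

theorem powerSum_eq_genSeries {k : ℕ} (hk : k ≠ 0) :
    powerSum k = genSeries fun i : ℕ => Finsupp.single i k := by
  classical
  ext α
  change (if ∃ i, α = Finsupp.single i k then (1 : ℂ) else 0) = _
  rw [coeff_genSeries]
  split_ifs with h
  · obtain ⟨i, rfl⟩ := h
    have : Unique {j // Finsupp.single j k = Finsupp.single i k} :=
      { default := ⟨i, rfl⟩
        uniq := fun j => Subtype.ext ((Finsupp.single_left_inj hk).1 j.2) }
    simp
  · have : IsEmpty {j // Finsupp.single j k = α} := ⟨fun j => h ⟨_, j.2.symm⟩⟩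
    simp

theorem powerPlethysm_of_ne_zero {k : ℕ} (hk : k ≠ 0) (f : SymPS) :
    powerPlethysm k f = expand k hk f := dif_pos hk

theorem powerPlethysm_powerSum {k l : ℕ} (hk : k ≠ 0) (hl : l ≠ 0) :
    powerPlethysm k (powerSum l) = powerSum (k * l) := by
  rw [powerPlethysm_of_ne_zero hk, powerSum_eq_genSeries hl, expand_genSeries,
    powerSum_eq_genSeries (mul_ne_zero hk hl)]
  exact genSeries_congr (Equiv.refl ℕ) fun i => by simp

theorem powerPlethysm_pow {k : ℕ} (hk : k ≠ 0) (f : SymPS) (m : ℕ) :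
    powerPlethysm k (f ^ m) = powerPlethysm k f ^ m := by
  simp only [powerPlethysm_of_ne_zero hk, map_pow]

theorem powerPlethysm_smul (k : ℕ) (c : ℂ) (f : SymPS) :
    powerPlethysm k (c • f) = c • powerPlethysm k f := by
  unfold powerPlethysm
  split_ifs
  · exact map_smul _ c f
  · exact (smul_zero c).symm

theorem powerPlethysm_sum (k : ℕ) {ι : Type*} (s : Finset ι) (f : ι → SymPS) :
    powerPlethysm k (∑ i ∈ s, f i) = ∑ i ∈ s, powerPlethysm k (f i) := by
  unfold powerPlethysm
  split_ifs
  · exact map_sum _ f s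
  · exact Finset.sum_const_zero.symm

end PowerSum

section CycleType

variable {X Y : Type*} [Fintype X] [DecidableEq X] [Fintype Y] [DecidableEq Y]

theorem cycleType_permCongr (e : X ≃ Y) (σ : Perm X) :
    (e.permCongr σ).cycleType = σ.cycleType := by
  rw [← Perm.cycleType_extendDomain (p := fun _ : Y => True) (e.trans (Equiv.Set.univ Y).symm)]
  rfl

theorem cycleType_sumCongr_one (σ : Perm X) :
    (Perm.sumCongr σ (1 : Perm Y)).cycleType = σ.cycleType := by
  let e : X ≃ {z : X ⊕ Y // z ∈ Set.range Sum.inl} := Equiv.ofInjective Sum.inl Sum.inl_injective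
  rw [← Perm.cycleType_extendDomain e]
  congr 1
  ext (x | y)
  · exact (Perm.extendDomain_apply_image σ e x).symm
  · rw [Perm.extendDomain_apply_not_subtype _ _ (by simp)]
    rfl

theorem cycleType_one_sumCongr (τ : Perm Y) :
    (Perm.sumCongr (1 : Perm X) τ).cycleType = τ.cycleType := by
  rw [← cycleType_sumCongr_one (Y := X) τ, ← cycleType_permCongr (Equiv.sumComm Y X)]
  congr 1
  ext (x | y) <;> rfl

theorem cycleType_sumCongr (σ : Perm X) (τ : Perm Y) :
    (Perm.sumCongr σ τ).cycleType = σ.cycleType + τ.cycleType := by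
  have disjoint : (Perm.sumCongr σ (1 : Perm Y)).Disjoint (Perm.sumCongr (1 : Perm X) τ) := by
    rintro (x | y) <;> simp
  rw [← mul_one σ, ← one_mul τ, ← Perm.sumCongr_mul, disjoint.cycleType_mul,
    cycleType_sumCongr_one, cycleType_one_sumCongr, mul_one, one_mul]

theorem parts_partition_eq_cycleType_add (σ : Perm X) :
    σ.partition.parts =
      σ.cycleType + Multiset.replicate (Fintype.card X - σ.cycleType.sum) 1 := by
  rw [Perm.parts_partition, Perm.sum_cycleType]

theorem parts_partition_one :
    (1 : Perm X).partition.parts = Multiset.replicate (Fintype.card X) 1 := by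
  simp [parts_partition_eq_cycleType_add]

theorem parts_partition_permCongr (e : X ≃ Y) (σ : Perm X) :
    (e.permCongr σ).partition.parts = σ.partition.parts := by
  rw [parts_partition_eq_cycleType_add, parts_partition_eq_cycleType_add, cycleType_permCongr,
    Fintype.card_congr e]

theorem parts_partition_sumCongr (σ : Perm X) (τ : Perm Y) :
    (Perm.sumCongr σ τ).partition.parts = σ.partition.parts + τ.partition.parts := by
  have card_sub : Fintype.card X + Fintype.card Y - (σ.cycleType.sum + τ.cycleType.sum) =
      (Fintype.card X - σ.cycleType.sum) + (Fintype.card Y - τ.cycleType.sum) := by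
    have := σ.sum_cycleType_le
    have := τ.sum_cycleType_le
    omega
  simp only [parts_partition_eq_cycleType_add]
  rw [cycleType_sumCongr, Fintype.card_sum, Multiset.sum_add, card_sub, Multiset.replicate_add]
  abel

theorem parts_partition_finRotate (k : ℕ) :
    (finRotate (k + 1)).partition.parts = {k + 1} := by
  rcases k with _ | k
  · have finRotate_one : finRotate (0 + 1) = 1 :=
      Equiv.ext fun x => Subsingleton.elim (α := Fin 1) _ _
    rw [finRotate_one, parts_partition_one]
    rfl
  · rw [parts_partition_eq_cycleType_add, cycleType_finRotate]
    simp

theorem exists_permCongr_eq_of_parts_partition_eq {σ : Perm X} {τ : Perm Y}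
    (h : σ.partition.parts = τ.partition.parts) : ∃ e : X ≃ Y, e.permCongr σ = τ := by
  have card_eq : Fintype.card X = Fintype.card Y := by
    rw [← σ.partition.parts_sum, h, τ.partition.parts_sum]
  let e := Fintype.equivOfCardEq card_eq
  have conj : IsConj (e.permCongr σ) τ := by
    rw [Perm.partition_eq_of_isConj, Nat.Partition.ext_iff, parts_partition_permCongr, h]
  obtain ⟨g, hg⟩ := isConj_iff.1 conj
  exact ⟨e.trans g, hg⟩

theorem parts_partition_eq_replicate {σ : Perm X} {d : ℕ} (hd : σ ^ d = 1)
    (hfree : ∀ m x, 0 < m → m < d → (σ ^ m) x ≠ x) (hd0 : d ≠ 0) :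
    σ.partition.parts = Multiset.replicate (Fintype.card X / d) d := by
  have eq_of_fixed {k : ℕ} (hk : 0 < k) (hdvd : k ∣ d) {x : X} (hx : (σ ^ k) x = x) : k = d :=
    (Nat.le_of_dvd (Nat.pos_of_ne_zero hd0) hdvd).eq_of_not_lt fun hlt => hfree k x hk hlt hx
  have parts_eq : ∀ k ∈ σ.partition.parts, k = d := by
    intro k hk
    rw [Perm.parts_partition, Multiset.mem_add] at hk
    rcases hk with hk | hk
    · have hdvd : k ∣ d := (Perm.dvd_of_mem_cycleType hk).trans (orderOf_dvd_of_pow_eq_one hd)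
      obtain ⟨c, τ, rfl, hdisj, hc, rfl⟩ := Perm.mem_cycleType_iff.1 hk
      obtain ⟨x, hx⟩ := hc.nonempty_support
      refine eq_of_fixed (zero_lt_two.trans_le (Perm.two_le_of_mem_cycleType hk)) hdvd (x := x) ?_
      have hτx : τ x = x := (hdisj x).resolve_left (Perm.mem_support.1 hx)
      rw [hdisj.commute.mul_pow, ← hc.orderOf, pow_orderOf_eq_one, one_mul]
      exact Perm.pow_apply_eq_self_of_apply_eq_self hτx _
    · obtain ⟨hcard, rfl⟩ := Multiset.mem_replicate.1 hk
      obtain ⟨x, hx⟩ : ∃ x, x ∉ σ.support := by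
        by_contra! hall
        rw [Finset.eq_univ_of_forall hall, Finset.card_univ, Nat.sub_self] at hcard
        exact hcard rfl
      exact eq_of_fixed one_pos (one_dvd d) (x := x) (by simpa using hx)
  have card_eq : Fintype.card X = σ.partition.parts.card * d := by
    conv_lhs => rw [← σ.partition.parts_sum, Multiset.eq_replicate_of_mem parts_eq,
      Multiset.sum_replicate, smul_eq_mul]
  rw [Nat.div_eq_of_eq_mul_left (Nat.pos_of_ne_zero hd0) card_eq]
  exact Multiset.eq_replicate_of_mem parts_eq

theorem perm_sumCongr_induction {C : ∀ (X : Type) [Fintype X] [DecidableEq X], Perm X → Prop}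
    (permCongr : ∀ (X Y : Type) [Fintype X] [DecidableEq X] [Fintype Y] [DecidableEq Y] (e : X ≃ Y)
      (σ : Perm X), C X σ → C Y (e.permCongr σ))
    (one : C (Fin 0) 1)
    (finRotate : ∀ k, C (Fin (k + 1)) (finRotate (k + 1)))
    (sumCongr : ∀ (X Y : Type) [Fintype X] [DecidableEq X] [Fintype Y] [DecidableEq Y]
      (σ : Perm X) (τ : Perm Y), C X σ → C Y τ → C (X ⊕ Y) (Perm.sumCongr σ τ))
    {X : Type} [Fintype X] [DecidableEq X] (σ : Perm X) : C X σ := by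
  have exists_parts_eq (s : Multiset ℕ) (hs : ∀ k ∈ s, 0 < k) :
      ∃ (Y : Type) (_ : Fintype Y) (_ : DecidableEq Y) (τ : Perm Y),
        C Y τ ∧ τ.partition.parts = s := by
    induction s using Multiset.induction_on with
    | empty => exact ⟨Fin 0, inferInstance, inferInstance, 1, one, parts_partition_one⟩
    | cons a s ih =>
      obtain ⟨Y, _, _, τ, hτ, hparts⟩ := ih fun k hk => hs k (Multiset.mem_cons_of_mem hk)
      obtain ⟨b, rfl⟩ := Nat.exists_eq_succ_of_ne_zero (hs a (Multiset.mem_cons_self _ _)).ne'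
      refine ⟨Fin (b + 1) ⊕ Y, inferInstance, inferInstance, _, sumCongr _ _ _ _ (finRotate b) hτ,
        ?_⟩
      rw [parts_partition_sumCongr, parts_partition_finRotate, hparts, Multiset.singleton_add]
  obtain ⟨Y, _, _, τ, hτ, hparts⟩ :=
    exists_parts_eq σ.partition.parts fun k hk => σ.partition.parts_pos hk
  obtain ⟨e, rfl⟩ := exists_permCongr_eq_of_parts_partition_eq hparts
  exact permCongr _ _ e τ hτ

end CycleType

section PowerSumPart

variable {X Y : Type*} [Fintype X] [DecidableEq X] [Fintype Y] [DecidableEq Y]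

theorem powerSumPart_permCongr (e : X ≃ Y) (σ : Perm X) :
    powerSumPart (e.permCongr σ).partition = powerSumPart σ.partition := by
  unfold powerSumPart
  rw [parts_partition_permCongr]

theorem powerSumPart_one_of_isEmpty [IsEmpty X] : powerSumPart (1 : Perm X).partition = 1 := by
  unfold powerSumPart
  rw [parts_partition_one, Fintype.card_eq_zero, Multiset.replicate_zero, Multiset.map_zero,
    Multiset.prod_zero]

theorem powerSumPart_finRotate (k : ℕ) :
    powerSumPart (finRotate (k + 1)).partition = powerSum (k + 1) := by
  rw [powerSumPart, parts_partition_finRotate, Multiset.map_singleton, Multiset.prod_singleton]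

theorem powerSumPart_sumCongr (σ : Perm X) (τ : Perm Y) :
    powerSumPart (Perm.sumCongr σ τ).partition =
      powerSumPart σ.partition * powerSumPart τ.partition := by
  unfold powerSumPart
  rw [parts_partition_sumCongr, Multiset.map_add, Multiset.prod_add]

end PowerSumPart

section FixedColorings

/-- The colorings of `X` by natural numbers that are fixed by a permutation `σ` of `X`, that is,
constant on its cycles. -/
abbrev FixedColoring {X : Type*} (σ : Perm X) : Type _ := {c : X → ℕ // ∀ x, c (σ x) = c x}

/-- The content of a coloring, as an exponent vector: `i` has as exponent the number of points of
color `i`. -/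
noncomputable def content {X : Type*} [Fintype X] (c : X → ℕ) : ℕ →₀ ℕ :=
  ∑ x, Finsupp.single (c x) 1

variable {X Y : Type*} [Fintype X] [Fintype Y]

theorem content_apply (c : X → ℕ) (i : ℕ) : content c i = Nat.card {x // c x = i} := by
  classical
  simp [content, Finsupp.finsetSum_apply, Finsupp.single_apply, Fintype.card_subtype]

theorem content_comp_equiv (c : Y → ℕ) (e : X ≃ Y) : content (c ∘ e) = content c :=
  Equiv.sum_comp e fun y => Finsupp.single (c y) 1

theorem content_const (i : ℕ) :
    content (fun _ : X => i) = Finsupp.single i (Fintype.card X) := by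
  simp [content]

theorem finite_content_eq (α : ℕ →₀ ℕ) : Finite {c : X → ℕ // content c = α} := by
  have mem_support (c : {c : X → ℕ // content c = α}) (x : X) : c.1 x ∈ α.support := by
    have : Nonempty {y // c.1 y = c.1 x} := ⟨⟨x, rfl⟩⟩
    have content_eq := content_apply c.1 (c.1 x)
    rw [c.2] at content_eq
    rw [Finsupp.mem_support_iff, content_eq]
    exact Nat.card_pos.ne'
  refine Finite.of_injective (β := X → α.support) (fun c x => ⟨c.1 x, mem_support c x⟩) ?_
  intro c d h
  exact Subtype.ext (funext fun x => congrArg Subtype.val (congrFun h x))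

theorem finite_fixedColoring_content_eq (σ : Perm X) (α : ℕ →₀ ℕ) :
    Finite {c : FixedColoring σ // content c.1 = α} :=
  have := finite_content_eq (X := X) α
  Finite.of_injective (β := {c : X → ℕ // content c = α}) (fun c => ⟨c.1.1, c.2⟩) fun _ _ h =>
    Subtype.ext (Subtype.ext (Subtype.mk.inj h))

/-- The generating series by content of the colorings fixed by a permutation. -/
noncomputable def fixedColoringSeries (σ : Perm X) : SymPS :=
  genSeries fun c : FixedColoring σ => content c.1

theorem fixedColoringSeries_permCongr (e : X ≃ Y) (σ : Perm X) :
    fixedColoringSeries (e.permCongr σ) = fixedColoringSeries σ := by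
  let f : FixedColoring σ ≃ FixedColoring (e.permCongr σ) :=
    (Equiv.arrowCongr e (Equiv.refl ℕ)).subtypeEquiv fun c =>
      ⟨fun h y => by simpa using h (e.symm y), fun h x => by simpa using h (e x)⟩
  exact (genSeries_congr f fun c => content_comp_equiv c.1 e.symm).symm

theorem fixedColoringSeries_of_isEmpty [IsEmpty X] (σ : Perm X) : fixedColoringSeries σ = 1 := by
  let : Unique (FixedColoring σ) :=
    { default := ⟨isEmptyElim, isEmptyElim⟩
      uniq := fun c => Subtype.ext (Subsingleton.elim _ _) }
  rw [fixedColoringSeries, genSeries_of_unique, content, Fintype.sum_empty,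
    monomial_zero_one]

theorem fixedColoringSeries_finRotate (k : ℕ) :
    fixedColoringSeries (finRotate (k + 1)) = powerSum (k + 1) := by
  have eq_apply_zero (c : FixedColoring (finRotate (k + 1))) (i : Fin (k + 1)) :
      c.1 0 = c.1 i := by
    induction i using Fin.induction with
    | zero => rfl
    | succ i ih => rw [ih, ← c.2 i.castSucc, finRotate_apply, Fin.coeSucc_eq_succ]
  let e : ℕ ≃ FixedColoring (finRotate (k + 1)) :=
    { toFun i := ⟨fun _ => i, fun _ => rfl⟩
      invFun c := c.1 0
      left_inv _ := rfl
      right_inv c := Subtype.ext (funext (eq_apply_zero c)) }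
  rw [powerSum_eq_genSeries k.succ_ne_zero]
  exact (genSeries_congr e fun i => (content_const i).trans (by rw [Fintype.card_fin])).symm

theorem fixedColoringSeries_sumCongr (σ : Perm X) (τ : Perm Y) :
    fixedColoringSeries (Perm.sumCongr σ τ) =
      fixedColoringSeries σ * fixedColoringSeries τ := by
  let e : FixedColoring (Perm.sumCongr σ τ) ≃ FixedColoring σ × FixedColoring τ :=
    { toFun c := ⟨⟨c.1 ∘ Sum.inl, fun x => c.2 (Sum.inl x)⟩,
        ⟨c.1 ∘ Sum.inr, fun y => c.2 (Sum.inr y)⟩⟩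
      invFun p := ⟨Sum.elim p.1.1 p.2.1, Sum.rec p.1.2 p.2.2⟩
      left_inv c := Subtype.ext (Sum.elim_comp_inl_inr c.1)
      right_inv _ := rfl }
  unfold fixedColoringSeries
  rw [← genSeries_prod (finite_fixedColoring_content_eq σ) (finite_fixedColoring_content_eq τ)]
  exact genSeries_congr e fun c => (Fintype.sum_sum_type fun z => Finsupp.single (c.1 z) 1).symm

theorem powerSumPart_eq_fixedColoringSeries {X : Type} [Fintype X] [DecidableEq X] (σ : Perm X) :
    powerSumPart σ.partition = fixedColoringSeries σ := by
  refine perm_sumCongr_induction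
    (C := fun X _ _ σ => powerSumPart σ.partition = fixedColoringSeries σ) ?_ ?_ ?_ ?_ σ
  · intro X Y _ _ _ _ e σ hσ
    rw [powerSumPart_permCongr, fixedColoringSeries_permCongr, hσ]
  · rw [powerSumPart_one_of_isEmpty, fixedColoringSeries_of_isEmpty]
  · intro k
    rw [powerSumPart_finRotate, fixedColoringSeries_finRotate]
  · intro X Y _ _ _ _ σ τ hσ hτ
    rw [powerSumPart_sumCongr, fixedColoringSeries_sumCongr, hσ, hτ]

end FixedColorings

section YoungDiagramRows

open YoungDiagram

variable {μ ν : YoungDiagram}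

theorem rowLen_ext (h : ∀ i, μ.rowLen i = ν.rowLen i) : μ = ν := by
  ext ⟨i, j⟩
  rw [mem_cells, mem_cells, mem_iff_lt_rowLen, mem_iff_lt_rowLen, h]

theorem le_iff_rowLen_le : μ ≤ ν ↔ ∀ i, μ.rowLen i ≤ ν.rowLen i := by
  refine ⟨fun h i => ?_, fun h ⟨i, j⟩ hc => ?_⟩
  · by_contra! hlt
    exact (mem_iff_lt_rowLen.1 (h (mem_iff_lt_rowLen.2 hlt : (i, ν.rowLen i) ∈ μ))).false
  · exact mem_iff_lt_rowLen.2 ((mem_iff_lt_rowLen.1 hc).trans_le (h i))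

theorem card_le_card_of_diagram_le (h : μ ≤ ν) : μ.card ≤ ν.card :=
  Finset.card_le_card (cells_subset_iff.2 h)

theorem card_bot_diagram : (⊥ : YoungDiagram).card = 0 :=
  Finset.card_empty

theorem diagram_card_eq_zero_iff : μ.card = 0 ↔ μ = ⊥ := by
  rw [YoungDiagram.card, Finset.card_eq_zero, ← cells_bot, YoungDiagram.ext_iff]

theorem rowLen_bot (i : ℕ) : (⊥ : YoungDiagram).rowLen i = 0 := by
  by_contra h
  exact notMem_bot (i, 0) (mem_iff_lt_rowLen.2 (Nat.pos_of_ne_zero h))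

theorem rowLen_le_card (μ : YoungDiagram) (i : ℕ) : μ.rowLen i ≤ μ.card := by
  rw [rowLen_eq_card]
  exact Finset.card_le_card (Finset.filter_subset _ _)

theorem rowLen_eq_zero_of_card_le {N : ℕ} (h : μ.card ≤ N) : μ.rowLen N = 0 := by
  by_contra hne
  have mem_col : (N, 0) ∈ μ := mem_iff_lt_rowLen.2 (Nat.pos_of_ne_zero hne)
  have colLen_le : μ.colLen 0 ≤ μ.card := by
    rw [colLen_eq_card]
    exact Finset.card_le_card (Finset.filter_subset _ _)
  exact (mem_iff_lt_colLen.1 mem_col).not_ge (colLen_le.trans h)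

theorem card_eq_sum_rowLen {N : ℕ} (h : μ.rowLen N = 0) :
    μ.card = ∑ i ∈ Finset.range N, μ.rowLen i := by
  have mem_range : ∀ c ∈ μ.cells, c.1 ∈ Finset.range N := by
    rintro ⟨i, j⟩ hc
    rw [Finset.mem_range]
    by_contra! hi
    exact ((mem_iff_lt_rowLen.1 hc).trans_le (μ.rowLen_anti _ _ hi)).not_ge (h ▸ Nat.zero_le j)
  rw [YoungDiagram.card, Finset.card_eq_sum_card_fiberwise mem_range]
  exact Finset.sum_congr rfl fun i _ => μ.rowLen_eq_card.symm

theorem finite_diagram_card_eq (n : ℕ) : {μ : YoungDiagram | μ.card = n}.Finite := by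
  refine Set.Finite.of_finite_image (f := YoungDiagram.cells) ?_ fun μ _ ν _ h => YoungDiagram.ext h
  refine (Finset.finite_toSet (Finset.range n ×ˢ Finset.range n).powerset).subset ?_
  rintro _ ⟨μ, rfl : μ.card = n, rfl⟩
  simp only [Finset.coe_powerset, Set.mem_preimage, Set.mem_powerset_iff, Finset.coe_subset]
  rintro ⟨i, j⟩ hc
  have lt_rowLen : j < μ.rowLen i := mem_iff_lt_rowLen.1 hc
  rw [Finset.mem_product, Finset.mem_range, Finset.mem_range]
  refine ⟨?_, lt_rowLen.trans_le (rowLen_le_card μ i)⟩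
  by_contra! hi
  exact Nat.not_lt_zero j (rowLen_eq_zero_of_card_le hi ▸ lt_rowLen)

/-- The Young diagram whose rows have the lengths given by an antitone function that is eventually
zero. -/
def diagramOfRowLen (f : ℕ → ℕ) (hf : Antitone f) (hf0 : ∃ N, f N = 0) : YoungDiagram where
  cells := (Finset.range (Nat.find hf0) ×ˢ Finset.range (f 0)).filter fun c => c.2 < f c.1
  isLowerSet := by
    rintro ⟨a, b⟩ ⟨c, d⟩ ⟨hca : c ≤ a, hdb : d ≤ b⟩ hab
    simp only [Finset.coe_filter, Finset.mem_product, Finset.mem_range, Set.mem_ofPred_eq] at *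
    have := hf hca
    omega

theorem rowLen_diagramOfRowLen {f : ℕ → ℕ} (hf : Antitone f) (hf0 : ∃ N, f N = 0) (i : ℕ) :
    (diagramOfRowLen f hf hf0).rowLen i = f i := by
  have mem_iff (j : ℕ) : (i, j) ∈ diagramOfRowLen f hf hf0 ↔ j < f i := by
    rw [← mem_cells]
    simp only [diagramOfRowLen, Finset.mem_filter, Finset.mem_product, Finset.mem_range]
    refine ⟨fun h => h.2, fun h => ⟨⟨?_, h.trans_le (hf (Nat.zero_le i))⟩, h⟩⟩
    by_contra! hi
    exact Nat.not_lt_zero j ((h.trans_le (hf hi)).trans_eq (Nat.find_spec hf0))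
  exact eq_of_forall_lt_iff fun j => mem_iff_lt_rowLen.symm.trans (mem_iff j)

end YoungDiagramRows

section HorizontalStrips

open YoungDiagram

/-- The skew diagram `μ / ν` is a horizontal strip: `ν` is contained in `μ` and the row lengths of
`ν` and `μ` interlace. -/
def IsStrip (ν μ : YoungDiagram) : Prop :=
  ∀ i, μ.rowLen (i + 1) ≤ ν.rowLen i ∧ ν.rowLen i ≤ μ.rowLen i

variable {μ ν : YoungDiagram}

theorem IsStrip.le (h : IsStrip ν μ) : ν ≤ μ :=
  le_iff_rowLen_le.2 fun i => (h i).2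

theorem isStrip_iff : IsStrip ν μ ↔ ν ≤ μ ∧ ∀ i j, (i + 1, j) ∈ μ → (i, j) ∈ ν := by
  refine ⟨fun h => ⟨h.le, fun i j hc => ?_⟩, fun h i => ⟨?_, le_iff_rowLen_le.1 h.1 i⟩⟩
  · exact mem_iff_lt_rowLen.2 ((mem_iff_lt_rowLen.1 hc).trans_le (h i).1)
  · by_contra! hlt
    exact (mem_iff_lt_rowLen.1 (h.2 i _ (mem_iff_lt_rowLen.2 hlt))).false

theorem finite_stripsBelow (μ : YoungDiagram) : {ν | IsStrip ν μ}.Finite := by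
  refine ((Set.finite_Iic μ.card).biUnion fun n _ => finite_diagram_card_eq n).subset ?_
  exact fun ν hν => Set.mem_biUnion (card_le_card_of_diagram_le (IsStrip.le hν)) rfl

/-- The diagrams `ν` such that `μ / ν` is a horizontal strip. -/
noncomputable def stripsBelow (μ : YoungDiagram) : Finset YoungDiagram :=
  (finite_stripsBelow μ).toFinset

theorem mem_stripsBelow : ν ∈ stripsBelow μ ↔ IsStrip ν μ := by
  simp [stripsBelow]

theorem finite_stripsAbove (a : ℕ) (ν : YoungDiagram) :
    {μ | IsStrip ν μ ∧ μ.card = ν.card + a}.Finite :=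
  (finite_diagram_card_eq (ν.card + a)).subset fun _ h => h.2

/-- The diagrams `μ` such that `μ / ν` is a horizontal strip of size `a`. -/
noncomputable def stripsAbove (a : ℕ) (ν : YoungDiagram) : Finset YoungDiagram :=
  (finite_stripsAbove a ν).toFinset

theorem mem_stripsAbove {a : ℕ} : μ ∈ stripsAbove a ν ↔ IsStrip ν μ ∧ μ.card = ν.card + a := by
  simp [stripsAbove]

end HorizontalStrips

section Toggle

variable {lam rho mu nu : YoungDiagram}

theorem rowLen_eq_zero_of_add_card_le {N : ℕ} (h : lam.card + rho.card ≤ N) :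
    lam.rowLen N = 0 ∧ rho.rowLen N = 0 :=
  ⟨rowLen_eq_zero_of_card_le (by omega), rowLen_eq_zero_of_card_le (by omega)⟩

/-- The local rule of the growth diagrams of the Robinson-Schensted-Knuth correspondence: it
completes a square of horizontal strips `lam ⊆ mu ⊇ rho` by a diagram contained in `lam` and
`rho`. -/
def toggleDown (lam rho mu : YoungDiagram) (h₁ : IsStrip lam mu) (h₂ : IsStrip rho mu) :
    YoungDiagram :=
  diagramOfRowLen (fun i => min (lam.rowLen i) (rho.rowLen i) +
      max (lam.rowLen (i + 1)) (rho.rowLen (i + 1)) - mu.rowLen (i + 1))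
    (antitone_nat_of_succ_le fun i => by
      have := h₁ i
      have := h₂ i
      have := h₁ (i + 1)
      have := h₂ (i + 1)
      have := h₁ (i + 1 + 1)
      have := h₂ (i + 1 + 1)
      omega)
    ⟨lam.card + rho.card, by
      have := rowLen_eq_zero_of_add_card_le (lam := lam) (rho := rho) le_rfl
      have := rowLen_eq_zero_of_add_card_le (lam := lam) (rho := rho) (Nat.le_add_right _ 1)
      omega⟩

theorem rowLen_toggleDown (h₁ : IsStrip lam mu) (h₂ : IsStrip rho mu) (i : ℕ) :
    (toggleDown lam rho mu h₁ h₂).rowLen i = min (lam.rowLen i) (rho.rowLen i) +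
      max (lam.rowLen (i + 1)) (rho.rowLen (i + 1)) - mu.rowLen (i + 1) :=
  rowLen_diagramOfRowLen _ _ _

/-- The row lengths of `toggleUp`. -/
def toggleUpRowLen (lam rho nu : YoungDiagram) (j : ℕ) : ℕ → ℕ
  | 0 => max (lam.rowLen 0) (rho.rowLen 0) + j
  | i + 1 => min (lam.rowLen i) (rho.rowLen i) +
      max (lam.rowLen (i + 1)) (rho.rowLen (i + 1)) - nu.rowLen i

/-- The inverse of the local rule `toggleDown`, which depends in addition on the number `j` of
cells by which the first row of the new diagram is longer than those of `lam` and `rho`. -/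
def toggleUp (lam rho nu : YoungDiagram) (h₁ : IsStrip nu lam) (h₂ : IsStrip nu rho) (j : ℕ) :
    YoungDiagram :=
  diagramOfRowLen (toggleUpRowLen lam rho nu j)
    (antitone_nat_of_succ_le fun i => by
      have := h₁ i
      have := h₂ i
      rcases i with _ | i
      · simp only [toggleUpRowLen]
        omega
      · have := h₁ i
        have := h₂ i
        simp only [toggleUpRowLen]
        omega)
    ⟨lam.card + rho.card + 1, by
      have := rowLen_eq_zero_of_add_card_le (lam := lam) (rho := rho) le_rfl
      have := rowLen_eq_zero_of_add_card_le (lam := lam) (rho := rho) (Nat.le_add_right _ 1)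
      simp only [toggleUpRowLen]
      omega⟩

theorem rowLen_toggleUp_zero (h₁ : IsStrip nu lam) (h₂ : IsStrip nu rho) (j : ℕ) :
    (toggleUp lam rho nu h₁ h₂ j).rowLen 0 = max (lam.rowLen 0) (rho.rowLen 0) + j :=
  rowLen_diagramOfRowLen _ _ _

theorem rowLen_toggleUp_succ (h₁ : IsStrip nu lam) (h₂ : IsStrip nu rho) (j i : ℕ) :
    (toggleUp lam rho nu h₁ h₂ j).rowLen (i + 1) = min (lam.rowLen i) (rho.rowLen i) +
      max (lam.rowLen (i + 1)) (rho.rowLen (i + 1)) - nu.rowLen i :=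
  rowLen_diagramOfRowLen _ _ _

theorem isStrip_toggleDown (h₁ : IsStrip lam mu) (h₂ : IsStrip rho mu) :
    IsStrip (toggleDown lam rho mu h₁ h₂) lam ∧ IsStrip (toggleDown lam rho mu h₁ h₂) rho := by
  refine ⟨fun i => ?_, fun i => ?_⟩ <;>
  · rw [rowLen_toggleDown]
    have := h₁ i
    have := h₂ i
    have := h₁ (i + 1)
    have := h₂ (i + 1)
    omega

theorem isStrip_toggleUp (h₁ : IsStrip nu lam) (h₂ : IsStrip nu rho) (j : ℕ) :
    IsStrip lam (toggleUp lam rho nu h₁ h₂ j) ∧ IsStrip rho (toggleUp lam rho nu h₁ h₂ j) := by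
  refine ⟨fun i => ?_, fun i => ?_⟩ <;>
  · rw [rowLen_toggleUp_succ]
    have := h₁ i
    have := h₂ i
    rcases i with _ | i
    · rw [rowLen_toggleUp_zero]
      omega
    · rw [rowLen_toggleUp_succ]
      have := h₁ i
      have := h₂ i
      omega

theorem toggleUp_toggleDown (h₁ : IsStrip lam mu) (h₂ : IsStrip rho mu) :
    toggleUp lam rho (toggleDown lam rho mu h₁ h₂) (isStrip_toggleDown h₁ h₂).1
      (isStrip_toggleDown h₁ h₂).2 (mu.rowLen 0 - max (lam.rowLen 0) (rho.rowLen 0)) = mu := by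
  refine rowLen_ext fun i => ?_
  rcases i with _ | i
  · rw [rowLen_toggleUp_zero]
    have := h₁ 0
    have := h₂ 0
    omega
  · rw [rowLen_toggleUp_succ, rowLen_toggleDown]
    have := h₁ i
    have := h₂ i
    have := h₁ (i + 1)
    have := h₂ (i + 1)
    omega

theorem toggleDown_toggleUp (h₁ : IsStrip nu lam) (h₂ : IsStrip nu rho) (j : ℕ) :
    toggleDown lam rho (toggleUp lam rho nu h₁ h₂ j) (isStrip_toggleUp h₁ h₂ j).1
      (isStrip_toggleUp h₁ h₂ j).2 = nu := by
  refine rowLen_ext fun i => ?_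
  rw [rowLen_toggleDown, rowLen_toggleUp_succ]
  have := h₁ i
  have := h₂ i
  omega

theorem card_toggleUp_add (h₁ : IsStrip nu lam) (h₂ : IsStrip nu rho) (j : ℕ) :
    (toggleUp lam rho nu h₁ h₂ j).card + nu.card = lam.card + rho.card + j := by
  set N := lam.card + rho.card with hN
  let M (i : ℕ) : ℕ := max (lam.rowLen i) (rho.rowLen i)
  have rowLen_add (i : ℕ) : (toggleUp lam rho nu h₁ h₂ j).rowLen (i + 1) + nu.rowLen i + M i =
      lam.rowLen i + rho.rowLen i + M (i + 1) := by
    rw [rowLen_toggleUp_succ]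
    have := h₁ i
    have := h₂ i
    simp only [M]
    omega
  have sum_rowLen_add := Finset.sum_congr (rfl : Finset.range N = _) fun i _ => rowLen_add i
  have sum_M : ∑ i ∈ Finset.range N, M (i + 1) + M 0 = ∑ i ∈ Finset.range N, M i + M N :=
    (Finset.sum_range_succ' M N).symm.trans (Finset.sum_range_succ M N)
  have rowLen_N := rowLen_eq_zero_of_add_card_le hN.ge
  have rowLen_N_succ := rowLen_eq_zero_of_add_card_le (hN.ge.trans (N.le_add_right 1))
  have nu_rowLen_N : nu.rowLen N = 0 := Nat.eq_zero_of_le_zero (rowLen_N.1 ▸ (h₁ N).2)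
  have toggleUp_rowLen_N : (toggleUp lam rho nu h₁ h₂ j).rowLen (N + 1) = 0 := by
    rw [rowLen_toggleUp_succ]
    omega
  have M_N : M N = 0 := by simp only [M, rowLen_N, max_self]
  simp only [Finset.sum_add_distrib, ← card_eq_sum_rowLen nu_rowLen_N,
    ← card_eq_sum_rowLen rowLen_N.1, ← card_eq_sum_rowLen rowLen_N.2] at sum_rowLen_add
  rw [card_eq_sum_rowLen toggleUp_rowLen_N, Finset.sum_range_succ', rowLen_toggleUp_zero]
  change _ + (M 0 + j) + _ = _
  omega

end Toggle

section Pieri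

theorem sum_stripsBelow_stripsAbove {M : Type*} [AddCommMonoid M] (a : ℕ) (lam : YoungDiagram)
    (F : YoungDiagram → ℕ → M) :
    ∑ j ∈ Finset.range (a + 1), ∑ nu ∈ stripsBelow lam, ∑ rho ∈ stripsAbove (a - j) nu,
        F rho (j + (lam.card - nu.card)) =
      ∑ mu ∈ stripsAbove a lam, ∑ rho ∈ stripsBelow mu, F rho (mu.card - rho.card) := by
  simp only [Finset.sum_sigma']
  refine Finset.sum_bij'
    (fun p hp => ⟨toggleUp lam p.2.2 p.2.1 ?_ ?_ p.1, p.2.2⟩)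
    (fun q hq => ⟨q.1.rowLen 0 - max (lam.rowLen 0) (q.2.rowLen 0),
      toggleDown lam q.2 q.1 ?_ ?_, q.2⟩) ?_ ?_ ?_ ?_ ?_ <;>
    simp only [Finset.mem_sigma, mem_stripsBelow, mem_stripsAbove, Finset.mem_range] at *
  · exact hp.2.1
  · exact hp.2.2.1
  · exact hq.1.1
  · exact hq.2
  · rintro ⟨j, nu, rho⟩ ⟨hj, h₁, h₂, hcard⟩
    dsimp only at hj h₁ h₂ hcard ⊢
    have := card_toggleUp_add h₁ h₂ j
    exact ⟨⟨(isStrip_toggleUp h₁ h₂ j).1, by omega⟩, (isStrip_toggleUp h₁ h₂ j).2⟩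
  · rintro ⟨mu, rho⟩ ⟨⟨h₁, hcard⟩, h₂⟩
    dsimp only at h₁ hcard h₂ ⊢
    have hdown := isStrip_toggleDown h₁ h₂
    have card_add := card_toggleUp_add hdown.1 hdown.2
      (mu.rowLen 0 - max (lam.rowLen 0) (rho.rowLen 0))
    rw [toggleUp_toggleDown] at card_add
    have := card_le_card_of_diagram_le hdown.2.le
    exact ⟨by omega, hdown.1, hdown.2, by omega⟩
  · rintro ⟨j, nu, rho⟩ ⟨hj, h₁, h₂, hcard⟩
    simp only [toggleDown_toggleUp, rowLen_toggleUp_zero, Nat.add_sub_cancel_left]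
  · rintro ⟨mu, rho⟩ _
    simp only [toggleUp_toggleDown]
  · rintro ⟨j, nu, rho⟩ ⟨hj, h₁, h₂, hcard⟩
    dsimp only at h₁ h₂ hcard ⊢
    have := card_toggleUp_add h₁ h₂ j
    have := card_le_card_of_diagram_le h₁.le
    congr 1
    omega

/-- The Schur polynomial in the variables `x_0, …, x_{k-1}`, defined by the branching rule. -/
noncomputable def schurPoly : ℕ → YoungDiagram → SymPS
  | 0, μ => open Classical in if μ = ⊥ then 1 else 0
  | k + 1, μ => ∑ ν ∈ stripsBelow μ, X k ^ (μ.card - ν.card) * schurPoly k ν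

/-- The complete homogeneous symmetric polynomial of degree `a` in the variables
`x_0, …, x_{k-1}`. -/
noncomputable def completePoly : ℕ → ℕ → SymPS
  | 0, a => if a = 0 then 1 else 0
  | k + 1, a => ∑ j ∈ Finset.range (a + 1), X k ^ j * completePoly k (a - j)

theorem completePoly_zero_mul_schurPoly (a : ℕ) (lam : YoungDiagram) :
    completePoly 0 a * schurPoly 0 lam = ∑ μ ∈ stripsAbove a lam, schurPoly 0 μ := by
  classical
  have bot_mem : ⊥ ∈ stripsAbove a lam ↔ a = 0 ∧ lam = ⊥ := by
    rw [mem_stripsAbove, card_bot_diagram]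
    constructor
    · rintro ⟨-, h⟩
      exact ⟨by omega, diagram_card_eq_zero_iff.1 (by omega)⟩
    · rintro ⟨rfl, rfl⟩
      exact ⟨fun i => by simp only [rowLen_bot, le_refl, and_self], card_bot_diagram.symm⟩
  simp only [completePoly, schurPoly, Finset.sum_ite_eq', bot_mem]
  rw [ite_zero_mul_ite_zero, one_mul]

theorem completePoly_mul_schurPoly (k a : ℕ) (lam : YoungDiagram) :
    completePoly k a * schurPoly k lam = ∑ μ ∈ stripsAbove a lam, schurPoly k μ := by
  induction k generalizing a lam with
  | zero => exact completePoly_zero_mul_schurPoly a lam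
  | succ k ih =>
    simp only [completePoly, schurPoly]
    rw [← sum_stripsBelow_stripsAbove a lam fun rho e => X k ^ e * schurPoly k rho,
      Finset.sum_mul_sum]
    refine Finset.sum_congr rfl fun j _ => Finset.sum_congr rfl fun nu _ => ?_
    rw [← Finset.mul_sum, ← ih, pow_add, mul_mul_mul_comm]

end Pieri

section BoundedTableaux

open YoungDiagram

variable {k : ℕ} {μ ν : YoungDiagram}

/-- The semistandard tableaux of shape `μ` with entries less than `k`, whose generating series by
content is the Schur polynomial in `k` variables. -/
abbrev BoundedTableau (k : ℕ) (μ : YoungDiagram) : Type :=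
  {T : SemistandardYoungTableau μ // ∀ i j, (i, j) ∈ μ → T i j < k}

theorem semistandardYoungTableau_ext {S T : SemistandardYoungTableau μ}
    (h : ∀ i j, (i, j) ∈ μ → S i j = T i j) : S = T := by
  refine SemistandardYoungTableau.ext fun i j => ?_
  by_cases hc : (i, j) ∈ μ
  · exact h i j hc
  · rw [S.zeros hc, T.zeros hc]

theorem finite_boundedTableau (k : ℕ) (μ : YoungDiagram) : Finite (BoundedTableau k μ) := by
  refine Finite.of_injective
    (fun T (c : μ.cells) => (⟨T.1 c.1.1 c.1.2, T.2 _ _ ((mem_cells _).1 c.2)⟩ : Fin k)) ?_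
  refine fun S T h => Subtype.ext (semistandardYoungTableau_ext fun i j hc => ?_)
  exact congrArg Fin.val (congrFun h ⟨(i, j), (mem_cells _).2 hc⟩)

/-- The tableau of shape `μ` obtained from a tableau of shape `ν` by filling the horizontal strip
`μ / ν` with the entry `k`. -/
def fillStrip (h : IsStrip ν μ) (T : BoundedTableau k ν) : BoundedTableau (k + 1) μ where
  val :=
    { entry i j := if (i, j) ∈ ν then T.1 i j else if (i, j) ∈ μ then k else 0
      row_weak' := by
        intro i j₁ j₂ hj hc
        have hc₁ := μ.up_left_mem le_rfl hj.le hc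
        by_cases h₂ : (i, j₂) ∈ ν
        · have h₁ := ν.up_left_mem le_rfl hj.le h₂
          simp only [h₁, h₂, if_true]
          exact T.1.row_weak hj h₂
        · simp only [h₂, hc, hc₁, if_true, if_false]
          split_ifs with h₁
          · exact (T.2 _ _ h₁).le
          · exact le_rfl
      col_strict' := by
        intro i₁ i₂ j hi hc
        have h₁ : (i₁, j) ∈ ν := (isStrip_iff.1 h).2 _ _ (μ.up_left_mem hi le_rfl hc)
        by_cases h₂ : (i₂, j) ∈ ν
        · simp only [h₁, h₂, if_true]
          exact T.1.col_strict hi h₂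
        · simp only [h₁, h₂, hc, if_true, if_false]
          exact T.2 _ _ h₁
      zeros' := fun hc => by rw [if_neg fun hν => hc (h.le hν), if_neg hc] }
  property i j hc := by
    change (if (i, j) ∈ ν then T.1 i j else if (i, j) ∈ μ then k else 0) < k + 1
    split_ifs with h₁
    · exact (T.2 _ _ h₁).trans k.lt_succ_self
    · exact k.lt_succ_self

theorem fillStrip_apply (h : IsStrip ν μ) (T : BoundedTableau k ν) (i j : ℕ) :
    (fillStrip h T).1 i j = if (i, j) ∈ ν then T.1 i j else if (i, j) ∈ μ then k else 0 :=
  rfl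

theorem fillStrip_lt_iff (h : IsStrip ν μ) (T : BoundedTableau k ν) {i j : ℕ} (hc : (i, j) ∈ μ) :
    (fillStrip h T).1 i j < k ↔ (i, j) ∈ ν := by
  rw [fillStrip_apply, if_pos hc]
  split_ifs with h₁
  · exact iff_of_true (T.2 _ _ h₁) h₁
  · exact iff_of_false k.lt_irrefl h₁

theorem tableauContent_fillStrip (h : IsStrip ν μ) (T : BoundedTableau k ν) :
    tableauContent (fillStrip h T).1 =
      Finsupp.single k (μ.card - ν.card) + tableauContent T.1 := by
  have cells_subset := cells_subset_iff.2 h.le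
  rw [tableauContent, ← Finset.sum_sdiff cells_subset, tableauContent]
  congr 1
  · rw [Finset.sum_congr rfl (g := fun _ => Finsupp.single k 1)]
    · rw [Finset.sum_const, Finset.card_sdiff_of_subset cells_subset, Finsupp.smul_single,
        smul_eq_mul, mul_one]
    · rintro ⟨i, j⟩ hc
      rw [Finset.mem_sdiff, mem_cells, mem_cells] at hc
      rw [fillStrip_apply, if_neg hc.2, if_pos hc.1]
  · refine Finset.sum_congr rfl ?_
    rintro ⟨i, j⟩ hc
    simp only [fillStrip_apply, (mem_cells _).1 hc, if_true]

/-- The restriction of a semistandard tableau to a smaller diagram. -/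
def restrictTableau (T : SemistandardYoungTableau μ) (h : ν ≤ μ) : SemistandardYoungTableau ν where
  entry i j := if (i, j) ∈ ν then T i j else 0
  row_weak' := by
    intro i j₁ j₂ hj hc
    simp only [hc, ν.up_left_mem le_rfl hj.le hc, if_true]
    exact T.row_weak hj (h hc)
  col_strict' := by
    intro i₁ i₂ j hi hc
    simp only [hc, ν.up_left_mem hi.le le_rfl hc, if_true]
    exact T.col_strict hi (h hc)
  zeros' hc := if_neg hc

theorem restrictTableau_apply (T : SemistandardYoungTableau μ) (h : ν ≤ μ) {i j : ℕ}
    (hc : (i, j) ∈ ν) : restrictTableau T h i j = T i j :=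
  if_pos hc

/-- The diagram formed by the cells of a semistandard tableau with entry less than `k`. -/
def entriesBelow (T : SemistandardYoungTableau μ) (k : ℕ) : YoungDiagram where
  cells := μ.cells.filter fun c => T c.1 c.2 < k
  isLowerSet := by
    rintro ⟨a, b⟩ ⟨c, d⟩ ⟨hca : c ≤ a, hdb : d ≤ b⟩ hab
    simp only [Finset.coe_filter, mem_cells, Set.mem_ofPred_eq] at hab ⊢
    refine ⟨μ.up_left_mem hca hdb hab.1, lt_of_le_of_lt ?_ hab.2⟩
    exact (T.row_weak_of_le hdb (μ.up_left_mem hca le_rfl hab.1)).trans (T.col_weak hca hab.1)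

theorem mem_entriesBelow (T : SemistandardYoungTableau μ) {i j : ℕ} :
    (i, j) ∈ entriesBelow T k ↔ (i, j) ∈ μ ∧ T i j < k := by
  rw [← mem_cells, entriesBelow, Finset.mem_filter, mem_cells]

theorem entriesBelow_le (T : SemistandardYoungTableau μ) : entriesBelow T k ≤ μ :=
  fun ⟨_, _⟩ hc => ((mem_entriesBelow T).1 hc).1

theorem entriesBelow_fillStrip (h : IsStrip ν μ) (T : BoundedTableau k ν) :
    entriesBelow (fillStrip h T).1 k = ν := by
  ext ⟨i, j⟩
  rw [mem_cells, mem_cells, mem_entriesBelow]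
  exact ⟨fun hc => (fillStrip_lt_iff h T hc.1).1 hc.2,
    fun hc => ⟨h.le hc, (fillStrip_lt_iff h T (h.le hc)).2 hc⟩⟩

theorem isStrip_entriesBelow (T : BoundedTableau (k + 1) μ) : IsStrip (entriesBelow T.1 k) μ := by
  refine isStrip_iff.2 ⟨entriesBelow_le T.1, fun i j hc => (mem_entriesBelow T.1).2
    ⟨μ.up_left_mem i.le_succ le_rfl hc, ?_⟩⟩
  exact (T.1.col_strict i.lt_succ_self hc).trans_le (Nat.lt_succ_iff.1 (T.2 _ _ hc))

theorem injective_fillStrip (h : IsStrip ν μ) :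
    Function.Injective (fillStrip h : BoundedTableau k ν → BoundedTableau (k + 1) μ) := by
  refine fun S T hST => Subtype.ext (semistandardYoungTableau_ext fun i j hc => ?_)
  have apply_eq := congrArg (fun U => U.1 i j) hST
  simpa only [fillStrip_apply, hc, if_true] using apply_eq

theorem bijective_fillStrip (k : ℕ) (μ : YoungDiagram) :
    Function.Bijective (fun p : (Σ ν : stripsBelow μ, BoundedTableau k ν.1) =>
      fillStrip (mem_stripsBelow.1 p.1.2) p.2) := by
  constructor
  · rintro ⟨⟨ν, hν⟩, S⟩ ⟨⟨ρ, hρ⟩, T⟩ (h : fillStrip _ S = fillStrip _ T)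
    obtain rfl : ν = ρ := by
      rw [← entriesBelow_fillStrip (mem_stripsBelow.1 hν) S, h, entriesBelow_fillStrip]
    rw [injective_fillStrip _ h]
  · intro T
    let S : BoundedTableau k (entriesBelow T.1 k) :=
      ⟨restrictTableau T.1 (entriesBelow_le T.1), fun i j hc => by
        rw [restrictTableau_apply _ _ hc]
        exact ((mem_entriesBelow T.1).1 hc).2⟩
    refine ⟨⟨⟨entriesBelow T.1 k, mem_stripsBelow.2 (isStrip_entriesBelow T)⟩, S⟩, ?_⟩
    refine Subtype.ext (semistandardYoungTableau_ext fun i j hc => ?_)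
    change (fillStrip (isStrip_entriesBelow T) S).1 i j = _
    rw [fillStrip_apply, if_pos hc]
    split_ifs with hlt
    · exact restrictTableau_apply _ (entriesBelow_le T.1) hlt
    · rw [mem_entriesBelow, not_and, not_lt] at hlt
      exact (hlt hc).antisymm (Nat.lt_succ_iff.1 (T.2 _ _ hc))

theorem genSeries_boundedTableau_zero (μ : YoungDiagram) :
    genSeries (fun T : BoundedTableau 0 μ => tableauContent T.1) = schurPoly 0 μ := by
  rw [schurPoly]
  split_ifs with h
  · subst h
    let : Unique (BoundedTableau 0 ⊥) :=
      { default := ⟨default, fun _ _ hc => (notMem_bot _ hc).elim⟩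
        uniq T := Subtype.ext (semistandardYoungTableau_ext fun _ _ hc => (notMem_bot _ hc).elim) }
    rw [genSeries_of_unique, tableauContent, cells_bot, Finset.sum_empty, monomial_zero_one]
  · have : IsEmpty (BoundedTableau 0 μ) := by
      obtain ⟨⟨i, j⟩, hc⟩ :=
        Finset.card_pos.1 (Nat.pos_of_ne_zero (mt diagram_card_eq_zero_iff.1 h))
      exact ⟨fun T => Nat.not_lt_zero _ (T.2 i j ((mem_cells _).1 hc))⟩
    ext α
    rw [coeff_genSeries, Nat.card_of_isEmpty, Nat.cast_zero, map_zero]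

theorem genSeries_boundedTableau (k : ℕ) (μ : YoungDiagram) :
    genSeries (fun T : BoundedTableau k μ => tableauContent T.1) = schurPoly k μ := by
  induction k generalizing μ with
  | zero => exact genSeries_boundedTableau_zero μ
  | succ k ih =>
    rw [schurPoly, ← Finset.sum_coe_sort, ← genSeries_congr
      (Equiv.ofBijective _ (bijective_fillStrip k μ)) fun p =>
        tableauContent_fillStrip (mem_stripsBelow.1 p.1.2) p.2,
      genSeries_sigma (w := fun (ν : stripsBelow μ) (T : BoundedTableau k ν.1) =>
        Finsupp.single k (μ.card - ν.1.card) + tableauContent T.1) fun ν α =>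
          have := finite_boundedTableau k ν.1
          inferInstance]
    refine Finset.sum_congr rfl fun ν _ => ?_
    rw [genSeries_const_add _ fun T : BoundedTableau k ν.1 => tableauContent T.1, ih, X_pow_eq]

theorem tableauContent_apply (T : SemistandardYoungTableau μ) (r : ℕ) :
    tableauContent T r = (μ.cells.filter fun c => T c.1 c.2 = r).card := by
  rw [tableauContent, Finsupp.finsetSum_apply, Finset.card_filter]
  exact Finset.sum_congr rfl fun c _ => by rw [Finsupp.single_apply]

theorem coeff_schur_eq {α : ℕ →₀ ℕ} (μ : YoungDiagram) (hα : α.support ⊆ Finset.range k) :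
    coeff α (schur μ) = coeff α (schurPoly k μ) := by
  rw [← genSeries_boundedTableau, coeff_genSeries]
  change (Nat.card {T : SemistandardYoungTableau μ // tableauContent T = α} : ℂ) = _
  refine congrArg _ (Nat.card_congr
    { toFun T := ⟨⟨T.1, fun i j hc => Finset.mem_range.1 (hα ?_)⟩, T.2⟩
      invFun T := ⟨T.1.1, T.2⟩ })
  rw [Finsupp.mem_support_iff, ← DFunLike.congr_fun T.2, tableauContent_apply]
  exact Finset.card_ne_zero_of_mem (a := (i, j))
    (Finset.mem_filter.2 ⟨(mem_cells _).2 hc, rfl⟩)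

end BoundedTableaux

section Kostka

open YoungDiagram

variable {μ ν : YoungDiagram}

open Classical in
/-- The number of chains of `k` horizontal strips of sizes `α 0, …, α (k - 1)` from the empty
diagram to `μ`. -/
noncomputable def stripChains : ℕ → (ℕ → ℕ) → YoungDiagram → ℕ
  | 0, _, μ => if μ = ⊥ then 1 else 0
  | k + 1, α, μ => ∑ ν ∈ stripsBelow μ, if ν.card + α k = μ.card then stripChains k α ν else 0

theorem stripChains_congr {k : ℕ} {α β : ℕ → ℕ} (h : ∀ i < k, α i = β i) (μ : YoungDiagram) :
    stripChains k α μ = stripChains k β μ := by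
  induction k generalizing μ with
  | zero => rfl
  | succ k ih =>
    simp only [stripChains, h k (Nat.lt_add_one k),
      ih fun i hi => h i (hi.trans (Nat.lt_add_one k))]

theorem coeff_X_pow_mul_of_ne_zero {σ R : Type*} [CommSemiring R] {f : MvPowerSeries σ R} {s : σ}
    (hf : ∀ β, coeff β f ≠ 0 → β s = 0) (j : ℕ) (α : σ →₀ ℕ) :
    coeff α (X s ^ j * f) = if α s = j then coeff (α.erase s) f else 0 := by
  classical
  rw [X_pow_eq, coeff_monomial_mul, one_mul]
  by_cases h : α s = j
  · subst h
    rw [if_pos (Finsupp.single_le_iff.2 le_rfl), if_pos rfl, ← Finsupp.erase_add_single s α]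
    simp
  · rw [if_neg h, ite_eq_right_iff]
    intro hle
    by_contra hne
    have hsub := hf _ hne
    rw [Finsupp.tsub_apply, Finsupp.single_eq_same] at hsub
    exact h ((Nat.le_of_sub_eq_zero hsub).antisymm (Finsupp.single_le_iff.1 hle))

theorem support_erase_subset_range_iff {k : ℕ} {α : ℕ →₀ ℕ} :
    (α.erase k).support ⊆ Finset.range k ↔ α.support ⊆ Finset.range (k + 1) := by
  rw [Finsupp.support_erase, Finset.range_add_one, Finset.subset_insert_iff]

theorem apply_eq_zero_of_support_subset_range {k : ℕ} {α : ℕ →₀ ℕ}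
    (h : α.support ⊆ Finset.range k) : α k = 0 :=
  Finsupp.notMem_support_iff.1 fun hk => (Finset.mem_range.1 (h hk)).false

theorem coeff_schurPoly (k : ℕ) (α : ℕ →₀ ℕ) (μ : YoungDiagram) :
    coeff α (schurPoly k μ) =
      if α.support ⊆ Finset.range k then (stripChains k α μ : ℂ) else 0 := by
  classical
  induction k generalizing α μ with
  | zero =>
    by_cases h : μ = ⊥ <;> simp [schurPoly, stripChains, h, coeff_one]
  | succ k ih =>
    have hk (ν : YoungDiagram) (β : ℕ →₀ ℕ) (hβ : coeff β (schurPoly k ν) ≠ 0) : β k = 0 := by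
      rw [ih] at hβ
      exact apply_eq_zero_of_support_subset_range (ite_ne_right_iff.1 hβ).1
    simp_rw [schurPoly, map_sum, fun ν => coeff_X_pow_mul_of_ne_zero (hk ν), ih,
      support_erase_subset_range_iff, stripChains]
    split_ifs with hα
    · rw [Nat.cast_sum]
      refine Finset.sum_congr rfl fun ν hν => ?_
      have hle := card_le_card_of_diagram_le (mem_stripsBelow.1 hν).le
      have hchains : stripChains k (α.erase k) ν = stripChains k α ν :=
        stripChains_congr (fun i hi => Finsupp.erase_ne hi.ne) ν
      rw [hchains, Nat.cast_ite, Nat.cast_zero]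
      exact if_congr (by omega) rfl rfl
    · simp only [ite_self, Finset.sum_const_zero]

theorem coeff_completePoly (k a : ℕ) (α : ℕ →₀ ℕ) : coeff α (completePoly k a) =
    if α.support ⊆ Finset.range k ∧ ∑ i ∈ Finset.range k, α i = a then (1 : ℂ) else 0 := by
  classical
  induction k generalizing α a with
  | zero => by_cases ha : a = 0 <;> simp [completePoly, ha, coeff_one, eq_comm]
  | succ k ih =>
    have hk (b : ℕ) (β : ℕ →₀ ℕ) (hβ : coeff β (completePoly k b) ≠ 0) : β k = 0 := by
      rw [ih] at hβ
      exact apply_eq_zero_of_support_subset_range (ite_ne_right_iff.1 hβ).1.1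
    have herase : ∑ i ∈ Finset.range k, α.erase k i = ∑ i ∈ Finset.range k, α i :=
      Finset.sum_congr rfl fun i hi => Finsupp.erase_ne (Finset.mem_range.1 hi).ne
    simp_rw [completePoly, map_sum, fun b => coeff_X_pow_mul_of_ne_zero (hk b), ih,
      support_erase_subset_range_iff, herase]
    rw [Finset.sum_ite_eq, ← ite_and, Finset.sum_range_succ]
    exact if_congr (by grind) rfl rfl

/-- The Young diagrams with `n` cells, that is, the partitions of `n`. -/
noncomputable def diagramsOfCard (n : ℕ) : Finset YoungDiagram :=
  (finite_diagram_card_eq n).toFinset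

theorem mem_diagramsOfCard {n : ℕ} : μ ∈ diagramsOfCard n ↔ μ.card = n :=
  (finite_diagram_card_eq n).mem_toFinset

theorem diagramsOfCard_zero : diagramsOfCard 0 = {⊥} := by
  ext μ
  rw [mem_diagramsOfCard, diagram_card_eq_zero_iff, Finset.mem_singleton]

theorem schurPoly_bot (k : ℕ) : schurPoly k ⊥ = 1 := by
  induction k with
  | zero => rw [schurPoly, if_pos rfl]
  | succ k ih =>
    have hstrips : stripsBelow ⊥ = {⊥} := by
      ext ν
      rw [mem_stripsBelow, Finset.mem_singleton]
      exact ⟨fun h => le_bot_iff.1 h.le, fun h i => by simp [h, rowLen_bot]⟩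
    rw [schurPoly, hstrips, Finset.sum_singleton, Nat.sub_self, pow_zero, one_mul, ih]

theorem prod_completePoly (k r : ℕ) (α : ℕ → ℕ) :
    ∏ i ∈ Finset.range r, completePoly k (α i) =
      ∑ μ ∈ diagramsOfCard (∑ i ∈ Finset.range r, α i),
        (stripChains r α μ : SymPS) * schurPoly k μ := by
  classical
  induction r with
  | zero => simp [diagramsOfCard_zero, stripChains, schurPoly_bot]
  | succ r ih =>
    have hpieri (ν : YoungDiagram) :
        (stripChains r α ν : SymPS) * schurPoly k ν * completePoly k (α r) =
          ∑ μ ∈ stripsAbove (α r) ν, (stripChains r α ν : SymPS) * schurPoly k μ := by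
      rw [← Finset.mul_sum, ← completePoly_mul_schurPoly]
      ring
    rw [Finset.prod_range_succ, ih, Finset.sum_mul, Finset.sum_congr rfl fun ν _ => hpieri ν,
      Finset.sum_comm' (t' := diagramsOfCard (∑ i ∈ Finset.range (r + 1), α i))
        (s' := fun μ => (stripsBelow μ).filter fun ν => ν.card + α r = μ.card)]
    · simp only [stripChains, Nat.cast_sum, Finset.sum_mul, Finset.sum_filter, Nat.cast_ite,
        Nat.cast_zero, ite_mul, zero_mul]
    · intro ν μ
      simp only [mem_diagramsOfCard, mem_stripsAbove, Finset.mem_filter, mem_stripsBelow,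
        Finset.sum_range_succ]
      grind

/-- The row lengths of `μ` as an exponent vector. -/
noncomputable def rowWeight (μ : YoungDiagram) : ℕ →₀ ℕ :=
  tableauContent (SemistandardYoungTableau.highestWeight μ)

theorem rowWeight_apply (μ : YoungDiagram) (i : ℕ) : rowWeight μ i = μ.rowLen i := by
  rw [rowWeight, tableauContent_apply, rowLen_eq_card, row]
  congr 1
  refine Finset.filter_congr fun c hc => ?_
  rw [SemistandardYoungTableau.highestWeight_apply, if_pos ((mem_cells _).1 hc)]

/-- The Kostka number: the number of semistandard tableaux of shape `μ` whose content is given by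
the row lengths of `ν`. -/
noncomputable def kostka (μ ν : YoungDiagram) : ℕ :=
  Nat.card {T : SemistandardYoungTableau μ // tableauContent T = rowWeight ν}

theorem coeff_rowWeight_schur (μ ν : YoungDiagram) :
    coeff (rowWeight ν) (schur μ) = (kostka μ ν : ℂ) :=
  rfl

theorem sum_tableauContent (T : SemistandardYoungTableau μ) (r : ℕ) :
    ∑ i ∈ Finset.range r, tableauContent T i =
      (μ.cells.filter fun c => T c.1 c.2 < r).card := by
  simp only [tableauContent_apply, Finset.card_filter]
  rw [Finset.sum_comm]
  exact Finset.sum_congr rfl fun c _ => by simp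

theorem sum_range_rowLen (μ : YoungDiagram) (r : ℕ) :
    ∑ i ∈ Finset.range r, μ.rowLen i = (μ.cells.filter fun c => c.1 < r).card := by
  simp only [rowLen_eq_card, row, Finset.card_filter]
  rw [Finset.sum_comm]
  exact Finset.sum_congr rfl fun c _ => by simp

theorem le_tableau_entry (T : SemistandardYoungTableau μ) {i j : ℕ} (hc : (i, j) ∈ μ) :
    i ≤ T i j := by
  induction i with
  | zero => exact Nat.zero_le _
  | succ i ih =>
    exact (ih (μ.up_left_mem (Nat.le_add_right _ 1) le_rfl hc)).trans_lt
      (T.col_strict (Nat.lt_add_one i) hc)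

theorem filter_entry_lt_subset (T : SemistandardYoungTableau μ) (r : ℕ) :
    (μ.cells.filter fun c => T c.1 c.2 < r) ⊆ μ.cells.filter fun c => c.1 < r :=
  Finset.monotone_filter_right _ fun _ hc =>
    (le_tableau_entry T ((mem_cells _).1 hc)).trans_lt

theorem sum_rowLen_le_of_kostka_ne_zero (h : kostka μ ν ≠ 0) (r : ℕ) :
    ∑ i ∈ Finset.range r, ν.rowLen i ≤ ∑ i ∈ Finset.range r, μ.rowLen i := by
  obtain ⟨⟨T, hT⟩⟩ := (Nat.card_ne_zero.1 h).1
  simp only [← rowWeight_apply ν, ← hT]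
  rw [sum_tableauContent, sum_range_rowLen]
  exact Finset.card_le_card (filter_entry_lt_subset T r)

theorem tableau_eq_highestWeight {T : SemistandardYoungTableau μ}
    (hT : tableauContent T = rowWeight μ) : T = SemistandardYoungTableau.highestWeight μ := by
  ext i j
  rw [SemistandardYoungTableau.highestWeight_apply]
  split_ifs with hc
  · have hcard := sum_tableauContent T (i + 1)
    simp only [hT, rowWeight_apply, sum_range_rowLen] at hcard
    have hmem : (i, j) ∈ μ.cells.filter fun c => c.1 < i + 1 :=
      Finset.mem_filter.2 ⟨(mem_cells _).2 hc, Nat.lt_add_one i⟩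
    rw [← Finset.eq_of_subset_of_card_le (filter_entry_lt_subset T (i + 1)) hcard.le] at hmem
    exact (Nat.le_of_lt_add_one (Finset.mem_filter.1 hmem).2).antisymm (le_tableau_entry T hc)
  · exact T.zeros hc

theorem kostka_self (μ : YoungDiagram) : kostka μ μ = 1 := by
  rw [kostka, Nat.card_eq_one_iff_unique]
  exact ⟨⟨fun S T => Subtype.ext
    ((tableau_eq_highestWeight S.2).trans (tableau_eq_highestWeight T.2).symm)⟩, ⟨⟨_, rfl⟩⟩⟩

end Kostka

section ColoringPairs

variable {X Y : Type*} [Fintype X] {α β : ℕ →₀ ℕ}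

theorem content_eq_toFinsupp (c : X → ℕ) :
    content c = Multiset.toFinsupp (Finset.univ.val.map c) := by
  ext i
  simp only [content_apply, Multiset.toFinsupp_apply, Multiset.count_map,
    Nat.card_eq_fintype_card, Fintype.card_subtype, Finset.card, Finset.filter_val, eq_comm]

theorem degree_toFinsupp {ι : Type*} [DecidableEq ι] (s : Multiset ι) :
    (Multiset.toFinsupp s).degree = Multiset.card s := by
  rw [Finsupp.degree_apply, Multiset.toFinsupp_support, ← Multiset.toFinset_sum_count_eq s]
  rfl

theorem exists_perm_comp_eq_of_map_eq {c d : X → Y}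
    (h : Finset.univ.val.map c = Finset.univ.val.map d) : ∃ σ : Perm X, d ∘ σ = c := by
  classical
  have hfiber (y : Y) : Nonempty ({x // c x = y} ≃ {x // d x = y}) := by
    rw [← Fintype.card_eq, Fintype.card_subtype, Fintype.card_subtype]
    simpa only [Multiset.count_map, Finset.card, Finset.filter_val, eq_comm]
      using congrArg (Multiset.count y) h
  let e (y : Y) := (hfiber y).some
  exact ⟨Equiv.ofFiberEquiv e, funext (Equiv.ofFiberEquiv_map e)⟩

theorem exists_map_univ_eq (s : Multiset Y) (hs : Multiset.card s = Fintype.card X) :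
    ∃ c : X → Y, Finset.univ.val.map c = s := by
  classical
  have e : X ≃ s := Fintype.equivOfCardEq (by rw [← hs, Multiset.card_coe])
  refine ⟨(fun y : s => (y : Y)) ∘ e, ?_⟩
  rw [← Multiset.map_map, Multiset.map_univ_val_equiv e,
    Multiset.map_univ_coe]

/-- The matrices of nonnegative integers with row sums `α` and column sums `β`, encoded as
multisets of positions. -/
abbrev MarginMultiset (α β : ℕ →₀ ℕ) : Type :=
  {s : Multiset (ℕ × ℕ) //
    Multiset.toFinsupp (s.map Prod.fst) = α ∧ Multiset.toFinsupp (s.map Prod.snd) = β}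

/-- The colorings of `X` with content `α`, on which the permutations of `X` act. -/
abbrev ContentColoring (X : Type*) [Fintype X] (α : ℕ →₀ ℕ) : Type _ :=
  {c : X → ℕ // content c = α}

instance : Finite (ContentColoring X α) :=
  finite_content_eq α

instance : MulAction (Perm X) (ContentColoring X α) where
  smul σ c := ⟨c.1 ∘ ⇑σ⁻¹, (content_comp_equiv c.1 σ⁻¹).trans c.2⟩
  one_smul _ := rfl
  mul_smul σ τ c := Subtype.ext <| by
    change c.1 ∘ ⇑(σ * τ)⁻¹ = (c.1 ∘ ⇑τ⁻¹) ∘ ⇑σ⁻¹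
    rw [mul_inv_rev]
    rfl

theorem coe_smul_contentColoring (σ : Perm X) (c : ContentColoring X α) :
    (σ • c).1 = c.1 ∘ ⇑σ⁻¹ :=
  rfl

theorem mem_fixedBy_contentColoring {σ : Perm X} {c : ContentColoring X α} :
    c ∈ MulAction.fixedBy (ContentColoring X α) σ ↔ ∀ x, c.1 (σ x) = c.1 x := by
  rw [MulAction.mem_fixedBy, smul_eq_iff_eq_inv_smul, Subtype.ext_iff, coe_smul_contentColoring,
    inv_inv, funext_iff]
  exact forall_congr' fun x => eq_comm

/-- The number of colorings of content `α` fixed by `σ`: the value at `σ` of the character of the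
permutation representation on colorings of content `α`. -/
noncomputable def numFixed (α : ℕ →₀ ℕ) (σ : Perm X) : ℕ :=
  Nat.card (MulAction.fixedBy (ContentColoring X α) σ)

theorem coeff_powerSumPart_partition {X : Type} [Fintype X] [DecidableEq X] (α : ℕ →₀ ℕ)
    (σ : Perm X) : coeff α (powerSumPart σ.partition) = (numFixed α σ : ℂ) := by
  rw [powerSumPart_eq_fixedColoringSeries, fixedColoringSeries, coeff_genSeries, numFixed]
  exact congrArg _ (Nat.card_congr
    { toFun c := ⟨⟨c.1.1, c.2⟩, mem_fixedBy_contentColoring.2 c.1.2⟩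
      invFun c := ⟨⟨c.1.1, mem_fixedBy_contentColoring.1 c.2⟩, c.1.2⟩ })

/-- The positions `(c x, d x)` of the points of `X` under two colorings. -/
def jointColors (p : ContentColoring X α × ContentColoring X β) : MarginMultiset α β :=
  ⟨Finset.univ.val.map fun x => (p.1.1 x, p.2.1 x), by
    rw [Multiset.map_map, Multiset.map_map]
    exact ⟨(content_eq_toFinsupp _).symm.trans p.1.2, (content_eq_toFinsupp _).symm.trans p.2.2⟩⟩

theorem jointColors_eq_iff {p q : ContentColoring X α × ContentColoring X β} :
    jointColors p = jointColors q ↔ ∃ σ : Perm X, σ • q = p := by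
  constructor
  · intro h
    obtain ⟨σ, hσ⟩ := exists_perm_comp_eq_of_map_eq (congrArg Subtype.val h)
    exact ⟨σ⁻¹, Prod.ext (Subtype.ext (congrArg (Prod.fst ∘ ·) hσ))
      (Subtype.ext (congrArg (Prod.snd ∘ ·) hσ))⟩
  · rintro ⟨σ, rfl⟩
    refine Subtype.ext ?_
    change Finset.univ.val.map ((fun x => (q.1.1 x, q.2.1 x)) ∘ ⇑σ⁻¹) = _
    rw [← Multiset.map_map, Multiset.map_univ_val_equiv]
    rfl

theorem jointColors_surjective (hα : α.degree = Fintype.card X) :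
    Function.Surjective
      (jointColors : ContentColoring X α × ContentColoring X β → MarginMultiset α β) := by
  rintro ⟨s, hs₁, hs₂⟩
  have hcard : Multiset.card s = Fintype.card X := by
    rw [← hα, ← hs₁, degree_toFinsupp, Multiset.card_map]
  obtain ⟨c, rfl⟩ := exists_map_univ_eq (X := X) s hcard
  rw [Multiset.map_map, ← content_eq_toFinsupp] at hs₁ hs₂
  exact ⟨(⟨_, hs₁⟩, ⟨_, hs₂⟩), rfl⟩

theorem card_orbits_contentColoring_prod (hα : α.degree = Fintype.card X) :
    Nat.card (MulAction.orbitRel.Quotient (Perm X) (ContentColoring X α × ContentColoring X β)) =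
      Nat.card (MarginMultiset α β) := by
  refine Nat.card_congr (Equiv.ofBijective
    (Quotient.lift jointColors fun p q h => jointColors_eq_iff.2 h) ⟨?_, ?_⟩)
  · exact fun p q => Quotient.inductionOn₂ p q fun p q h =>
      Quotient.sound (jointColors_eq_iff.1 h)
  · exact Quotient.lift_surjective _ _ (jointColors_surjective hα)

theorem card_fixedBy_prod {G A B : Type*} [Group G] [MulAction G A] [MulAction G B] (g : G) :
    Nat.card (MulAction.fixedBy (A × B) g) =
      Nat.card (MulAction.fixedBy A g) * Nat.card (MulAction.fixedBy B g) := by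
  have hprod : MulAction.fixedBy (A × B) g = MulAction.fixedBy A g ×ˢ MulAction.fixedBy B g := by
    ext p
    simp [Prod.ext_iff]
  rw [hprod, Nat.card_congr (Equiv.Set.prod _ _), Nat.card_prod]

/-- Burnside's lemma, the orbits of `Perm X` on pairs of colorings being `MarginMultiset α β`. -/
theorem sum_numFixed_mul_numFixed [DecidableEq X] (hα : α.degree = Fintype.card X) :
    ∑ σ : Perm X, numFixed α σ * numFixed β σ =
      Nat.card (MarginMultiset α β) * (Fintype.card X).factorial := by
  classical
  have := Fintype.ofFinite (ContentColoring X α × ContentColoring X β)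
  rw [← card_orbits_contentColoring_prod hα, ← Fintype.card_perm, Nat.card_eq_fintype_card,
    ← MulAction.sum_card_fixedBy_eq_card_orbits_mul_card_group]
  refine Finset.sum_congr rfl fun σ _ => ?_
  rw [numFixed, numFixed, ← card_fixedBy_prod, Nat.card_eq_fintype_card]

end ColoringPairs

section Margins

/-- The additive equivalence between multisets of positions and finitely supported matrices of
multiplicities. -/
noncomputable def pairMultisetEquiv : Multiset (ℕ × ℕ) ≃+ (ℕ →₀ ℕ →₀ ℕ) :=
  Multiset.toFinsupp.trans Finsupp.curryAddEquiv

theorem pairMultisetEquiv_singleton (p : ℕ × ℕ) :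
    pairMultisetEquiv {p} = Finsupp.single p.1 (Finsupp.single p.2 1) := by
  rw [pairMultisetEquiv, AddEquiv.trans_apply, Multiset.toFinsupp_singleton]
  exact Finsupp.curry_single _ _

theorem toFinsupp_map_fst_apply (s : Multiset (ℕ × ℕ)) (i : ℕ) :
    Multiset.toFinsupp (s.map Prod.fst) i = (pairMultisetEquiv s i).degree := by
  induction s using Multiset.induction_on with
  | empty => simp
  | cons p s ih =>
    rw [← Multiset.singleton_add, map_add, Multiset.map_add, map_add, Finsupp.add_apply,
      Finsupp.add_apply, map_add, ih, pairMultisetEquiv_singleton, Multiset.map_singleton,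
      Multiset.toFinsupp_singleton, Finsupp.single_apply, Finsupp.single_apply]
    split_ifs <;> simp

theorem toFinsupp_map_snd (s : Multiset (ℕ × ℕ)) :
    Multiset.toFinsupp (s.map Prod.snd) = (pairMultisetEquiv s).sum fun _ f => f := by
  induction s using Multiset.induction_on with
  | empty => simp
  | cons p s ih =>
    rw [← Multiset.singleton_add, map_add, Multiset.map_add, map_add,
      Finsupp.sum_add_index' (fun _ => rfl) (fun _ _ _ => rfl), ih, pairMultisetEquiv_singleton,
      Multiset.map_singleton, Multiset.toFinsupp_singleton, Finsupp.sum_single_index rfl]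

theorem degree_eq_sum_of_support_subset {ι : Type*} {f : ι →₀ ℕ} {s : Finset ι}
    (h : f.support ⊆ s) : f.degree = ∑ i ∈ s, f i := by
  rw [Finsupp.degree_apply]
  exact Finset.sum_subset h fun _ _ => Finsupp.notMem_support_iff.1

theorem margins_iff_mem_finsuppAntidiag {k r : ℕ} {α β : ℕ →₀ ℕ}
    (hα : α.support ⊆ Finset.range r) (hβ : β.support ⊆ Finset.range k) (l : ℕ →₀ ℕ →₀ ℕ) :
    ((∀ i, (l i).degree = α i) ∧ l.sum (fun _ f => f) = β) ↔
      l ∈ (Finset.range r).finsuppAntidiag β ∧ ∀ i ∈ Finset.range r,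
        (l i).support ⊆ Finset.range k ∧ ∑ j ∈ Finset.range k, l i j = α i := by
  have hsum (hl : l.support ⊆ Finset.range r) :
      l.sum (fun _ f => f) = (Finset.range r).sum l :=
    Finsupp.sum_of_support_subset l hl _ fun _ _ => rfl
  rw [Finset.mem_finsuppAntidiag]
  constructor
  · rintro ⟨ha, hb⟩
    have hl : l.support ⊆ Finset.range r := by
      refine fun i hi => hα (Finsupp.mem_support_iff.2 fun h₀ => ?_)
      rw [← ha, Finsupp.degree_eq_zero_iff] at h₀
      exact Finsupp.mem_support_iff.1 hi h₀
    rw [hsum hl] at hb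
    refine ⟨⟨hb, hl⟩, fun i hi => ?_⟩
    have hsupp : (l i).support ⊆ Finset.range k := by
      refine fun j hj => hβ (Finsupp.mem_support_iff.2 fun h₀ => ?_)
      rw [← hb, Finsupp.finsetSum_apply, Finset.sum_eq_zero_iff] at h₀
      exact Finsupp.mem_support_iff.1 hj (h₀ i hi)
    exact ⟨hsupp, by rw [← degree_eq_sum_of_support_subset hsupp, ha]⟩
  · rintro ⟨⟨hb, hl⟩, ha⟩
    refine ⟨fun i => ?_, (hsum hl).trans hb⟩
    by_cases hi : i ∈ Finset.range r
    · rw [degree_eq_sum_of_support_subset (ha i hi).1, (ha i hi).2]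
    · rw [Finsupp.notMem_support_iff.1 fun h => hi (hl h),
        Finsupp.notMem_support_iff.1 fun h => hi (hα h), map_zero]

theorem coeff_prod_completePoly {k r : ℕ} {α β : ℕ →₀ ℕ} (hα : α.support ⊆ Finset.range r)
    (hβ : β.support ⊆ Finset.range k) :
    coeff β (∏ i ∈ Finset.range r, completePoly k (α i)) =
      (Nat.card (MarginMultiset α β) : ℂ) := by
  classical
  rw [coeff_prod]
  simp only [coeff_completePoly, Finset.prod_boole]
  rw [Finset.sum_boole, ← Fintype.card_coe, ← Nat.card_eq_fintype_card]
  refine congrArg _ (Nat.card_congr (pairMultisetEquiv.toEquiv.subtypeEquiv fun s => ?_)).symm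
  rw [Finset.mem_filter, DFunLike.ext_iff, toFinsupp_map_snd]
  simp only [toFinsupp_map_fst_apply]
  exact margins_iff_mem_finsuppAntidiag hα hβ _

end Margins

section ClassSums

theorem parts_eq_filter_add_replicate {n : ℕ} (lam : n.Partition) :
    lam.parts = lam.parts.filter (2 ≤ ·) + Multiset.replicate (lam.parts.count 1) 1 := by
  have hones : lam.parts.filter (¬ 2 ≤ ·) = Multiset.replicate (lam.parts.count 1) 1 := by
    rw [← Multiset.filter_eq']
    refine Multiset.filter_congr fun k hk => ?_
    have := lam.parts_pos hk
    omega
  rw [← hones, Multiset.filter_add_not]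

theorem sum_filter_add_count_one {n : ℕ} (lam : n.Partition) :
    (lam.parts.filter (2 ≤ ·)).sum + lam.parts.count 1 = n := by
  have h := congrArg Multiset.sum (parts_eq_filter_add_replicate lam)
  rwa [Multiset.sum_add, Multiset.sum_replicate, smul_eq_mul, mul_one, lam.parts_sum,
    eq_comm] at h

theorem zPart_eq {n : ℕ} (lam : n.Partition) :
    zPart lam = (lam.parts.count 1).factorial * (lam.parts.filter (2 ≤ ·)).prod *
      ∏ i ∈ (lam.parts.filter (2 ≤ ·)).toFinset,
        ((lam.parts.filter (2 ≤ ·)).count i).factorial := by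
  set m := lam.parts.filter (2 ≤ ·) with hm
  have hprod : lam.parts.prod = m.prod := by
    rw [parts_eq_filter_add_replicate lam, Multiset.prod_add, Multiset.prod_replicate, one_pow,
      mul_one]
  have one_notMem : 1 ∉ m.toFinset := by simp [hm]
  have hsubset : lam.parts.toFinset ⊆ insert 1 m.toFinset := by
    intro k hk
    have := lam.parts_pos (Multiset.mem_toFinset.1 hk)
    simp only [Finset.mem_insert, Multiset.mem_toFinset, hm, Multiset.mem_filter] at hk ⊢
    grind
  have hcount : ∀ k ∈ m.toFinset, lam.parts.count k = m.count k := fun k hk =>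
    (Multiset.count_filter_of_pos (Multiset.mem_filter.1 (Multiset.mem_toFinset.1 hk)).2).symm
  have hfactorial : ∏ i ∈ lam.parts.toFinset, (lam.parts.count i).factorial =
      (lam.parts.count 1).factorial * ∏ i ∈ m.toFinset, (m.count i).factorial := by
    rw [Finset.prod_subset hsubset, Finset.prod_insert one_notMem,
      Finset.prod_congr rfl fun k hk => congrArg Nat.factorial (hcount k hk)]
    intro k _ hk
    rw [Multiset.count_eq_zero.2 fun h => hk (Multiset.mem_toFinset.2 h), Nat.factorial_zero]
  rw [zPart, Finset.prod_mul_distrib, ← Finset.prod_multiset_count, hprod, hfactorial]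
  ring

theorem zPart_ne_zero {n : ℕ} (lam : n.Partition) : zPart lam ≠ 0 :=
  Finset.prod_ne_zero_iff.2 fun _ hi =>
    have := lam.parts_pos (Multiset.mem_toFinset.1 hi)
    mul_ne_zero (pow_ne_zero _ this.ne') (Nat.factorial_ne_zero _)

theorem natCast_zPart_ne_zero {n : ℕ} (lam : n.Partition) : (zPart lam : ℂ) ≠ 0 :=
  Nat.cast_ne_zero.2 (zPart_ne_zero lam)

theorem natCast_factorial_ne_zero (n : ℕ) : (n.factorial : ℂ) ≠ 0 :=
  Nat.cast_ne_zero.2 n.factorial_ne_zero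

variable {X : Type*} [Fintype X] [DecidableEq X]

theorem partition_eq_iff_cycleType_eq {σ : Perm X} {lam : (Fintype.card X).Partition} :
    σ.partition = lam ↔ σ.cycleType = lam.parts.filter (2 ≤ ·) := by
  constructor
  · rintro rfl
    exact Perm.filter_parts_partition_eq_cycleType.symm
  · intro h
    have hsum := sum_filter_add_count_one lam
    rw [Nat.Partition.ext_iff, parts_partition_eq_cycleType_add, h,
      show Fintype.card X - (lam.parts.filter (2 ≤ ·)).sum = lam.parts.count 1 by omega,
      ← parts_eq_filter_add_replicate]

theorem card_partition_eq_mul_zPart (lam : (Fintype.card X).Partition) :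
    (Finset.univ.filter fun σ : Perm X => σ.partition = lam).card * zPart lam =
      (Fintype.card X).factorial := by
  have hsum := sum_filter_add_count_one lam
  have h := Perm.card_of_cycleType_mul_eq X (lam.parts.filter (2 ≤ ·))
  rw [if_pos ⟨by omega, fun a ha => (Multiset.mem_filter.1 ha).2⟩,
    show Fintype.card X - (lam.parts.filter (2 ≤ ·)).sum = lam.parts.count 1 by omega] at h
  simp only [partition_eq_iff_cycleType_eq]
  rw [zPart_eq, h]

theorem sum_perm_eq_sum_partition {M : Type*} [AddCommGroup M] [Module ℂ M]
    (F : (Fintype.card X).Partition → M) :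
    ((Fintype.card X).factorial : ℂ)⁻¹ • ∑ σ : Perm X, F σ.partition =
      ∑ lam, (zPart lam : ℂ)⁻¹ • F lam := by
  rw [← Finset.sum_fiberwise (s := Finset.univ) (g := fun σ : Perm X => σ.partition),
    Finset.smul_sum]
  refine Finset.sum_congr rfl fun lam _ => ?_
  rw [Finset.sum_congr rfl (g := fun _ => F lam) fun σ hσ => by rw [(Finset.mem_filter.1 hσ).2],
    Finset.sum_const, ← Nat.cast_smul_eq_nsmul ℂ, smul_smul, inv_mul_eq_iff_eq_mul₀
      (natCast_factorial_ne_zero _) |>.2]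
  rw [← card_partition_eq_mul_zPart lam, Nat.cast_mul,
    mul_inv_cancel_right₀ (natCast_zPart_ne_zero lam)]

end ClassSums

section TransitionMatrix

open YoungDiagram

variable {n : ℕ}

theorem support_rowWeight_subset (μ : YoungDiagram) :
    (rowWeight μ).support ⊆ Finset.range μ.card := by
  intro i hi
  rw [Finsupp.mem_support_iff, rowWeight_apply] at hi
  exact Finset.mem_range.2 (not_le.1 fun h => hi (rowLen_eq_zero_of_card_le h))

theorem sum_rowWeight (μ : YoungDiagram) : ∑ i ∈ Finset.range μ.card, rowWeight μ i = μ.card := by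
  simp only [rowWeight_apply]
  exact (card_eq_sum_rowLen (rowLen_eq_zero_of_card_le le_rfl)).symm

theorem degree_rowWeight (μ : YoungDiagram) : (rowWeight μ).degree = μ.card :=
  (degree_eq_sum_of_support_subset (support_rowWeight_subset μ)).trans (sum_rowWeight μ)

theorem card_marginMultiset (μ : YoungDiagram) (β : ℕ →₀ ℕ) :
    (Nat.card (MarginMultiset (rowWeight μ) β) : ℂ) =
      ∑ κ ∈ diagramsOfCard μ.card, (kostka κ μ : ℂ) * coeff β (schur κ) := by
  classical
  obtain ⟨k, hk⟩ := β.support.exists_nat_subset_range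
  rw [← coeff_prod_completePoly (support_rowWeight_subset μ) hk, prod_completePoly, map_sum,
    sum_rowWeight]
  refine Finset.sum_congr rfl fun κ _ => ?_
  rw [coeff_schur_eq κ hk, ← coeff_rowWeight_schur, coeff_schur_eq κ (support_rowWeight_subset μ),
    coeff_schurPoly, if_pos (support_rowWeight_subset μ), ← coeff_C_mul, map_natCast]

/-- The scalar product `⟨f, g⟩ = (1 / n!) ∑_σ f(σ) g(σ)` of class functions on the symmetric group,
given by their values on cycle types. It is bilinear: the characters of a symmetric group are
real-valued. -/
noncomputable def classInner (f g : n.Partition → ℂ) : ℂ :=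
  ∑ lam, (zPart lam : ℂ)⁻¹ * (f lam * g lam)

theorem classInner_eq_sum_perm {X : Type*} [Fintype X] [DecidableEq X]
    (f g : (Fintype.card X).Partition → ℂ) :
    classInner f g = ((Fintype.card X).factorial : ℂ)⁻¹ *
      ∑ σ : Perm X, f σ.partition * g σ.partition :=
  (sum_perm_eq_sum_partition fun lam => f lam * g lam).symm

theorem classInner_coeff_powerSumPart {α : ℕ →₀ ℕ} (hα : α.degree = n) (β : ℕ →₀ ℕ) :
    classInner (fun lam : n.Partition => coeff α (powerSumPart lam))
        (fun lam => coeff β (powerSumPart lam)) =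
      (Nat.card (MarginMultiset α β) : ℂ) := by
  obtain ⟨X, _, _, rfl⟩ : ∃ (X : Type) (_ : Fintype X) (_ : DecidableEq X), Fintype.card X = n :=
    ⟨Fin n, inferInstance, inferInstance, Fintype.card_fin n⟩
  rw [classInner_eq_sum_perm, inv_mul_eq_iff_eq_mul₀ (natCast_factorial_ne_zero _), mul_comm]
  simp only [coeff_powerSumPart_partition]
  exact_mod_cast sum_numFixed_mul_numFixed hα

theorem sum_rowLens (μ : YoungDiagram) : μ.rowLens.sum = μ.card := by
  have h0 : μ.rowLen (μ.colLen 0) = 0 := by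
    by_contra h
    exact lt_irrefl _ (mem_iff_lt_colLen.1 (mem_iff_lt_rowLen.2 (Nat.pos_of_ne_zero h)))
  rw [card_eq_sum_rowLen h0, rowLens]
  rfl

theorem nonempty_diagramsOfCard_equiv (n : ℕ) : Nonempty (diagramsOfCard n ≃ n.Partition) := by
  let f (μ : diagramsOfCard n) : n.Partition :=
    { parts := μ.1.rowLens
      parts_pos := fun {i} hi => μ.1.pos_of_mem_rowLens i (Multiset.mem_coe.1 hi)
      parts_sum := by rw [Multiset.sum_coe, sum_rowLens, mem_diagramsOfCard.1 μ.2] }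
  refine ⟨Equiv.ofBijective f ⟨fun μ ν h => ?_, fun lam => ?_⟩⟩
  · have hperm : (μ.1.rowLens : Multiset ℕ) = ν.1.rowLens := congrArg Nat.Partition.parts h
    have hlist := (Multiset.coe_eq_coe.1 hperm).eq_of_sortedGE μ.1.rowLens_sorted ν.1.rowLens_sorted
    exact Subtype.ext (equivListRowLens.injective (Subtype.ext hlist))
  · have hs : (lam.parts.sort (· ≥ ·)).SortedGE := (Multiset.pairwise_sort _ _).sortedGE
    have hrows : (ofRowLens _ hs).rowLens = lam.parts.sort (· ≥ ·) :=
      rowLens_ofRowLens_eq_self fun x hx => lam.parts_pos ((Multiset.mem_sort _).1 hx)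
    have hcard : (ofRowLens _ hs).card = n := by
      rw [← sum_rowLens, hrows, ← Multiset.sum_coe, Multiset.sort_eq, lam.parts_sum]
    refine ⟨⟨_, mem_diagramsOfCard.2 hcard⟩, Nat.Partition.ext ?_⟩
    change ((ofRowLens _ hs).rowLens : Multiset ℕ) = lam.parts
    rw [hrows, Multiset.sort_eq]

instance : DecidableEq YoungDiagram :=
  fun _ _ => decidable_of_iff _ YoungDiagram.ext_iff.symm

/-- The matrix of Kostka numbers. -/
noncomputable def kostkaMatrix (n : ℕ) : Matrix (diagramsOfCard n) (diagramsOfCard n) ℤ :=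
  .of fun μ κ => kostka κ μ

theorem kostkaMatrix_apply (μ κ : diagramsOfCard n) : kostkaMatrix n μ κ = kostka κ μ :=
  rfl

/-- The Kostka matrix is unitriangular for the lexicographic order on row lengths. -/
theorem det_kostkaMatrix (n : ℕ) : (kostkaMatrix n).det = 1 := by
  let : LinearOrder (diagramsOfCard n) :=
    LinearOrder.lift' (fun μ => toLex μ.1.rowLen) fun _ _ h =>
      Subtype.ext (rowLen_ext fun i => congrFun (toLex.injective h) i)
  rw [Matrix.det_of_isUpperTriangular]
  · exact Finset.prod_eq_one fun μ _ => by rw [kostkaMatrix_apply, kostka_self, Nat.cast_one]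
  · intro μ κ hlt
    obtain ⟨r, heq, hr⟩ : ∃ r, (∀ j < r, κ.1.rowLen j = μ.1.rowLen j) ∧
      κ.1.rowLen r < μ.1.rowLen r := hlt
    rw [kostkaMatrix_apply, Nat.cast_eq_zero]
    by_contra hne
    have hle := sum_rowLen_le_of_kostka_ne_zero hne (r + 1)
    have hsum : ∑ i ∈ Finset.range r, κ.1.rowLen i = ∑ i ∈ Finset.range r, μ.1.rowLen i :=
      Finset.sum_congr rfl fun i hi => heq i (Finset.mem_range.1 hi)
    rw [Finset.sum_range_succ, Finset.sum_range_succ, hsum] at hle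
    omega

theorem isUnit_det_kostkaMatrix (n : ℕ) : IsUnit (kostkaMatrix n).det :=
  det_kostkaMatrix n ▸ isUnit_one

/-- The values of the permutation characters of the Young subgroups: by
`coeff_powerSumPart_partition` they are the coefficients of power sums at weights of diagrams. -/
noncomputable def permCharMatrix (n : ℕ) : Matrix (diagramsOfCard n) n.Partition ℂ :=
  .of fun μ lam => coeff (rowWeight μ) (powerSumPart lam)

/-- The character table of the symmetric group. -/
noncomputable def charTable (n : ℕ) : Matrix (diagramsOfCard n) n.Partition ℂ :=
  (kostkaMatrix n)⁻¹.map (Int.castRingHom ℂ) * permCharMatrix n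

/-- The diagonal matrix with entries `z_lam⁻¹`. -/
noncomputable def invZMatrix (n : ℕ) : Matrix n.Partition n.Partition ℂ :=
  Matrix.diagonal fun lam => (zPart lam : ℂ)⁻¹

theorem invZMatrix_mulVec (f : n.Partition → ℂ) :
    (invZMatrix n).mulVec f = fun lam => (zPart lam : ℂ)⁻¹ * f lam :=
  funext fun _ => Matrix.mulVec_diagonal _ _ _

theorem dotProduct_invZMatrix_mulVec (f g : n.Partition → ℂ) :
    f ⬝ᵥ (invZMatrix n).mulVec g = classInner f g := by
  rw [invZMatrix_mulVec]
  exact Finset.sum_congr rfl fun lam _ => mul_left_comm _ _ _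

theorem mul_invZMatrix_mulVec {ι : Type*} (M : Matrix ι n.Partition ℂ) (g : n.Partition → ℂ) :
    (M * invZMatrix n).mulVec g = fun i => classInner (M i) g := by
  rw [← Matrix.mulVec_mulVec]
  exact funext fun i => dotProduct_invZMatrix_mulVec (M i) g

theorem map_inv_mul_map_kostkaMatrix (n : ℕ) :
    (kostkaMatrix n)⁻¹.map (Int.castRingHom ℂ) * (kostkaMatrix n).map (Int.castRingHom ℂ) = 1 := by
  rw [← Matrix.map_mul, Matrix.nonsing_inv_mul _ (isUnit_det_kostkaMatrix n),
    Matrix.map_one _ (map_zero _) (map_one _)]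

theorem permCharMatrix_mulVec (n : ℕ) (β : ℕ →₀ ℕ) :
    (permCharMatrix n * invZMatrix n).mulVec (fun lam => coeff β (powerSumPart lam)) =
      ((kostkaMatrix n).map (Int.castRingHom ℂ)).mulVec fun κ => coeff β (schur κ.1) := by
  rw [mul_invZMatrix_mulVec]
  ext ⟨μ, hμ⟩
  obtain rfl := mem_diagramsOfCard.1 hμ
  refine (classInner_coeff_powerSumPart (degree_rowWeight μ) β).trans ?_
  rw [card_marginMultiset, ← Finset.sum_coe_sort]
  simp only [Matrix.mulVec, dotProduct, Matrix.map_apply, kostkaMatrix_apply, eq_intCast,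
    Int.cast_natCast]

theorem charTable_mulVec (n : ℕ) (β : ℕ →₀ ℕ) :
    (charTable n * invZMatrix n).mulVec (fun lam => coeff β (powerSumPart lam)) =
      fun κ => coeff β (schur κ.1) := by
  rw [charTable, Matrix.mul_assoc, ← Matrix.mulVec_mulVec, permCharMatrix_mulVec,
    Matrix.mulVec_mulVec, map_inv_mul_map_kostkaMatrix, Matrix.one_mulVec]

theorem charTable_mul_transpose (n : ℕ) :
    charTable n * invZMatrix n * (charTable n).transpose = 1 := by
  have h : charTable n * invZMatrix n * (permCharMatrix n).transpose =
      ((kostkaMatrix n).map (Int.castRingHom ℂ)).transpose := by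
    ext κ ν
    refine (congrFun (charTable_mulVec n (rowWeight ν)) κ).trans ?_
    rw [coeff_rowWeight_schur, Matrix.transpose_apply, Matrix.map_apply, kostkaMatrix_apply,
      eq_intCast, Int.cast_natCast]
  conv_lhs => rw [charTable, Matrix.transpose_mul, ← charTable, ← Matrix.mul_assoc, h]
  rw [← Matrix.transpose_mul, map_inv_mul_map_kostkaMatrix, Matrix.transpose_one]

theorem transpose_charTable_mul (n : ℕ) :
    (charTable n).transpose * (charTable n * invZMatrix n) = 1 :=
  (Matrix.mul_eq_one_comm_of_equiv (nonempty_diagramsOfCard_equiv n).some).1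
    (charTable_mul_transpose n)

theorem powerSumPart_eq_sum_schur (lam : n.Partition) :
    powerSumPart lam = ∑ κ, charTable n κ lam • schur κ := by
  ext β
  have h := congrFun (congrArg (charTable n).transpose.mulVec (charTable_mulVec n β)) lam
  rw [Matrix.mulVec_mulVec, transpose_charTable_mul, Matrix.one_mulVec] at h
  rw [h, map_sum]
  exact Finset.sum_congr rfl fun κ _ => (coeff_smul _ _ _).symm

theorem sum_classInner_charTable_mul (f g : n.Partition → ℂ) :
    ∑ κ, classInner (charTable n κ) f * classInner (charTable n κ) g = classInner f g := by
  change (fun κ => classInner (charTable n κ) f) ⬝ᵥ (fun κ => classInner (charTable n κ) g) = _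
  rw [← mul_invZMatrix_mulVec, ← mul_invZMatrix_mulVec, ← Matrix.mulVec_mulVec g,
    Matrix.dotProduct_mulVec, ← Matrix.mulVec_transpose, Matrix.mulVec_mulVec,
    transpose_charTable_mul, Matrix.one_mulVec, dotProduct_invZMatrix_mulVec]

theorem sum_smul_powerSumPart (f : n.Partition → ℂ) :
    ∑ lam, (zPart lam : ℂ)⁻¹ • f lam • powerSumPart lam =
      ∑ κ, classInner (charTable n κ) f • schur κ := by
  simp_rw [powerSumPart_eq_sum_schur, Finset.smul_sum]
  rw [Finset.sum_comm]
  refine Finset.sum_congr rfl fun κ _ => ?_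
  rw [classInner, Finset.sum_smul]
  refine Finset.sum_congr rfl fun lam _ => ?_
  rw [smul_smul, smul_smul, mul_comm (charTable n κ lam), mul_assoc]

theorem classInner_charTable_eq_mulVec {f : n.Partition → ℂ} {m : diagramsOfCard n → ℤ}
    (hm : ∀ ν, classInner (permCharMatrix n ν) f = m ν) (κ : diagramsOfCard n) :
    classInner (charTable n κ) f = ((kostkaMatrix n)⁻¹.mulVec m κ : ℂ) := by
  have h := congrFun (mul_invZMatrix_mulVec (charTable n) f) κ
  rw [charTable, Matrix.mul_assoc, ← Matrix.mulVec_mulVec, mul_invZMatrix_mulVec,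
    funext hm, ← charTable] at h
  rw [← h]
  simp [Matrix.mulVec, dotProduct]

theorem exists_apply_eq_one_or_neg_one {ι : Type*} [Fintype ι] {c : ι → ℤ}
    (hc : ∑ i, c i * c i = 1) : ∃ i, (c i = 1 ∨ c i = -1) ∧ ∀ j ≠ i, c j = 0 := by
  classical
  obtain ⟨i, hi⟩ : ∃ i, c i ≠ 0 := by
    by_contra! h
    simp [h] at hc
  have hzero : ∀ j ≠ i, c j = 0 := by
    intro j hji
    by_contra hj
    have hle : c i * c i + c j * c j ≤ 1 := by
      rw [← hc, ← Finset.sum_pair (f := fun i => c i * c i) hji.symm]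
      exact Finset.sum_le_sum_of_subset_of_nonneg (Finset.subset_univ _)
        fun _ _ _ => mul_self_nonneg _
    have := mul_self_pos.2 hi
    have := mul_self_pos.2 hj
    omega
  rw [Fintype.sum_eq_single i fun j hj => by rw [hzero j hj, zero_mul]] at hc
  exact ⟨i, mul_self_eq_one_iff.1 hc, hzero⟩

/-- The Schur expansion of `f` has integer coefficients of square sum `1`, so it is `±s_κ`; the
scalar product with the permutation character of index `κ` determines the sign. -/
theorem exists_sum_smul_powerSumPart_eq_schur {f : n.Partition → ℂ} {m : diagramsOfCard n → ℕ}
    (hm : ∀ ν, classInner (permCharMatrix n ν) f = m ν) (hf : classInner f f = 1) :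
    ∃ μ, ∑ lam, (zPart lam : ℂ)⁻¹ • f lam • powerSumPart lam = schur μ := by
  set c : diagramsOfCard n → ℤ := (kostkaMatrix n)⁻¹.mulVec fun ν => m ν with hc
  have hcf : ∀ κ, classInner (charTable n κ) f = c κ :=
    classInner_charTable_eq_mulVec fun ν => by rw [hm, Int.cast_natCast]
  have hnorm : ∑ κ, c κ * c κ = 1 := by
    have h := sum_classInner_charTable_mul f f
    simp only [hcf, hf] at h
    exact_mod_cast h
  obtain ⟨κ, hκ, hzero⟩ := exists_apply_eq_one_or_neg_one hnorm
  have hnonneg : 0 ≤ c κ := by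
    have hK : (kostkaMatrix n).mulVec c κ = m κ := by
      rw [hc, Matrix.mulVec_mulVec, Matrix.mul_nonsing_inv _ (isUnit_det_kostkaMatrix n),
        Matrix.one_mulVec]
    rw [Matrix.mulVec, dotProduct, Fintype.sum_eq_single κ fun ν h => by rw [hzero ν h, mul_zero],
      kostkaMatrix_apply, kostka_self, Nat.cast_one, one_mul] at hK
    exact hK ▸ Int.natCast_nonneg _
  refine ⟨κ, ?_⟩
  rw [sum_smul_powerSumPart, Fintype.sum_eq_single κ fun ν h => by
      rw [hcf, hzero ν h, Int.cast_zero, zero_smul],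
    hcf, hκ.resolve_right (by omega), Int.cast_one, one_smul]

end TransitionMatrix

section SchurPositive

theorem schurPositive_zero : SchurPositive 0 := ⟨0, by simp⟩

theorem schurPositive_schur (μ : YoungDiagram) : SchurPositive (schur μ) := by
  refine ⟨Finsupp.single μ 1, ?_⟩
  rw [Finsupp.support_single _ one_ne_zero, Finset.sum_singleton,
    Finsupp.single_eq_same, Nat.cast_one, one_smul]

theorem SchurPositive.add {f g : SymPS} (hf : SchurPositive f) (hg : SchurPositive g) :
    SchurPositive (f + g) := by
  obtain ⟨c, rfl⟩ := hf
  obtain ⟨d, rfl⟩ := hg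
  refine ⟨c + d, ?_⟩
  change c.sum (fun μ k => (k : ℂ) • schur μ) + d.sum (fun μ k => (k : ℂ) • schur μ) =
    (c + d).sum fun μ k => (k : ℂ) • schur μ
  refine (Finsupp.sum_add_index' (fun μ => ?_) fun μ a b => ?_).symm
  · rw [Nat.cast_zero, zero_smul]
  · rw [Nat.cast_add, add_smul]

theorem schurPositive_sum {ι : Type*} (s : Finset ι) (f : ι → SymPS)
    (h : ∀ i ∈ s, SchurPositive (f i)) : SchurPositive (∑ i ∈ s, f i) :=
  Finset.sum_induction f SchurPositive (fun _ _ => SchurPositive.add) schurPositive_zero h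

end SchurPositive

section Representations

theorem trace_mapDomainLinearMap {R Y : Type*} [CommRing R] [Finite Y] (f : Y → Y) :
    LinearMap.trace R (MonoidAlgebra R Y) (MonoidAlgebra.mapDomainLinearMap R R f) =
      Nat.card {y // f y = y} := by
  classical
  have := Fintype.ofFinite Y
  rw [LinearMap.trace_eq_matrix_trace R (MonoidAlgebra.basis Y R), Matrix.trace,
    Nat.card_eq_fintype_card, Fintype.card_subtype, Finset.card_filter, Nat.cast_sum]
  refine Finset.sum_congr rfl fun y _ => ?_
  rw [Matrix.diag_apply, LinearMap.toMatrix_apply, MonoidAlgebra.basis_apply,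
    show MonoidAlgebra.mapDomainLinearMap R R f (MonoidAlgebra.single y 1) =
      MonoidAlgebra.single (f y) 1 by simp]
  change (MonoidAlgebra.single (f y) 1 : MonoidAlgebra R Y).coeff y = _
  rw [MonoidAlgebra.coeff_single, Finsupp.single_apply, Nat.cast_ite, Nat.cast_one, Nat.cast_zero]

instance {K Y : Type*} [Field K] [Finite Y] : FiniteDimensional K (MonoidAlgebra K Y) :=
  Module.Finite.of_basis (MonoidAlgebra.basis Y K)

theorem character_ofMulAction {K G Y : Type*} [Field K] [Group G] [MulAction G Y] [Finite Y]
    (g : G) :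
    (Representation.ofMulAction K G Y).character g = Nat.card (MulAction.fixedBy Y g) :=
  trace_mapDomainLinearMap fun y : Y => g • y

theorem trace_eq_add_of_isCompl {K W : Type*} [Field K] [AddCommGroup W] [Module K W]
    [FiniteDimensional K W] {p q : Submodule K W} (h : IsCompl p q) (f : W →ₗ[K] W)
    (hp : ∀ x ∈ p, f x ∈ p) (hq : ∀ x ∈ q, f x ∈ q) :
    LinearMap.trace K W f =
      LinearMap.trace K p (f.restrict hp) + LinearMap.trace K q (f.restrict hq) := by
  rw [← LinearMap.trace_prodMap', ← LinearMap.trace_conj' _ (Submodule.prodEquivOfIsCompl p q h)]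
  congr 1
  ext x
  obtain ⟨⟨a, b⟩, rfl⟩ := (Submodule.prodEquivOfIsCompl p q h).surjective x
  rw [LinearEquiv.conj_apply_apply, LinearEquiv.symm_apply_apply]
  simp

variable {G K V : Type*} [Group G] [Field K] [AddCommGroup V] [Module K V]
  {ρ : Representation K G V}

theorem isCompl_toSubmodule {p q : Subrepresentation ρ} (h : IsCompl p q) :
    IsCompl p.toSubmodule q.toSubmodule := by
  rw [isCompl_iff, disjoint_iff, codisjoint_iff] at h ⊢
  exact ⟨congrArg Subrepresentation.toSubmodule h.1, congrArg Subrepresentation.toSubmodule h.2⟩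

theorem character_eq_add_of_isCompl [FiniteDimensional K V] {p q : Subrepresentation ρ}
    (h : IsCompl p q) (g : G) :
    ρ.character g = p.toRepresentation.character g + q.toRepresentation.character g :=
  trace_eq_add_of_isCompl (isCompl_toSubmodule h) (ρ g) (p.apply_mem_toSubmodule g)
    (q.apply_mem_toSubmodule g)

theorem finrank_toSubmodule_lt [FiniteDimensional K V] {p : Subrepresentation ρ} (hp : p ≠ ⊤) :
    Module.finrank K p.toSubmodule < Module.finrank K V :=
  Submodule.finrank_lt fun h => hp (Subrepresentation.toSubmodule_injective h)

theorem exists_isCompl_ne_top [Finite G] [NeZero (Nat.card G : K)] [Nontrivial V]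
    (hρ : ¬ ρ.IsIrreducible) : ∃ p q : Subrepresentation ρ, IsCompl p q ∧ p ≠ ⊤ ∧ q ≠ ⊤ := by
  have : Nontrivial (Subrepresentation ρ) := by
    refine ⟨⊥, ⊤, fun h => ?_⟩
    exact bot_ne_top (α := Submodule K V) (congrArg Subrepresentation.toSubmodule h)
  obtain ⟨p, hp_bot, hp_top⟩ : ∃ p : Subrepresentation ρ, p ≠ ⊥ ∧ p ≠ ⊤ := by
    by_contra! h
    exact hρ ⟨fun p => or_iff_not_imp_left.2 (h p)⟩
  obtain ⟨q, hpq⟩ := exists_isCompl p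
  refine ⟨p, q, hpq, hp_top, ?_⟩
  rintro rfl
  exact hp_bot (by simpa using hpq.inf_eq_bot)

end Representations

section FrobeniusCharacteristic

section

variable {X : Type*} [Fintype X] [DecidableEq X] {K V : Type*} [Field K] [AddCommGroup V]
  [Module K V]

theorem character_eq_of_partition_eq (ρ : Representation K (Perm X) V) {σ τ : Perm X}
    (h : σ.partition = τ.partition) : ρ.character σ = ρ.character τ := by
  obtain ⟨π, rfl⟩ := isConj_iff.1 (Perm.partition_eq_of_isConj.2 h)
  rw [Representation.char_conj]

theorem exists_partition_eq (lam : (Fintype.card X).Partition) :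
    ∃ σ : Perm X, σ.partition = lam := by
  have hcard := card_partition_eq_mul_zPart lam ▸ (Fintype.card X).factorial_ne_zero
  obtain ⟨σ, hσ⟩ := Finset.card_ne_zero.1 (left_ne_zero_of_mul hcard)
  exact ⟨σ, (Finset.mem_filter.1 hσ).2⟩

theorem exists_classFunction (ρ : Representation K (Perm X) V) :
    ∃ χ : (Fintype.card X).Partition → K, ∀ σ : Perm X, χ σ.partition = ρ.character σ := by
  choose f hf using exists_partition_eq (X := X)
  exact ⟨fun lam => ρ.character (f lam), fun σ => character_eq_of_partition_eq ρ (hf _)⟩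

end

theorem character_inv_perm {X : Type*} [Finite X] {K V : Type*} [Field K] [AddCommGroup V]
    [Module K V] (ρ : Representation K (Perm X) V) (σ : Perm X) :
    ρ.character σ⁻¹ = ρ.character σ := by
  classical
  have := Fintype.ofFinite X
  exact character_eq_of_partition_eq ρ (Perm.partition_eq_of_isConj.1
    (Perm.isConj_iff_cycleType_eq.2 (Perm.cycleType_inv σ)))

theorem natCast_card_perm (X : Type*) [Fintype X] :
    (Nat.card (Perm X) : ℂ) = (Fintype.card X).factorial := by
  rw [Nat.card_perm, Nat.card_eq_fintype_card]

variable {X : Type} [Fintype X] [DecidableEq X] {V : Type} [AddCommGroup V] [Module ℂ V]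
  {χ : (Fintype.card X).Partition → ℂ}

theorem frobeniusChar_eq_sum {ρ : Representation ℂ (Perm X) V}
    (hχ : ∀ σ : Perm X, χ σ.partition = ρ.character σ) :
    frobeniusChar ρ = ∑ lam, (zPart lam : ℂ)⁻¹ • χ lam • powerSumPart lam := by
  rw [← sum_perm_eq_sum_partition fun lam => χ lam • powerSumPart lam, frobeniusChar]
  simp only [hχ]

theorem frobeniusChar_eq_add_of_isCompl [FiniteDimensional ℂ V]
    {ρ : Representation ℂ (Perm X) V} {p q : Subrepresentation ρ} (h : IsCompl p q) :
    frobeniusChar ρ = frobeniusChar p.toRepresentation + frobeniusChar q.toRepresentation := by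
  simp only [frobeniusChar, character_eq_add_of_isCompl h, add_smul, Finset.sum_add_distrib,
    smul_add]

theorem frobeniusChar_of_subsingleton [Subsingleton V] (ρ : Representation ℂ (Perm X) V) :
    frobeniusChar ρ = 0 := by
  have hzero : ∀ σ, ρ.character σ = 0 := fun σ => by
    rw [Representation.character, Subsingleton.elim (ρ σ) 0, map_zero]
  simp only [frobeniusChar, hzero, zero_smul, Finset.sum_const_zero, smul_zero]

variable [FiniteDimensional ℂ V] (ρ : Representation ℂ (Perm X) V)

theorem classInner_permCharMatrix (hχ : ∀ σ : Perm X, χ σ.partition = ρ.character σ)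
    (ν : diagramsOfCard (Fintype.card X)) :
    classInner (permCharMatrix _ ν) χ = Module.finrank ℂ (Representation.IntertwiningMap
      (Representation.ofMulAction ℂ (Perm X) (ContentColoring X (rowWeight ν))) ρ) := by
  let : Invertible (Nat.card (Perm X) : ℂ) :=
    invertibleOfNonzero (natCast_card_perm X ▸ natCast_factorial_ne_zero _)
  rw [← Representation.card_inv_mul_sum_char_mul_char_eq_finrank, natCast_card_perm,
    classInner_eq_sum_perm]
  refine congrArg _ (Finset.sum_congr rfl fun σ _ => ?_)
  rw [hχ, character_ofMulAction, MulAction.fixedBy_inv, mul_comm]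
  exact congrArg _ (coeff_powerSumPart_partition _ σ)

theorem classInner_self_eq_one [ρ.IsIrreducible]
    (hχ : ∀ σ : Perm X, χ σ.partition = ρ.character σ) : classInner χ χ = 1 := by
  let : Invertible (Nat.card (Perm X) : ℂ) :=
    invertibleOfNonzero (natCast_card_perm X ▸ natCast_factorial_ne_zero _)
  have h := Representation.char_orthonormal ρ ρ
  rw [if_pos ⟨Representation.Equiv.refl ρ⟩, natCast_card_perm] at h
  simp only [classInner_eq_sum_perm, hχ, ← h, character_inv_perm]

theorem exists_frobeniusChar_eq_schur [ρ.IsIrreducible] : ∃ μ, frobeniusChar ρ = schur μ := by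
  obtain ⟨χ, hχ⟩ := exists_classFunction ρ
  rw [frobeniusChar_eq_sum hχ]
  exact exists_sum_smul_powerSumPart_eq_schur (classInner_permCharMatrix ρ hχ)
    (classInner_self_eq_one ρ hχ)

theorem schurPositive_frobeniusChar : SchurPositive (frobeniusChar ρ) := by
  induction hd : Module.finrank ℂ V using Nat.strong_induction_on generalizing V with
  | _ d ih =>
    subst hd
    by_cases hirr : ρ.IsIrreducible
    · obtain ⟨μ, hμ⟩ := exists_frobeniusChar_eq_schur ρ
      exact hμ ▸ schurPositive_schur μ
    rcases subsingleton_or_nontrivial V with _ | _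
    · exact frobeniusChar_of_subsingleton ρ ▸ schurPositive_zero
    obtain ⟨p, q, hpq, hp, hq⟩ := exists_isCompl_ne_top hirr
    rw [frobeniusChar_eq_add_of_isCompl hpq]
    exact (ih _ (finrank_toSubmodule_lt hp) _ rfl).add (ih _ (finrank_toSubmodule_lt hq) _ rfl)

end FrobeniusCharacteristic

section InducedRepresentations

section

variable {K G W : Type*} [Field K] [Group G] [Fintype G] [Invertible (Fintype.card G : K)]
  [AddCommGroup W] [Module K W] (τ : Representation K G W)

theorem averageMap_eq : τ.averageMap = ⅟(Fintype.card G : K) • ∑ g, τ g := by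
  simp only [Representation.averageMap, GroupAlgebra.average, map_smul, map_sum,
    Representation.asAlgebraHom_of]

theorem averageMap_comp (g : G) : τ.averageMap ∘ₗ τ g = τ.averageMap := by
  rw [Representation.averageMap, ← Representation.asAlgebraHom_single_one τ g,
    ← Module.End.mul_eq_comp, ← map_mul, GroupAlgebra.mul_average_right]

/-- The section of the projection of `W` onto its coinvariants obtained by averaging over the
group. It exhibits the coinvariants as a direct summand, so that traces on them become traces
on `W`. -/
noncomputable def averageSection : τ.Coinvariants →ₗ[K] W :=
  Representation.Coinvariants.lift τ τ.averageMap (averageMap_comp τ)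

theorem mk_comp_averageSection :
    Representation.Coinvariants.mk τ ∘ₗ averageSection τ = LinearMap.id := by
  ext v
  simp only [LinearMap.comp_apply, averageSection, Representation.Coinvariants.lift_mk,
    LinearMap.id_apply, averageMap_eq, LinearMap.smul_apply, LinearMap.sum_apply, map_smul,
    map_sum, Representation.Coinvariants.mk_self_apply]
  rw [Finset.sum_const, Finset.card_univ, ← Nat.cast_smul_eq_nsmul K, smul_smul, invOf_mul_self,
    one_smul]

theorem trace_coinvariants_map [FiniteDimensional K W]
    (f : Representation.IntertwiningMap τ τ) :
    LinearMap.trace K _ (Representation.Coinvariants.map τ τ f) =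
      ⅟(Fintype.card G : K) * ∑ g, LinearMap.trace K W (f.toLinearMap ∘ₗ τ g) := by
  have hmap : Representation.Coinvariants.map τ τ f =
      (Representation.Coinvariants.mk τ ∘ₗ f.toLinearMap) ∘ₗ averageSection τ := by
    rw [← LinearMap.comp_id (Representation.Coinvariants.map τ τ f), ← mk_comp_averageSection τ]
    rfl
  have hsection : averageSection τ ∘ₗ Representation.Coinvariants.mk τ ∘ₗ f.toLinearMap =
      τ.averageMap ∘ₗ f.toLinearMap := rfl
  rw [hmap, LinearMap.trace_comp_comm', hsection, LinearMap.trace_comp_comm', averageMap_eq,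
    LinearMap.comp_smul, map_smul, smul_eq_mul, ← Module.End.mul_eq_comp, Finset.mul_sum, map_sum]
  rfl

theorem character_ind {H : Type*} [Group H] [Finite H] [FiniteDimensional K W] (φ : G →* H)
    (h : H) :
    (Representation.ind φ τ).character h = ⅟(Fintype.card G : K) *
      ∑ g, (Nat.card {π : H // π⁻¹ * φ g * π = h} : K) * τ.character g := by
  have := Fintype.ofFinite H
  rw [Representation.character, Representation.ind_apply, trace_coinvariants_map]
  refine congrArg _ (Finset.sum_congr rfl fun g _ => ?_)
  have htensor : LinearMap.rTensor W (MonoidAlgebra.mapDomainLinearMap K K fun x : H => x * h⁻¹)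
      ∘ₗ (Representation.tprod ((Representation.leftRegular K H).comp φ) τ) g =
      TensorProduct.map (MonoidAlgebra.mapDomainLinearMap K K fun x : H => φ g * x * h⁻¹)
        (τ g) := by
    ext π a
    simp
  refine (congrArg (LinearMap.trace K _) htensor).trans ?_
  rw [LinearMap.trace_tensorProduct', trace_mapDomainLinearMap]
  refine congrArg₂ _ (congrArg _ (Nat.card_congr (Equiv.subtypeEquivRight fun π => ?_))) rfl
  rw [mul_inv_eq_iff_eq_mul, mul_assoc, inv_mul_eq_iff_eq_mul]

end

variable {X : Type} [Fintype X] [DecidableEq X]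

theorem sum_card_conj_eq_smul_powerSumPart (τ : Perm X) :
    ∑ σ : Perm X, (Nat.card {π : Perm X // π⁻¹ * τ * π = σ} : ℂ) • powerSumPart σ.partition =
      ((Fintype.card X).factorial : ℂ) • powerSumPart τ.partition := by
  have hconj (π : Perm X) : powerSumPart (π⁻¹ * τ * π).partition = powerSumPart τ.partition := by
    rw [Perm.partition_eq_of_isConj.1 (isConj_iff.2 ⟨π, by group⟩ : IsConj (π⁻¹ * τ * π) τ)]
  calc ∑ σ : Perm X, (Nat.card {π : Perm X // π⁻¹ * τ * π = σ} : ℂ) • powerSumPart σ.partition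
      = ∑ σ : Perm X, ∑ π with π⁻¹ * τ * π = σ, powerSumPart (π⁻¹ * τ * π).partition := by
        refine Finset.sum_congr rfl fun σ _ => ?_
        rw [Finset.sum_congr rfl fun π hπ => by rw [(Finset.mem_filter.1 hπ).2],
          Finset.sum_const, Nat.card_eq_fintype_card, Fintype.card_subtype,
          Nat.cast_smul_eq_nsmul]
    _ = ∑ π : Perm X, powerSumPart (π⁻¹ * τ * π).partition := Finset.sum_fiberwise _ _ _
    _ = ((Fintype.card X).factorial : ℂ) • powerSumPart τ.partition := by
        simp only [hconj, Finset.sum_const, Finset.card_univ, Fintype.card_perm,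
          Nat.cast_smul_eq_nsmul]

theorem frobeniusChar_ind {G : Type} [Group G] [Fintype G] {A : Type} [AddCommGroup A]
    [Module ℂ A] [FiniteDimensional ℂ A] (φ : G →* Perm X) (ρ : Representation ℂ G A) :
    frobeniusChar (Representation.ind φ ρ) =
      (Fintype.card G : ℂ)⁻¹ • ∑ g, ρ.character g • powerSumPart (φ g).partition := by
  let : Invertible (Fintype.card G : ℂ) :=
    invertibleOfNonzero (Nat.cast_ne_zero.2 Fintype.card_ne_zero)
  rw [frobeniusChar, inv_smul_eq_iff₀ (natCast_factorial_ne_zero _)]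
  simp only [character_ind, invOf_eq_inv, mul_smul, Finset.sum_smul]
  rw [← Finset.smul_sum, Finset.sum_comm, smul_comm]
  congr 1
  rw [Finset.smul_sum]
  refine Finset.sum_congr rfl fun g _ => ?_
  rw [smul_comm, ← sum_card_conj_eq_smul_powerSumPart, Finset.smul_sum]
  exact Finset.sum_congr rfl fun σ _ => smul_comm _ _ _

end InducedRepresentations

section CycleIndex

/-- The cycle index `|G|⁻¹ ∑_g ξ(g) p_{cycle type of φ(g)}` of a finite group `G` acting through
`φ`, weighted by a linear character `ξ` of `G`. -/
noncomputable def cycleIndex {G X : Type*} [Group G] [Fintype G] [Fintype X] [DecidableEq X]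
    (φ : G →* Perm X) (ξ : G →* ℂ) : SymPS :=
  (Fintype.card G : ℂ)⁻¹ • ∑ g, ξ g • powerSumPart (φ g).partition

/-- The one-dimensional representation on which a group acts through a linear character. -/
noncomputable def linearRep {K G : Type*} [Field K] [Group G] (ξ : G →* K) :
    Representation K G K :=
  ((algebraMap K (Module.End K K)).toMonoidHom).comp ξ

theorem character_linearRep {K G : Type*} [Field K] [Group G] (ξ : G →* K) (g : G) :
    (linearRep ξ).character g = ξ g := by
  have hsmul : linearRep ξ g = ξ g • LinearMap.id := rfl
  rw [Representation.character, hsmul, map_smul, LinearMap.trace_id, Module.finrank_self,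
    Nat.cast_one, smul_eq_mul, mul_one]

theorem frobeniusChar_ind_linearRep {G X : Type} [Group G] [Fintype G] [Fintype X]
    [DecidableEq X] (φ : G →* Perm X) (ξ : G →* ℂ) :
    frobeniusChar (Representation.ind φ (linearRep ξ)) = cycleIndex φ ξ := by
  simp only [frobeniusChar_ind, character_linearRep, cycleIndex]

theorem cycleIndex_sumCongr {G H X Y : Type*} [Group G] [Fintype G] [Group H] [Fintype H]
    [Fintype X] [DecidableEq X] [Fintype Y] [DecidableEq Y] (φ : G →* Perm X) (ξ : G →* ℂ)
    (ψ : H →* Perm Y) (η : H →* ℂ) :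
    cycleIndex ((Perm.sumCongrHom X Y).comp (φ.prodMap ψ))
        (ξ.comp (MonoidHom.fst G H) * η.comp (MonoidHom.snd G H)) =
      cycleIndex φ ξ * cycleIndex ψ η := by
  unfold cycleIndex
  rw [smul_mul_smul_comm, Fintype.card_prod, Nat.cast_mul, mul_inv, Finset.sum_mul_sum,
    Fintype.sum_prod_type]
  congr 1
  refine Finset.sum_congr rfl fun g _ => Finset.sum_congr rfl fun h _ => ?_
  rw [smul_mul_smul_comm, ← powerSumPart_sumCongr]
  rfl

/-- `f` is the cycle index of some finite permutation group weighted by a linear character. These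
series are Schur-positive, and unlike Schur positivity this property is easily seen to be preserved
by products and by plethysm with `h_m`. -/
def IsCycleIndex (f : SymPS) : Prop :=
  ∃ (G X : Type) (_ : Group G) (_ : Fintype G) (_ : Fintype X) (_ : DecidableEq X)
    (φ : G →* Perm X) (ξ : G →* ℂ), f = cycleIndex φ ξ

theorem IsCycleIndex.schurPositive {f : SymPS} (hf : IsCycleIndex f) : SchurPositive f := by
  obtain ⟨G, X, _, _, _, _, φ, ξ, rfl⟩ := hf
  rw [← frobeniusChar_ind_linearRep]
  exact schurPositive_frobeniusChar _

theorem isCycleIndex_one : IsCycleIndex 1 := by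
  refine ⟨Unit, Fin 0, inferInstance, inferInstance, inferInstance, inferInstance, 1, 1, ?_⟩
  simp [cycleIndex, powerSumPart_one_of_isEmpty]

theorem IsCycleIndex.mul {f g : SymPS} (hf : IsCycleIndex f) (hg : IsCycleIndex g) :
    IsCycleIndex (f * g) := by
  obtain ⟨G, X, _, _, _, _, φ, ξ, rfl⟩ := hf
  obtain ⟨H, Y, _, _, _, _, ψ, η, rfl⟩ := hg
  exact ⟨G × H, X ⊕ Y, inferInstance, inferInstance, inferInstance, inferInstance, _, _,
    (cycleIndex_sumCongr φ ξ ψ η).symm⟩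

theorem isCycleIndex_prod {ι : Type*} (s : Finset ι) (f : ι → SymPS)
    (h : ∀ i ∈ s, IsCycleIndex (f i)) : IsCycleIndex (∏ i ∈ s, f i) :=
  Finset.prod_induction f IsCycleIndex (fun _ _ => IsCycleIndex.mul) isCycleIndex_one h

end CycleIndex

section PartialQuotients

variable {G : Type*} [Group G]

/-- The sequence `g` in a group determined by `g i * ⋯ * g 1 * g 0 = u i` for all `i`. -/
def partialQuotients {k : ℕ} (u : Fin (k + 1) → G) : Fin (k + 1) → G :=
  Fin.cases (u 0) fun i => u i.succ * (u i.castSucc)⁻¹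

theorem partialQuotients_zero {k : ℕ} (u : Fin (k + 1) → G) : partialQuotients u 0 = u 0 := rfl

theorem partialQuotients_succ {k : ℕ} (u : Fin (k + 1) → G) (i : Fin k) :
    partialQuotients u i.succ = u i.succ * (u i.castSucc)⁻¹ := rfl

theorem partialQuotients_castSucc {k : ℕ} (u : Fin (k + 2) → G) (i : Fin (k + 1)) :
    partialQuotients u i.castSucc = partialQuotients (fun j => u j.castSucc) i := by
  cases i using Fin.cases <;> rfl

theorem map_comp_partialQuotients {H : Type*} [Group H] (φ : G →* H) {k : ℕ}
    (u : Fin (k + 1) → G) : φ ∘ partialQuotients u = partialQuotients (φ ∘ u) := by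
  funext i
  cases i using Fin.cases with
  | zero => rfl
  | succ i => simp only [Function.comp_apply, partialQuotients_succ, map_mul, map_inv]

theorem partialQuotients_bijective (k : ℕ) :
    Function.Bijective (partialQuotients : (Fin (k + 1) → G) → Fin (k + 1) → G) := by
  constructor
  · intro u v h
    funext i
    induction i using Fin.induction with
    | zero => exact congrFun h 0
    | succ i ih =>
      have hsucc := congrFun h i.succ
      rw [partialQuotients_succ, partialQuotients_succ, ih] at hsucc
      exact mul_right_cancel hsucc
  · intro g
    refine ⟨Fin.induction (g 0) fun i p => g i.succ * p, funext fun i => ?_⟩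
    cases i using Fin.cases with
    | zero => rfl
    | succ i => rw [partialQuotients_succ, Fin.induction_succ, mul_inv_cancel_right]

theorem prod_map_partialQuotients {M : Type*} [CommMonoid M] (ξ : G →* M) {k : ℕ}
    (u : Fin (k + 1) → G) : ∏ i, ξ (partialQuotients u i) = ξ (u (Fin.last k)) := by
  induction k with
  | zero => rw [Fin.prod_univ_one, partialQuotients_zero, Fin.last_zero]
  | succ k ih =>
    rw [Fin.prod_univ_castSucc]
    simp only [partialQuotients_castSucc]
    rw [ih, ← Fin.succ_last, partialQuotients_succ, mul_comm, ← map_mul, inv_mul_cancel_right]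

end PartialQuotients

section CyclePlethysm

variable {ι κ : Type*} [Fintype ι] [DecidableEq ι] [Fintype κ] [DecidableEq κ]

/-- The plethysm `p_lam[f]`, where `lam` is the cycle type of the permutation `τ`. -/
noncomputable def cyclePlethysm (τ : Perm ι) (f : SymPS) : SymPS :=
  (τ.partition.parts.map fun k => powerPlethysm k f).prod

theorem cyclePlethysm_permCongr (e : ι ≃ κ) (τ : Perm ι) (f : SymPS) :
    cyclePlethysm (e.permCongr τ) f = cyclePlethysm τ f := by
  unfold cyclePlethysm
  rw [parts_partition_permCongr]

theorem cyclePlethysm_one_of_isEmpty [IsEmpty ι] (f : SymPS) :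
    cyclePlethysm (1 : Perm ι) f = 1 := by
  unfold cyclePlethysm
  rw [parts_partition_one, Fintype.card_eq_zero, Multiset.replicate_zero, Multiset.map_zero,
    Multiset.prod_zero]

theorem cyclePlethysm_finRotate (k : ℕ) (f : SymPS) :
    cyclePlethysm (finRotate (k + 1)) f = powerPlethysm (k + 1) f := by
  rw [cyclePlethysm, parts_partition_finRotate, Multiset.map_singleton, Multiset.prod_singleton]

theorem cyclePlethysm_sumCongr (σ : Perm ι) (τ : Perm κ) (f : SymPS) :
    cyclePlethysm (Perm.sumCongr σ τ) f = cyclePlethysm σ f * cyclePlethysm τ f := by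
  unfold cyclePlethysm
  rw [parts_partition_sumCongr, Multiset.map_add, Multiset.prod_add]

theorem hPlethysm_card_eq_sum_perm (ι : Type) [Fintype ι] [DecidableEq ι] (f : SymPS) :
    hPlethysm (Fintype.card ι) f =
      ((Fintype.card ι).factorial : ℂ)⁻¹ • ∑ τ : Perm ι, cyclePlethysm τ f :=
  (sum_perm_eq_sum_partition fun lam => (lam.parts.map fun k => powerPlethysm k f).prod).symm

end CyclePlethysm

section WreathProduct

/-- The permutation `(i, x) ↦ (τ i, g (τ i) x)` of `ι × X`, by which the element `(g, τ)` of the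
wreath product of `Perm X` with `Perm ι` acts. -/
def wreathPerm {ι X : Type*} (τ : Perm ι) (g : ι → Perm X) : Perm (ι × X) :=
  Equiv.prodShear τ fun i => g (τ i)

theorem wreathPerm_apply {ι X : Type*} (τ : Perm ι) (g : ι → Perm X) (i : ι) (x : X) :
    wreathPerm τ g (i, x) = (τ i, g (τ i) x) := rfl

section FixedColoringRotate

variable {X : Type*} {k : ℕ}

theorem wreathPerm_finRotate_castSucc (u : Fin (k + 1) → Perm X) (i : Fin k) (x : X) :
    wreathPerm (finRotate (k + 1)) (partialQuotients u) (i.castSucc, u i.castSucc x) =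
      (i.succ, u i.succ x) := by
  rw [wreathPerm_apply, finRotate_apply, Fin.coeSucc_eq_succ, partialQuotients_succ,
    Perm.mul_apply, Perm.coe_inv, symm_apply_apply]

theorem wreathPerm_finRotate_last (u : Fin (k + 1) → Perm X) (x : X) :
    wreathPerm (finRotate (k + 1)) (partialQuotients u) (Fin.last k, x) = (0, u 0 x) := by
  rw [wreathPerm_apply, finRotate_last, partialQuotients_zero]

theorem fixedColoring_apply_eq_apply_zero {u : Fin (k + 1) → Perm X}
    (c : FixedColoring (wreathPerm (finRotate (k + 1)) (partialQuotients u))) (i : Fin (k + 1))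
    (x : X) : c.1 (i, u i x) = c.1 (0, u 0 x) := by
  induction i using Fin.induction with
  | zero => rfl
  | succ i ih => rw [← ih, ← wreathPerm_finRotate_castSucc, c.2]

/-- A cycle of `wreathPerm (finRotate (k + 1)) g` runs `k + 1` times as long as the cycle of the
product `g k * ⋯ * g 0` that it induces on the last fiber, hence the bijection between the colorings
fixed by the two permutations. -/
def fixedColoringRotate (u : Fin (k + 1) → Perm X) :
    FixedColoring (u (Fin.last k)) ≃
      FixedColoring (wreathPerm (finRotate (k + 1)) (partialQuotients u)) where
  toFun d := ⟨fun p => d.1 ((u p.1).symm p.2), by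
    rintro ⟨i, x⟩
    obtain ⟨x, rfl⟩ := (u i).surjective x
    cases i using Fin.lastCases with
    | last => simp only [wreathPerm_finRotate_last, symm_apply_apply, d.2]
    | cast i => simp only [wreathPerm_finRotate_castSucc, symm_apply_apply]⟩
  invFun c := ⟨fun x => c.1 (Fin.last k, u (Fin.last k) x), fun x => by
    dsimp only
    rw [fixedColoring_apply_eq_apply_zero, ← wreathPerm_finRotate_last, c.2]⟩
  left_inv d := Subtype.ext (funext fun x => congrArg d.1 (symm_apply_apply _ x))
  right_inv c := Subtype.ext (funext fun ⟨i, x⟩ => by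
    obtain ⟨x, rfl⟩ := (u i).surjective x
    simp only [symm_apply_apply, fixedColoring_apply_eq_apply_zero])

theorem powerSumPart_wreathPerm_finRotate {X : Type} [Fintype X] [DecidableEq X]
    (u : Fin (k + 1) → Perm X) :
    powerSumPart (wreathPerm (finRotate (k + 1)) (partialQuotients u)).partition =
      powerPlethysm (k + 1) (powerSumPart (u (Fin.last k)).partition) := by
  simp only [powerPlethysm_of_ne_zero k.succ_ne_zero, powerSumPart_eq_fixedColoringSeries,
    fixedColoringSeries, expand_genSeries]
  refine (genSeries_congr (fixedColoringRotate u) fun d => ?_).symm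
  calc ∑ p : Fin (k + 1) × X, Finsupp.single (d.1 ((u p.1).symm p.2)) 1
      = ∑ _i : Fin (k + 1), content d.1 := by
        rw [Fintype.sum_prod_type]
        exact Finset.sum_congr rfl fun i _ => content_comp_equiv d.1 (u i).symm
    _ = (k + 1) • content d.1 := by rw [Finset.sum_const, Finset.card_univ, Fintype.card_fin]

end FixedColoringRotate

section WreathSeries

variable {G X : Type} [Group G] [Fintype G] [Fintype X] [DecidableEq X] (φ : G →* Perm X)
  (ξ : G →* ℂ) {ι κ : Type} [Fintype ι] [DecidableEq ι] [Fintype κ] [DecidableEq κ]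

/-- The contribution to the cycle index of the wreath product of `G` with `Perm ι` of the coset
`{(g, τ) | g : ι → G}`, normalized by the number of its elements. -/
noncomputable def wreathSeries (τ : Perm ι) : SymPS :=
  (Fintype.card (ι → G) : ℂ)⁻¹ •
    ∑ g : ι → G, (∏ i, ξ (g i)) • powerSumPart (wreathPerm τ (φ ∘ g)).partition

theorem wreathSeries_permCongr (e : ι ≃ κ) (τ : Perm ι) :
    wreathSeries φ ξ (e.permCongr τ) = wreathSeries φ ξ τ := by
  have hsum (g : ι → G) :
      (∏ i, ξ (g i)) • powerSumPart (wreathPerm τ (φ ∘ g)).partition =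
        (∏ j, ξ (g (e.symm j))) •
          powerSumPart (wreathPerm (e.permCongr τ) (φ ∘ g ∘ e.symm)).partition := by
    have hperm : wreathPerm (e.permCongr τ) (φ ∘ g ∘ e.symm) =
        (e.prodCongr (Equiv.refl X)).permCongr (wreathPerm τ (φ ∘ g)) := by
      ext1 ⟨j, x⟩
      simp [wreathPerm_apply, Equiv.permCongr_apply]
    rw [Equiv.prod_comp e.symm fun i => ξ (g i), hperm, powerSumPart_permCongr]
  unfold wreathSeries
  rw [Fintype.card_congr (e.arrowCongr (Equiv.refl G))]
  exact congrArg _ (Fintype.sum_equiv (e.arrowCongr (Equiv.refl G)) _ _ hsum).symm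

theorem wreathSeries_of_isEmpty [IsEmpty ι] (τ : Perm ι) : wreathSeries φ ξ τ = 1 := by
  rw [wreathSeries, Fintype.card_unique, Fintype.sum_unique, Fintype.prod_empty,
    Subsingleton.elim (wreathPerm _ _) 1, powerSumPart_one_of_isEmpty]
  simp

theorem wreathSeries_finRotate (k : ℕ) :
    wreathSeries φ ξ (finRotate (k + 1)) = powerPlethysm (k + 1) (cycleIndex φ ξ) := by
  let F (g : G) : SymPS := ξ g • powerPlethysm (k + 1) (powerSumPart (φ g).partition)
  have hG : (Fintype.card G : ℂ) ≠ 0 := Nat.cast_ne_zero.2 Fintype.card_ne_zero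
  have hreindex : ∑ g : Fin (k + 1) → G, (∏ i, ξ (g i)) •
      powerSumPart (wreathPerm (finRotate (k + 1)) (φ ∘ g)).partition =
        ∑ u : Fin (k + 1) → G, F (u (Fin.last k)) := by
    refine (Fintype.sum_equiv (Equiv.ofBijective _ (partialQuotients_bijective k)) _ _
      fun u => ?_).symm
    rw [Equiv.ofBijective_apply, prod_map_partialQuotients, map_comp_partialQuotients,
      powerSumPart_wreathPerm_finRotate]
    rfl
  have hlast : ∑ u : Fin (k + 1) → G, F (u (Fin.last k)) =
      (Fintype.card G : ℂ) ^ k • ∑ g, F g := by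
    have h := Fintype.sum_piFinset_apply F Finset.univ (Fin.last k)
    rwa [Fintype.piFinset_univ, Finset.card_univ, Fintype.card_fin, Nat.add_sub_cancel,
      ← Nat.cast_smul_eq_nsmul ℂ, Nat.cast_pow] at h
  rw [wreathSeries, hreindex, hlast, smul_smul, Fintype.card_fun, Fintype.card_fin, Nat.cast_pow,
    pow_succ, mul_inv, mul_comm _⁻¹, mul_assoc, inv_mul_cancel₀ (pow_ne_zero k hG), mul_one,
    cycleIndex, powerPlethysm_smul, powerPlethysm_sum]
  simp only [powerPlethysm_smul, F]

theorem wreathSeries_sumCongr (σ : Perm ι) (τ : Perm κ) :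
    wreathSeries φ ξ (Perm.sumCongr σ τ) = wreathSeries φ ξ σ * wreathSeries φ ξ τ := by
  have hperm (g : ι ⊕ κ → G) :
      (Equiv.sumProdDistrib ι κ X).permCongr (wreathPerm (Perm.sumCongr σ τ) (φ ∘ g)) =
        Perm.sumCongr (wreathPerm σ (φ ∘ g ∘ Sum.inl)) (wreathPerm τ (φ ∘ g ∘ Sum.inr)) := by
    ext1 (⟨i, x⟩ | ⟨i, x⟩) <;> rfl
  unfold wreathSeries
  rw [smul_mul_smul_comm, ← mul_inv, ← Nat.cast_mul, ← Fintype.card_prod,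
    Fintype.card_congr (Equiv.sumArrowEquivProdArrow ι κ G), Finset.sum_mul_sum,
    ← Fintype.sum_prod_type']
  refine congrArg _ (Fintype.sum_equiv (Equiv.sumArrowEquivProdArrow ι κ G) _ _ fun g => ?_)
  rw [smul_mul_smul_comm, Fintype.prod_sum_type,
    ← powerSumPart_permCongr (Equiv.sumProdDistrib ι κ X), hperm, powerSumPart_sumCongr]
  rfl

theorem wreathSeries_eq_cyclePlethysm (τ : Perm ι) :
    wreathSeries φ ξ τ = cyclePlethysm τ (cycleIndex φ ξ) := by
  refine perm_sumCongr_induction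
    (C := fun ι _ _ τ => wreathSeries φ ξ τ = cyclePlethysm τ (cycleIndex φ ξ)) ?_ ?_ ?_ ?_ τ
  · intro ι κ _ _ _ _ e σ hσ
    rw [wreathSeries_permCongr, cyclePlethysm_permCongr, hσ]
  · rw [wreathSeries_of_isEmpty, cyclePlethysm_one_of_isEmpty]
  · intro k
    rw [wreathSeries_finRotate, cyclePlethysm_finRotate]
  · intro ι κ _ _ _ _ σ τ hσ hτ
    rw [wreathSeries_sumCongr, cyclePlethysm_sumCongr, hσ, hτ]

end WreathSeries

/-- The action on `ι × X` of the wreath product of `G` with `Perm ι`, for a group `G` acting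
on `X`. -/
def wreathHom {G X ι : Type*} [Group G] (φ : G →* Perm X) :
    (ι → G) ⋊[mulAutArrow] Perm ι →* Perm (ι × X) where
  toFun w := wreathPerm w.right (φ ∘ w.left)
  map_one' := by
    ext1 ⟨i, x⟩
    simp [wreathPerm_apply]
  map_mul' a b := by
    ext1 ⟨i, x⟩
    have hleft : (mulAutArrow a.right b.left) (a.right (b.right i)) = b.left (b.right i) :=
      congrArg b.left (symm_apply_apply a.right _)
    simp only [Perm.mul_apply, wreathPerm_apply, SemidirectProduct.mul_left,
      SemidirectProduct.mul_right, Function.comp_apply, Pi.mul_apply, map_mul, hleft]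

/-- The linear character `(g, τ) ↦ ∏ i, ξ (g i)` of the wreath product of `G` with `Perm ι`. -/
def wreathChar {G ι M : Type*} [Group G] [Fintype ι] [CommMonoid M] (ξ : G →* M) :
    (ι → G) ⋊[mulAutArrow] Perm ι →* M where
  toFun w := ∏ i, ξ (w.left i)
  map_one' := by simp
  map_mul' a b := by
    simp only [SemidirectProduct.mul_left, Pi.mul_apply, map_mul, Finset.prod_mul_distrib]
    exact congrArg _ (Equiv.prod_comp a.right⁻¹ fun i => ξ (b.left i))

theorem cycleIndex_wreath {G X ι : Type} [Group G] [Fintype G] [Fintype X] [DecidableEq X]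
    [Fintype ι] [DecidableEq ι] [Fintype ((ι → G) ⋊[mulAutArrow] Perm ι)] (φ : G →* Perm X)
    (ξ : G →* ℂ) :
    cycleIndex (wreathHom (ι := ι) φ) (wreathChar ξ) =
      hPlethysm (Fintype.card ι) (cycleIndex φ ξ) := by
  have hsum : ∑ w : (ι → G) ⋊[mulAutArrow] Perm ι,
      wreathChar ξ w • powerSumPart (wreathHom φ w).partition =
        ∑ p : (ι → G) × Perm ι,
          (∏ i, ξ (p.1 i)) • powerSumPart (wreathPerm p.2 (φ ∘ p.1)).partition :=
    Fintype.sum_equiv SemidirectProduct.equivProd _ _ fun w => rfl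
  rw [cycleIndex, hsum, Fintype.card_congr SemidirectProduct.equivProd, Fintype.card_prod,
    Fintype.card_perm, hPlethysm_card_eq_sum_perm, Fintype.sum_prod_type_right, Nat.cast_mul,
    mul_inv, mul_comm, mul_smul, Finset.smul_sum]
  simp only [← wreathSeries_eq_cyclePlethysm, wreathSeries]

theorem IsCycleIndex.hPlethysm {f : SymPS} (hf : IsCycleIndex f) (m : ℕ) :
    IsCycleIndex (hPlethysm m f) := by
  obtain ⟨G, X, _, _, _, _, φ, ξ, rfl⟩ := hf
  let : Fintype ((Fin m → G) ⋊[mulAutArrow] Perm (Fin m)) :=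
    Fintype.ofEquiv _ SemidirectProduct.equivProd.symm
  refine ⟨(Fin m → G) ⋊[mulAutArrow] Perm (Fin m), Fin m × X, inferInstance, inferInstance,
    inferInstance, inferInstance, wreathHom φ, wreathChar ξ, ?_⟩
  rw [cycleIndex_wreath, Fintype.card_fin]

end WreathProduct

section NewtonRecursion

variable {R : Type*} [CommSemiring R]

/-- The product `∏_i f i m_i` over the distinct elements `i` of a multiset, `m_i` being the
multiplicity of `i`. Both `z_lam⁻¹ p_lam[f]` and `H_lam[Q]` have this shape. -/
def multiplicityWeight (f : ℕ → ℕ → R) (s : Multiset ℕ) : R :=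
  ∏ i ∈ s.toFinset, f i (s.count i)

/-- The partitions of `n`, represented by their multisets of parts: unlike in `n.Partition`, parts
can be added and removed without changing the type. -/
def partitionParts (n : ℕ) : Finset (Multiset ℕ) :=
  Finset.univ.map ⟨Nat.Partition.parts (n := n), fun _ _ => Nat.Partition.ext⟩

theorem mem_partitionParts {n : ℕ} {s : Multiset ℕ} :
    s ∈ partitionParts n ↔ (∀ i ∈ s, 0 < i) ∧ s.sum = n := by
  rw [partitionParts, Finset.mem_map]
  constructor
  · rintro ⟨lam, -, rfl⟩
    exact ⟨fun _ hi => lam.parts_pos hi, lam.parts_sum⟩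
  · rintro ⟨hpos, hsum⟩
    exact ⟨⟨s, hpos _, hsum⟩, Finset.mem_univ _, rfl⟩

theorem sum_partition_eq_sum_partitionParts (n : ℕ) (F : Multiset ℕ → R) :
    ∑ lam : n.Partition, F lam.parts = ∑ s ∈ partitionParts n, F s := by
  rw [partitionParts, Finset.sum_map]
  rfl

theorem add_replicate_mem_partitionParts {n i k : ℕ} (hi : 0 < i) {t : Multiset ℕ} :
    t + Multiset.replicate k i ∈ partitionParts n ↔
      i * k ≤ n ∧ t ∈ partitionParts (n - i * k) := by
  simp only [mem_partitionParts, Multiset.mem_add, or_imp, forall_and, Multiset.sum_add,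
    Multiset.sum_replicate, smul_eq_mul, mul_comm k]
  have : ∀ j ∈ Multiset.replicate k i, 0 < j := fun j hj => by
    rwa [Multiset.eq_of_mem_replicate hj]
  exact ⟨fun ⟨h, _⟩ => ⟨by omega, h.1, by omega⟩, fun ⟨_, hpos, _⟩ => ⟨⟨hpos, this⟩, by omega⟩⟩

theorem sum_partitionParts_sub_replicate (n : ℕ) (F : ℕ → ℕ → Multiset ℕ → R) :
    ∑ s ∈ partitionParts n, ∑ i ∈ s.toFinset, ∑ k ∈ Finset.Icc 1 (s.count i),
        F i k (s - Multiset.replicate k i) =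
      ∑ j ∈ Finset.Icc 1 n, ∑ x ∈ j.divisorsAntidiagonal, ∑ t ∈ partitionParts (n - j),
        F x.1 x.2 t := by
  have sub_add_replicate {s : Multiset ℕ} {i k : ℕ} (h : k ≤ s.count i) :
      s - Multiset.replicate k i + Multiset.replicate k i = s :=
    tsub_add_cancel_of_le (Multiset.le_count_iff_replicate_le.1 h)
  simp only [Finset.sum_sigma']
  refine Finset.sum_bij'
    (fun x _ => ⟨x.2.1 * x.2.2, (x.2.1, x.2.2), x.1 - Multiset.replicate x.2.2 x.2.1⟩)
    (fun y _ => ⟨y.2.2 + Multiset.replicate y.2.1.2 y.2.1.1, y.2.1.1, y.2.1.2⟩)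
    ?_ ?_ ?_ ?_ fun _ _ => rfl
  · rintro ⟨s, i, k⟩ h
    simp only [Finset.mem_sigma, Multiset.mem_toFinset, Finset.mem_Icc,
      Nat.mem_divisorsAntidiagonal] at h ⊢
    obtain ⟨hs, his, hk, hcount⟩ := h
    have hi : 0 < i := (mem_partitionParts.1 hs).1 i his
    have hik : 0 < i * k := Nat.mul_pos hi hk
    rw [← sub_add_replicate hcount, add_replicate_mem_partitionParts hi] at hs
    exact ⟨⟨hik, hs.1⟩, ⟨trivial, hik.ne'⟩, hs.2⟩
  · rintro ⟨j, ⟨i, k⟩, t⟩ h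
    simp only [Finset.mem_sigma, Multiset.mem_toFinset, Finset.mem_Icc,
      Nat.mem_divisorsAntidiagonal] at h ⊢
    obtain ⟨⟨-, hj⟩, ⟨rfl, hik⟩, ht⟩ := h
    have hk : k ≠ 0 := right_ne_zero_of_mul hik
    rw [Multiset.count_add, Multiset.count_replicate_self]
    exact ⟨(add_replicate_mem_partitionParts (Nat.pos_of_ne_zero (left_ne_zero_of_mul hik))).2
        ⟨hj, ht⟩, Multiset.mem_add.2 (Or.inr (Multiset.mem_replicate.2 ⟨hk, rfl⟩)),
      Nat.one_le_iff_ne_zero.2 hk, Nat.le_add_left _ _⟩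
  · rintro ⟨s, i, k⟩ h
    simp only [Finset.mem_sigma, Finset.mem_Icc] at h
    simp only [sub_add_replicate h.2.2.2]
  · rintro ⟨j, ⟨i, k⟩, t⟩ h
    simp only [Finset.mem_sigma, Nat.mem_divisorsAntidiagonal] at h
    simp only [h.2.1.1, add_tsub_cancel_right]

theorem sum_mul_multiplicityWeight {f c : ℕ → ℕ → R} (hf : ∀ i, f i 0 = 1)
    (hc : ∀ i m : ℕ, (m : R) * f i m = ∑ k ∈ Finset.Icc 1 m, c i k * f i (m - k))
    (s : Multiset ℕ) :
    (s.sum : R) * multiplicityWeight f s = ∑ i ∈ s.toFinset, ∑ k ∈ Finset.Icc 1 (s.count i),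
      i * c i k * multiplicityWeight f (s - Multiset.replicate k i) := by
  have weight_sub (i : ℕ) (hi : i ∈ s.toFinset) (k : ℕ) :
      multiplicityWeight f (s - Multiset.replicate k i) =
        f i (s.count i - k) * ∏ a ∈ s.toFinset.erase i, f a (s.count a) := by
    have hsub : (s - Multiset.replicate k i).toFinset ⊆ s.toFinset :=
      Multiset.toFinset_subset.2 (Multiset.subset_of_le (Multiset.sub_le_self _ _))
    rw [multiplicityWeight, Finset.prod_subset hsub fun a _ ha => by
        rw [Multiset.count_eq_zero.2 (mt Multiset.mem_toFinset.2 ha), hf],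
      ← Finset.mul_prod_erase _ _ hi, Multiset.count_sub, Multiset.count_replicate_self]
    refine congrArg _ (Finset.prod_congr rfl fun a ha => ?_)
    rw [Multiset.count_sub, Multiset.count_replicate, if_neg (Finset.ne_of_mem_erase ha).symm,
      Nat.sub_zero]
  rw [Finset.sum_multiset_count, Nat.cast_sum, Finset.sum_mul]
  refine Finset.sum_congr rfl fun i hi => ?_
  rw [multiplicityWeight, ← Finset.mul_prod_erase _ _ hi]
  simp only [weight_sub i hi]
  calc _ = (i : R) * ((s.count i : R) * f i (s.count i)) *
        ∏ a ∈ s.toFinset.erase i, f a (s.count a) := by rw [smul_eq_mul, Nat.cast_mul]; ring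
    _ = _ := by
      rw [hc, Finset.mul_sum, Finset.sum_mul]
      exact Finset.sum_congr rfl fun k _ => by ring

theorem natCast_mul_sum_multiplicityWeight {f c : ℕ → ℕ → R} (hf : ∀ i, f i 0 = 1)
    (hc : ∀ i m : ℕ, (m : R) * f i m = ∑ k ∈ Finset.Icc 1 m, c i k * f i (m - k)) (n : ℕ) :
    (n : R) * ∑ lam : n.Partition, multiplicityWeight f lam.parts =
      ∑ j ∈ Finset.Icc 1 n, (∑ x ∈ j.divisorsAntidiagonal, x.1 * c x.1 x.2) *
        ∑ lam : (n - j).Partition, multiplicityWeight f lam.parts := by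
  simp only [sum_partition_eq_sum_partitionParts _ (multiplicityWeight f)]
  calc _ = ∑ s ∈ partitionParts n, (s.sum : R) * multiplicityWeight f s := by
        rw [Finset.mul_sum]
        exact Finset.sum_congr rfl fun s hs => by rw [(mem_partitionParts.1 hs).2]
    _ = ∑ s ∈ partitionParts n, ∑ i ∈ s.toFinset, ∑ k ∈ Finset.Icc 1 (s.count i),
        i * c i k * multiplicityWeight f (s - Multiset.replicate k i) :=
      Finset.sum_congr rfl fun s _ => sum_mul_multiplicityWeight hf hc s
    _ = _ := by
      rw [sum_partitionParts_sub_replicate n fun i k t => i * c i k * multiplicityWeight f t]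
      simp only [Finset.sum_mul_sum]

end NewtonRecursion

theorem eq_of_natCast_mul_eq_sum {R : Type*} [Semiring R] [IsAddTorsionFree R] {b a a' : ℕ → R}
    (h0 : a 0 = a' 0)
    (h : ∀ n : ℕ, (n : R) * a n = ∑ j ∈ Finset.Icc 1 n, b j * a (n - j))
    (h' : ∀ n : ℕ, (n : R) * a' n = ∑ j ∈ Finset.Icc 1 n, b j * a' (n - j)) (n : ℕ) :
    a n = a' n := by
  induction n using Nat.strong_induction_on with
  | _ n ih =>
    rcases eq_or_ne n 0 with rfl | hn
    · exact h0
    refine nsmul_right_injective hn ?_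
    simp only [nsmul_eq_mul, h, h']
    refine Finset.sum_congr rfl fun j hj => ?_
    rw [ih (n - j) (by rw [Finset.mem_Icc] at hj; omega)]

section HPlethysm

theorem hPlethysm_zero (f : SymPS) : hPlethysm 0 f = 1 := by
  simp [hPlethysm, zPart]

theorem hPlethysm_eq_sum_multiplicityWeight (m : ℕ) (f : SymPS) :
    hPlethysm m f = ∑ lam : m.Partition, multiplicityWeight
      (fun i a => ((i ^ a * a.factorial : ℕ) : ℂ)⁻¹ • powerPlethysm i f ^ a) lam.parts := by
  refine Finset.sum_congr rfl fun lam _ => ?_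
  rw [multiplicityWeight, zPart, Finset.prod_multiset_map_count, Finset.prod_smul,
    Nat.cast_prod, Finset.prod_inv_distrib]

theorem natCast_mul_inv_smul_pow {K A : Type*} [Field K] [CharZero K] [Semiring A] [Algebra K A]
    (i m : ℕ) (x : A) :
    (m : A) * (((i ^ m * m.factorial : ℕ) : K)⁻¹ • x ^ m) =
      ∑ k ∈ Finset.Icc 1 m, (if k = 1 then (i : K)⁻¹ • x else 0) *
        (((i ^ (m - k) * (m - k).factorial : ℕ) : K)⁻¹ • x ^ (m - k)) := by
  rcases m with _ | m
  · simp
  simp only [ite_mul, zero_mul]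
  rw [Finset.sum_ite_eq' _ 1, if_pos (Finset.left_mem_Icc.2 (Nat.le_add_left 1 m)),
    Nat.add_sub_cancel, smul_mul_smul_comm, ← pow_succ', ← nsmul_eq_mul,
    ← Nat.cast_smul_eq_nsmul K, smul_smul, Nat.factorial_succ, pow_succ]
  congr 1
  push_cast
  have hm : (m : K) + 1 ≠ 0 := Nat.cast_add_one_ne_zero m
  simp only [mul_inv]
  field_simp

/-- Newton's identity `m h_m = ∑_k p_k h_{m - k}`, substituted into `f`. -/
theorem natCast_mul_hPlethysm (m : ℕ) (f : SymPS) :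
    (m : SymPS) * hPlethysm m f =
      ∑ k ∈ Finset.Icc 1 m, powerPlethysm k f * hPlethysm (m - k) f := by
  simp only [hPlethysm_eq_sum_multiplicityWeight]
  rw [natCast_mul_sum_multiplicityWeight (by simp) fun i m =>
    natCast_mul_inv_smul_pow i m (powerPlethysm i f)]
  refine Finset.sum_congr rfl fun j hj => congrArg (· * _) ?_
  have hj0 : j ≠ 0 := Nat.one_le_iff_ne_zero.1 (Finset.mem_Icc.1 hj).1
  rw [Finset.sum_eq_single_of_mem (j, 1) (Nat.mem_divisorsAntidiagonal.2 ⟨mul_one j, hj0⟩)]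
  · rw [if_pos rfl, ← nsmul_eq_mul, ← Nat.cast_smul_eq_nsmul ℂ,
      smul_inv_smul₀ (Nat.cast_ne_zero.2 hj0)]
  · rintro ⟨i, k⟩ hx hne
    rw [Nat.mem_divisorsAntidiagonal] at hx
    rw [if_neg, mul_zero]
    rintro rfl
    exact hne (by rw [← hx.1, mul_one])

end HPlethysm

section CyclicGroups

theorem modL_eq_cycleIndex (S : Set ℕ) (n : ℕ) [NeZero n] :
    modL S n = cycleIndex (cyclicInclusion n)
      ((ZMod.stdAddChar (N := n)).mulShift (primesPart S n : ZMod n)).toMonoidHom := by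
  rw [modL, dif_neg (NeZero.ne n)]
  exact frobeniusChar_ind_linearRep _ _

theorem isCycleIndex_modL (S : Set ℕ) {n : ℕ} (hn : n ≠ 0) : IsCycleIndex (modL S n) :=
  have : NeZero n := ⟨hn⟩
  ⟨Multiplicative (ZMod n), ZMod n, inferInstance, inferInstance, inferInstance, inferInstance,
    _, _, modL_eq_cycleIndex S n⟩

theorem schurPositive_symmetricPower_modL (S : Set ℕ) (n : ℕ) :
    SchurPositive (symmetricPower (modL S) n) := by
  refine schurPositive_sum _ _ fun lam _ => (isCycleIndex_prod _ _ fun i hi => ?_).schurPositive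
  exact (isCycleIndex_modL S (lam.parts_pos (Multiset.mem_toFinset.1 hi)).ne').hPlethysm _

theorem powerSumPart_addLeft {A : Type*} [AddGroup A] [Fintype A] [DecidableEq A] (a : A) :
    powerSumPart (Equiv.addLeft a).partition =
      powerSum (addOrderOf a) ^ (Fintype.card A / addOrderOf a) := by
  have hparts : (Equiv.addLeft a).partition.parts =
      Multiset.replicate (Fintype.card A / addOrderOf a) (addOrderOf a) := by
    refine parts_partition_eq_replicate ?_ (fun m x hm hlt hx => ?_) (addOrderOf_pos a).ne'
    · rw [Equiv.nsmul_addLeft, addOrderOf_nsmul_eq_zero, Equiv.addLeft_zero]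
    · rw [Equiv.nsmul_addLeft, Equiv.coe_addLeft, add_eq_right] at hx
      exact nsmul_ne_zero_of_lt_addOrderOf hm.ne' hlt hx
  rw [powerSumPart, hparts, Multiset.map_replicate, Multiset.prod_replicate]

theorem image_stdAddChar (n : ℕ) [NeZero n] :
    Finset.univ.image (ZMod.stdAddChar (N := n)) = Polynomial.nthRootsFinset n (1 : ℂ) := by
  refine Finset.eq_of_subset_of_card_le (Finset.image_subset_iff.2 fun k _ => ?_) ?_
  · rw [Polynomial.mem_nthRootsFinset (NeZero.pos n), ← AddChar.map_nsmul_eq_pow]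
    simp
  · rw [Finset.card_image_of_injective _ ZMod.injective_stdAddChar, Finset.card_univ, ZMod.card,
      Polynomial.nthRootsFinset_def]
    exact (Multiset.toFinset_card_le _).trans (Polynomial.card_nthRoots n 1)

theorem orderOf_stdAddChar {n : ℕ} [NeZero n] (a : ZMod n) :
    orderOf (ZMod.stdAddChar a : ℂ) = addOrderOf a :=
  (orderOf_injective ZMod.stdAddChar.toMonoidHom ZMod.injective_stdAddChar
    (Multiplicative.ofAdd a)).trans (orderOf_ofAdd_eq_addOrderOf a)

theorem natCast_smul_modL (S : Set ℕ) {n : ℕ} (hn : n ≠ 0) :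
    (n : ℂ) • modL S n = ∑ ζ ∈ Polynomial.nthRootsFinset n (1 : ℂ),
      ζ ^ primesPart S n • powerSum (orderOf ζ) ^ (n / orderOf ζ) := by
  have : NeZero n := ⟨hn⟩
  have hcard : (Fintype.card (Multiplicative (ZMod n)) : ℂ) = n := by
    rw [Fintype.card_multiplicative, ZMod.card]
  have cyclicInclusion_eq (a : ZMod n) :
      cyclicInclusion n (Multiplicative.ofAdd a) = Equiv.addLeft a := Equiv.ext fun _ => rfl
  rw [modL_eq_cycleIndex, cycleIndex, hcard, smul_inv_smul₀ (Nat.cast_ne_zero.2 hn),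
    ← image_stdAddChar, Finset.sum_image ZMod.injective_stdAddChar.injOn,
    ← Multiplicative.ofAdd.sum_comp]
  refine Finset.sum_congr rfl fun a _ => ?_
  rw [cyclicInclusion_eq, powerSumPart_addLeft, orderOf_stdAddChar, ZMod.card]
  exact congrArg (· • _) (AddChar.mulShift_spec' ZMod.stdAddChar (primesPart S n) a)

end CyclicGroups

section PrimesPart

variable {T : Set ℕ}

theorem primesPart_mul (T : Set ℕ) {a b : ℕ} (ha : a ≠ 0) (hb : b ≠ 0) :
    primesPart T (a * b) = primesPart T a * primesPart T b := by
  rw [primesPart, Nat.factorization_mul ha hb]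
  refine Finsupp.prod_add_index' (fun q => ?_) fun q x y => ?_
  · rw [pow_zero, ite_self]
  · split_ifs
    · exact pow_add q x y
    · rfl

theorem primesPart_dvd_primesPart (T : Set ℕ) {a b : ℕ} (hb : b ≠ 0) (h : a ∣ b) :
    primesPart T a ∣ primesPart T b := by
  obtain ⟨c, rfl⟩ := h
  rw [primesPart_mul T (left_ne_zero_of_mul hb) (right_ne_zero_of_mul hb)]
  exact dvd_mul_right _ _

theorem primesPart_of_prime_of_notMem {q : ℕ} (hq : q.Prime) (hqT : q ∉ T) :
    primesPart T q = 1 := by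
  rw [primesPart, hq.factorization, Finsupp.prod_single_index (by rw [pow_zero, ite_self]),
    if_neg hqT]

theorem primesPart_of_mem_primeMonoid {n : ℕ} (h : n ∈ primeMonoid T) : primesPart T n = n := by
  have hn : n ≠ 0 := Nat.one_le_iff_ne_zero.1 h.1
  conv_rhs => rw [← Nat.prod_factorization_pow_eq_self hn]
  rw [primesPart, Finsupp.prod, Finsupp.prod]
  refine Finset.prod_congr rfl fun q hq => ?_
  exact if_pos (h.2 q (Nat.prime_of_mem_primeFactors hq) (Nat.dvd_of_mem_primeFactors hq))

theorem coprime_primesPart {q : ℕ} (hq : q.Prime) (hqT : q ∉ T) (n : ℕ) :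
    (primesPart T n).Coprime q := by
  rw [primesPart, Finsupp.prod]
  refine Nat.Coprime.prod_left fun p hp => ?_
  split_ifs with hpT
  · refine Nat.Coprime.pow_left _ ((Nat.coprime_primes (Nat.prime_of_mem_primeFactors hp) hq).2 ?_)
    rintro rfl
    exact hqT hpT
  · exact Nat.coprime_one_left q

theorem primesPart_eq_of_dvd_mul {q : ℕ} (hq : q.Prime) (hqT : q ∉ T) {a b : ℕ}
    (hab : a ∣ q * b) (hba : b ∣ q * a) : primesPart T a = primesPart T b := by
  have dvd_of_dvd_mul {a b : ℕ} (hb : b ≠ 0) (h : a ∣ q * b) : primesPart T a ∣ primesPart T b := by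
    simpa only [primesPart_mul T hq.ne_zero hb, primesPart_of_prime_of_notMem hq hqT, one_mul]
      using primesPart_dvd_primesPart T (mul_ne_zero hq.ne_zero hb) h
  rcases eq_or_ne a 0 with rfl | ha
  · rw [zero_dvd_iff, mul_eq_zero] at hab
    rw [hab.resolve_left hq.ne_zero]
  rcases eq_or_ne b 0 with rfl | hb
  · rw [zero_dvd_iff, mul_eq_zero] at hba
    exact absurd (hba.resolve_left hq.ne_zero) ha
  · exact Nat.dvd_antisymm (dvd_of_dvd_mul hb hab) (dvd_of_dvd_mul ha hba)

theorem primesPart_mul_orderOf_mul {M : Type*} [CommMonoid M] {q : ℕ} (hq : q.Prime) (hqT : q ∉ T)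
    (m : ℕ) (x : M) {y : M} (hy : y ^ q = 1) :
    primesPart T (m * orderOf (x * y)) = primesPart T (m * orderOf x) := by
  have mul_pow_eq (a : ℕ) : (x * y) ^ (q * a) = x ^ (q * a) := by
    rw [mul_pow, pow_mul y, hy, one_pow, mul_one]
  refine primesPart_eq_of_dvd_mul hq hqT ?_ ?_ <;>
    rw [mul_left_comm] <;>
    refine Nat.mul_dvd_mul_left m (orderOf_dvd_of_pow_eq_one ?_)
  · rw [mul_pow_eq, mul_comm q, pow_mul, pow_orderOf_eq_one, one_pow]
  · rw [← mul_pow_eq, mul_comm q, pow_mul, pow_orderOf_eq_one, one_pow]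

end PrimesPart

section RootsOfUnity

theorem sum_nthRootsFinset_mul {K M : Type*} [Field K] [AddCommMonoid M] {n : ℕ} (hn : 0 < n)
    {η : K} (hη : η ^ n = 1) (F : K → M) :
    ∑ ζ ∈ Polynomial.nthRootsFinset n (1 : K), F (ζ * η) =
      ∑ ζ ∈ Polynomial.nthRootsFinset n (1 : K), F ζ := by
  have hη0 : η ≠ 0 := by
    rintro rfl
    exact zero_ne_one ((zero_pow hn.ne').symm.trans hη)
  refine Finset.sum_nbij' (· * η) (· * η⁻¹) (fun ζ hζ => ?_) (fun ζ hζ => ?_)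
    (fun ζ _ => mul_inv_cancel_right₀ hη0 ζ) (fun ζ _ => inv_mul_cancel_right₀ hη0 ζ)
    fun _ _ => rfl
  all_goals
    rw [Polynomial.mem_nthRootsFinset hn] at hζ ⊢
    simp only [mul_pow, inv_pow, hζ, hη, inv_one, mul_one]

theorem sum_nthRootsFinset_pow_eq_zero {K : Type*} [Field K] {q n : ℕ} (hq : 1 < q) (hn : 0 < n)
    (hqn : q ∣ n) {η : K} (hη : IsPrimitiveRoot η q) {e : K → ℕ}
    (he : ∀ j ζ, e (ζ * η ^ j) = e ζ) (hcop : ∀ ζ, (e ζ).Coprime q) :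
    ∑ ζ ∈ Polynomial.nthRootsFinset n (1 : K), ζ ^ e ζ = 0 := by
  have : NeZero q := ⟨(zero_lt_one.trans hq).ne'⟩
  refine (mul_eq_zero.1 ?_).resolve_left hη.neZero'.out
  calc (q : K) * ∑ ζ ∈ Polynomial.nthRootsFinset n (1 : K), ζ ^ e ζ
      = ∑ j ∈ Finset.range q, ∑ ζ ∈ Polynomial.nthRootsFinset n (1 : K),
          (ζ * η ^ j) ^ e (ζ * η ^ j) := by
        rw [← nsmul_eq_mul, ← Finset.card_range q, ← Finset.sum_const, Finset.card_range]
        refine Finset.sum_congr rfl fun j _ => (sum_nthRootsFinset_mul hn ?_ _).symm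
        rw [← pow_mul, hη.pow_eq_one_iff_dvd]
        exact hqn.mul_left j
    _ = ∑ ζ ∈ Polynomial.nthRootsFinset n (1 : K),
          ζ ^ e ζ * ∑ j ∈ Finset.range q, (η ^ e ζ) ^ j := by
        rw [Finset.sum_comm]
        simp only [he, mul_pow, Finset.mul_sum, ← pow_mul, mul_comm]
    _ = 0 := Finset.sum_eq_zero fun ζ _ => by
        rw [(hη.pow_of_coprime _ (hcop ζ)).geom_sum_eq_zero hq, mul_zero]

open Classical in
theorem sum_nthRootsFinset_pow_primesPart (T : Set ℕ) {m n : ℕ} (hm : m ≠ 0) (hn : n ≠ 0) :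
    ∑ ζ ∈ Polynomial.nthRootsFinset n (1 : ℂ), ζ ^ primesPart T (m * orderOf ζ) =
      if n ∈ primeMonoid T then (n : ℂ) else 0 := by
  have hn' := Nat.pos_of_ne_zero hn
  split_ifs with h
  · have pow_eq_one : ∀ ζ ∈ Polynomial.nthRootsFinset n (1 : ℂ),
        ζ ^ primesPart T (m * orderOf ζ) = 1 := by
      intro ζ hζ
      have hdvd := orderOf_dvd_of_pow_eq_one ((Polynomial.mem_nthRootsFinset hn' _).1 hζ)
      have hpos := Nat.pos_of_dvd_of_pos hdvd hn'
      have hmem : orderOf ζ ∈ primeMonoid T := ⟨hpos, fun q hq hqd => h.2 q hq (hqd.trans hdvd)⟩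
      rw [← orderOf_dvd_iff_pow_eq_one, primesPart_mul T hm hpos.ne',
        primesPart_of_mem_primeMonoid hmem]
      exact dvd_mul_left _ _
    rw [Finset.sum_congr rfl pow_eq_one, Finset.sum_const, nsmul_one,
      (Complex.isPrimitiveRoot_exp n hn).card_nthRootsFinset]
  · obtain ⟨q, hq, hqn, hqT⟩ : ∃ q : ℕ, q.Prime ∧ q ∣ n ∧ q ∉ T := by
      by_contra! hall
      exact h ⟨hn', hall⟩
    have hη := Complex.isPrimitiveRoot_exp q hq.ne_zero
    refine sum_nthRootsFinset_pow_eq_zero hq.one_lt hn' hqn hη (fun j ζ => ?_) fun ζ =>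
      coprime_primesPart hq hqT _
    exact primesPart_mul_orderOf_mul hq hqT m ζ
      (by rw [← pow_mul, mul_comm j, pow_mul, hη.pow_eq_one, one_pow])

theorem sum_nthRootsFinset_eq_sum_divisors {R M : Type*} [CommRing R] [IsDomain R]
    [AddCommMonoid M] (n : ℕ) (F : R → ℕ → M) :
    ∑ ζ ∈ Polynomial.nthRootsFinset n (1 : R), F ζ (orderOf ζ) =
      ∑ d ∈ n.divisors, ∑ ζ ∈ primitiveRoots d R, F ζ d := by
  classical
  rw [IsPrimitiveRoot.nthRoots_one_eq_biUnion_primitiveRoots, Finset.sum_biUnion]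
  · refine Finset.sum_congr rfl fun d _ => Finset.sum_congr rfl fun ζ hζ => ?_
    rw [← (isPrimitiveRoot_of_mem_primitiveRoots hζ).eq_orderOf]
  · exact fun d _ e _ hde => IsPrimitiveRoot.disjoint hde

end RootsOfUnity

section CyclicGroupsNewton

theorem sum_divisorsAntidiagonal_right_comm {M : Type*} [AddCommMonoid M] (n : ℕ)
    (F : ℕ → ℕ → ℕ → M) :
    ∑ x ∈ n.divisorsAntidiagonal, ∑ y ∈ x.1.divisorsAntidiagonal, F y.1 y.2 x.2 =
      ∑ x ∈ n.divisorsAntidiagonal, ∑ y ∈ x.1.divisorsAntidiagonal, F y.1 x.2 y.2 := by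
  let swap (z : (_ : ℕ × ℕ) × ℕ × ℕ) : (_ : ℕ × ℕ) × ℕ × ℕ :=
    ⟨(z.2.1 * z.1.2, z.2.2), (z.2.1, z.1.2)⟩
  have swap_mem : ∀ z ∈ n.divisorsAntidiagonal.sigma fun x => x.1.divisorsAntidiagonal,
      swap z ∈ n.divisorsAntidiagonal.sigma fun x => x.1.divisorsAntidiagonal := by
    rintro ⟨⟨i, k⟩, d, e⟩ hz
    simp only [swap, Finset.mem_sigma, Nat.mem_divisorsAntidiagonal] at hz ⊢
    obtain ⟨⟨rfl, hn⟩, rfl, hi⟩ := hz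
    exact ⟨⟨mul_right_comm d k e, hn⟩, trivial,
      mul_ne_zero (left_ne_zero_of_mul hi) (right_ne_zero_of_mul hn)⟩
  have swap_swap : ∀ z ∈ n.divisorsAntidiagonal.sigma fun x => x.1.divisorsAntidiagonal,
      swap (swap z) = z := by
    rintro ⟨⟨i, k⟩, d, e⟩ hz
    simp only [Finset.mem_sigma, Nat.mem_divisorsAntidiagonal] at hz
    simp only [swap, hz.2.1]
  rw [Finset.sum_sigma', Finset.sum_sigma']
  exact Finset.sum_nbij' swap swap swap_mem swap_mem swap_swap swap_swap fun _ _ => rfl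

theorem natCast_mul_powerPlethysm_modL (T : Set ℕ) {k n : ℕ} (hk : k ≠ 0) (hn : n ≠ 0) :
    (n : SymPS) * powerPlethysm k (modL T n) = ∑ x ∈ n.divisorsAntidiagonal,
      (∑ ζ ∈ primitiveRoots x.1 ℂ, ζ ^ primesPart T (x.2 * x.1)) • powerSum (x.1 * k) ^ x.2 := by
  rw [← nsmul_eq_mul, ← Nat.cast_smul_eq_nsmul ℂ, ← powerPlethysm_smul, natCast_smul_modL T hn,
    sum_nthRootsFinset_eq_sum_divisors n
      fun ζ d => ζ ^ primesPart T n • powerSum d ^ (n / d),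
    ← Nat.sum_divisorsAntidiagonal fun d e =>
      ∑ ζ ∈ primitiveRoots d ℂ, ζ ^ primesPart T n • powerSum d ^ e, powerPlethysm_sum]
  refine Finset.sum_congr rfl fun x hx => ?_
  obtain ⟨hx, -⟩ := Nat.mem_divisorsAntidiagonal.1 hx
  rw [← Finset.sum_smul, powerPlethysm_smul, powerPlethysm_pow hk,
    powerPlethysm_powerSum hk (left_ne_zero_of_mul (hx.trans_ne hn)), mul_comm x.2, hx, mul_comm k]

open Classical in
theorem sum_divisorsAntidiagonal_powerPlethysm_modL (T : Set ℕ) (n : ℕ) :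
    ∑ x ∈ n.divisorsAntidiagonal, (x.1 : SymPS) * powerPlethysm x.2 (modL T x.1) =
      ∑ x ∈ n.divisorsAntidiagonal, (x.1 : SymPS) *
        if x.1 ∈ primeMonoid T then powerSum x.1 ^ x.2 else 0 := by
  calc _ = ∑ x ∈ n.divisorsAntidiagonal, ∑ y ∈ x.1.divisorsAntidiagonal,
          (∑ ζ ∈ primitiveRoots y.1 ℂ, ζ ^ primesPart T (y.2 * y.1)) •
            powerSum (y.1 * x.2) ^ y.2 := by
        refine Finset.sum_congr rfl fun x hx => ?_
        obtain ⟨rfl, hn⟩ := Nat.mem_divisorsAntidiagonal.1 hx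
        exact natCast_mul_powerPlethysm_modL T (right_ne_zero_of_mul hn) (left_ne_zero_of_mul hn)
    _ = ∑ x ∈ n.divisorsAntidiagonal, ∑ y ∈ x.1.divisorsAntidiagonal,
          (∑ ζ ∈ primitiveRoots y.1 ℂ, ζ ^ primesPart T (x.2 * y.1)) •
            powerSum (y.1 * y.2) ^ x.2 :=
      sum_divisorsAntidiagonal_right_comm n fun d e k =>
        (∑ ζ ∈ primitiveRoots d ℂ, ζ ^ primesPart T (e * d)) • powerSum (d * k) ^ e
    _ = _ := by
        refine Finset.sum_congr rfl fun x hx => ?_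
        obtain ⟨rfl, hn⟩ := Nat.mem_divisorsAntidiagonal.1 hx
        rw [Finset.sum_congr rfl fun y hy => by rw [(Nat.mem_divisorsAntidiagonal.1 hy).1],
          ← Finset.sum_smul, Nat.sum_divisorsAntidiagonal fun d _ =>
            ∑ ζ ∈ primitiveRoots d ℂ, ζ ^ primesPart T (x.2 * d),
          ← sum_nthRootsFinset_eq_sum_divisors x.1 fun ζ d => ζ ^ primesPart T (x.2 * d),
          sum_nthRootsFinset_pow_primesPart T (right_ne_zero_of_mul hn) (left_ne_zero_of_mul hn),
          ite_smul, zero_smul, Nat.cast_smul_eq_nsmul, nsmul_eq_mul, mul_ite, mul_zero]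

end CyclicGroupsNewton

section PowerSumSums

open Classical in
/-- The weights `p_i ^ m` restricted to parts `i ∈ P`: their multiplicity weights are the `p_lam`
with all parts in `P`. The case `m = 0` is kept for every `i`, so that absent parts weigh `1`. -/
noncomputable def powerSumWeight (P : Set ℕ) (i m : ℕ) : SymPS :=
  if i ∈ P ∨ m = 0 then powerSum i ^ m else 0

theorem powerSumWeight_zero (P : Set ℕ) (i : ℕ) : powerSumWeight P i 0 = 1 := by
  rw [powerSumWeight, if_pos (Or.inr rfl), pow_zero]

theorem powerSumSum_eq_sum_multiplicityWeight (P : Set ℕ) (n : ℕ) :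
    powerSumSum P n = ∑ lam : n.Partition, multiplicityWeight (powerSumWeight P) lam.parts := by
  classical
  rw [powerSumSum, Finset.sum_filter]
  refine Finset.sum_congr rfl fun lam _ => ?_
  split_ifs with h
  · rw [powerSumPart, Finset.prod_multiset_map_count]
    exact Finset.prod_congr rfl fun i hi =>
      (if_pos (Or.inl (h i (Multiset.mem_toFinset.1 hi)))).symm
  · push Not at h
    obtain ⟨i, hi, hiP⟩ := h
    exact (Finset.prod_eq_zero (Multiset.mem_toFinset.2 hi)
      (if_neg (not_or.2 ⟨hiP, Multiset.count_ne_zero.2 hi⟩))).symm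

open Classical in
theorem natCast_mul_powerSumWeight (P : Set ℕ) (i m : ℕ) :
    (m : SymPS) * powerSumWeight P i m = ∑ k ∈ Finset.Icc 1 m,
      (if i ∈ P then powerSum i ^ k else 0) * powerSumWeight P i (m - k) := by
  by_cases h : i ∈ P
  · have weight (a : ℕ) : powerSumWeight P i a = powerSum i ^ a := if_pos (Or.inl h)
    rw [Finset.sum_congr rfl (g := fun _ => powerSum i ^ m) fun k hk => by
        rw [if_pos h, weight, ← pow_add, Nat.add_sub_cancel' (Finset.mem_Icc.1 hk).2],
      Finset.sum_const, Nat.card_Icc, Nat.add_sub_cancel, nsmul_eq_mul, weight]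
  · rw [Finset.sum_eq_zero fun k _ => by rw [if_neg h, zero_mul]]
    rcases eq_or_ne m 0 with rfl | hm
    · rw [Nat.cast_zero, zero_mul]
    · rw [powerSumWeight, if_neg (not_or.2 ⟨h, hm⟩), mul_zero]

theorem natCast_mul_symmetricPower (Q : ℕ → SymPS) (n : ℕ) :
    (n : SymPS) * symmetricPower Q n = ∑ j ∈ Finset.Icc 1 n,
      (∑ x ∈ j.divisorsAntidiagonal, (x.1 : SymPS) * powerPlethysm x.2 (Q x.1)) *
        symmetricPower Q (n - j) :=
  natCast_mul_sum_multiplicityWeight (f := fun i m => hPlethysm m (Q i))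
    (c := fun i k => powerPlethysm k (Q i)) (fun i => hPlethysm_zero (Q i))
    (fun i m => natCast_mul_hPlethysm m (Q i)) n

open Classical in
theorem natCast_mul_powerSumSum (P : Set ℕ) (n : ℕ) :
    (n : SymPS) * powerSumSum P n = ∑ j ∈ Finset.Icc 1 n,
      (∑ x ∈ j.divisorsAntidiagonal,
          (x.1 : SymPS) * if x.1 ∈ P then powerSum x.1 ^ x.2 else 0) *
        powerSumSum P (n - j) := by
  simp only [powerSumSum_eq_sum_multiplicityWeight]
  exact natCast_mul_sum_multiplicityWeight (powerSumWeight_zero P) (natCast_mul_powerSumWeight P) n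

theorem powerSumSum_eq_symmetricPower (T : Set ℕ) (n : ℕ) :
    powerSumSum (primeMonoid T) n = symmetricPower (modL T) n := by
  have : IsAddTorsionFree SymPS := .of_module_rat _
  have h0 : powerSumSum (primeMonoid T) 0 = symmetricPower (modL T) 0 := by
    simp [powerSumSum, powerSumPart, symmetricPower, higherH]
  refine eq_of_natCast_mul_eq_sum h0 (natCast_mul_powerSumSum _) (fun m => ?_) n
  simp only [natCast_mul_symmetricPower, sum_divisorsAntidiagonal_powerPlethysm_modL]

end PowerSumSums

theorem mainTheorem8 (S : Set ℕ) (hS : ∀ q ∈ S, q.Prime) (n : ℕ) :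
    (SchurPositive (powerSumSum (primeMonoid S) n) ∧
      powerSumSum (primeMonoid S) n = symmetricPower (modL S) n) ∧
    (SchurPositive (powerSumSum (primeMonoid (primesCompl S)) n) ∧
      powerSumSum (primeMonoid (primesCompl S)) n = symmetricPower (modL (primesCompl S)) n) := by
  have schurPositive_and_eq (T : Set ℕ) : SchurPositive (powerSumSum (primeMonoid T) n) ∧
      powerSumSum (primeMonoid T) n = symmetricPower (modL T) n := by
    rw [powerSumSum_eq_symmetricPower]
    exact ⟨schurPositive_symmetricPower_modL T n, rfl⟩
  exact ⟨schurPositive_and_eq S, schurPositive_and_eq (primesCompl S)⟩
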